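/- **Setting.** Let $\bar W$ be a compact complex threefold and $D\subset\bar W$ a smooth closed divisor with an open neighbourhood $U$, a holomorphic function $z$ on $U$ with $dz\neq0$ and $D=\{z=0\}$, and a smooth retraction $\pi:U\to D$ such that $(\pi,z):U\to D\times\{|z|<1\}$ is a diffeomorphism. On the cylindrical end $U\smallsetminus D$ write $z=e^{-s-\mathbf i\alpha}$, and set $W=\bar W\smallsetminus D$. Let $\kappa$ be a smooth Hermitian metric on $D$ (denote also by $\kappa$ its fundamental form) and let $\omega$ be a Kähler form on $W$ which is exponentially asymptotic, with rate $\lambda>0$, to the cylindrical form $\omega_\infty=\pi^*\kappa+ds\wedge d\alpha$: $|\omega-\omega_\infty|_{\omega_\infty}=O(e^{-\lambda s})$ as $s\to\infty$. (This includes the asymptotically cylindrical Calabi--Yau threefolds of the Calabi--Yau--Tian--Kovalev theorem, where $D$ is a K3 surface with Ricci-flat Kähler form $\kappa$ and $\lambda$ is any positive number smaller than $\min\{1,\sqrt{\lambda_1(D)}\}$, $\lambda_1(D)$ being the first eigenvalue of the Laplacian of $\kappa$.) Let $\mathcal E\to\bar W$ be a holomorphic vector bundle of rank $r$. For a Hermitian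 metric $H$ on $\mathcal E|_W$, let $F_H$ be the curvature of its Chern connection, $\hat F_H=(F_H,\omega)=\Lambda_\omega F_H$ (normalized by $\Lambda_\omega\omega=3$), and $\hat e_H=|\hat F_H|_H^2=\operatorname{tr}(\hat F_H\hat F_H^{*_H})$. Let $H_0$ be a smooth Hermitian metric on $\mathcal E\to\bar W$ whose restriction to $\mathcal E|_D$ is Hermitian Yang--Mills with respect to $\kappa$, i.e. $\Lambda_\kappa F_{H_0|_D}=0$. For $T>0$ consider any smooth family $\{H_t\}_{0\le t\le T}$ of Hermitian metrics on $\mathcal E\to W$ solving $$H^{-1}\frac{\partial H}{\partial t}=-2\mathbf i\hat F_H\quad\text{on }W\times[0,T],\qquad H(0)=H_0,$$ and bounded, in the sense that $K^{-1}H_0\le H_t\le KH_0$ on $W\times[0,T]$ for some constant $K$. Write $\hat e_t=\hat e_{H_t}$, and let $\epsilon=e^{-s}$ on $U\smallsetminus D$, $\epsilon=1$ on $\bar W\smallsetminus U$. Put $\mu_0=\min\{1,2\lambda\}$. **Proposition.** There is a constant $C\ge1$, depending only on $r$ and on the data $(\bar W,D,U,z,\pi,\kappa,\omega,\lambda)$,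 such that for all $\mathcal E$ and $H_0$ as above: 1. There is a constant $B$ with $\hat e_0\le B\epsilon^{\mu_0}$ on $W$. 2. Let $\mu\in(0,1]$ and let $B$ be any constant with $\hat e_0\le B\epsilon^\mu$ on $W$. Then, for every $T>0$, every solution $\{H_t\}_{0\le t\le T}$ as above and every $t\in[0,T]$, $$\hat e_t\le (C\,B\,e^{t})\,\epsilon^{\mu}\quad\text{on }W.$$ In particular, if $\hat e_0\le B\epsilon$ then $\hat e_t\le (CBe^t)\epsilon$; by 1 such a $B$ exists whenever $\lambda\ge\frac12$. 3. Hence $\hat F_{H_t}$ decays exponentially along the tube for each finite $t$: there is a constant $B'$, independent of $T$, $t$ and of the solution, with $|\hat F_{H_t}|_{H_t}\le B'e^{t/2}e^{-\mu_0s/2}$ on $U\smallsetminus D$. -/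

import Mathlib

open Set
open scoped Manifold ContDiff Matrix ComplexConjugate

noncomputable section

/-- The Wirtinger derivative `∂f/∂z_j` of a real differentiable function. -/
def dz {n : ℕ} (j : Fin n) (f : (Fin n → ℂ) → ℂ) (u : Fin n → ℂ) : ℂ :=
  (fderiv ℝ f u (Pi.single j 1) - Complex.I * fderiv ℝ f u (Pi.single j Complex.I)) / 2

/-- The Wirtinger derivative `∂f/∂z̄_j` of a real differentiable function. -/
def dzbar {n : ℕ} (j : Fin n) (f : (Fin n → ℂ) → ℂ) (u : Fin n → ℂ) : ℂ :=
  (fderiv ℝ f u (Pi.single j 1) + Complex.I * fderiv ℝ f u (Pi.single j Complex.I)) / 2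

section Bundle

variable {X : Type*} [TopologicalSpace X] [ChartedSpace (Fin 3 → ℂ) X]
variable (r : ℕ) {E : X → Type*} [∀ x, AddCommGroup (E x)] [∀ x, Module ℂ (E x)]
  [∀ x, TopologicalSpace (E x)] [TopologicalSpace (Bundle.TotalSpace (Fin r → ℂ) E)]
  [FiberBundle (Fin r → ℂ) E] [VectorBundle ℂ (Fin r → ℂ) E]

/-- The `i`-th vector, at `y`, of the local frame of `E` given by the preferred trivialization
around `x₀`. For a holomorphic vector bundle this is a holomorphic frame; for the tangent bundle it
is the coordinate frame of the preferred chart at `x₀`. -/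
def localFrame (x₀ : X) (i : Fin r) (y : X) : E y :=
  (trivializationAt (Fin r → ℂ) E x₀).symm y (Pi.single i 1)

/-- The Gram matrix `H(e_i, e_j)` (antilinear in `e_i`) of a field of sesquilinear forms, in the
frame around `x₀`, as a function of the coordinates around `x₀`. -/
def gram (H : ∀ x, E x →ₗ⋆[ℂ] E x →ₗ[ℂ] ℂ) (x₀ : X) (u : Fin 3 → ℂ) : Matrix (Fin r) (Fin r) ℂ :=
  Matrix.of fun i j =>
    H ((chartAt (Fin 3 → ℂ) x₀).symm u) (localFrame r x₀ i _) (localFrame r x₀ j _)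

variable (E) in
/-- The coordinates, in the preferred chart around `x₀`, of the points of `S` over which the
preferred frame around `x₀` is defined. -/
def frameDomain (x₀ : X) (S : Set X) : Set (Fin 3 → ℂ) :=
  (chartAt (Fin 3 → ℂ) x₀).target ∩ (chartAt (Fin 3 → ℂ) x₀).symm ⁻¹'
    ((trivializationAt (Fin r → ℂ) E x₀).baseSet ∩ S)

/-- `H` is a smooth Hermitian metric on the bundle `E` over the (open) set `S`. -/
structure IsHermitianMetricOn (H : ∀ x, E x →ₗ⋆[ℂ] E x →ₗ[ℂ] ℂ) (S : Set X) : Prop where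
  symm : ∀ x ∈ S, ∀ v w, H x v w = conj (H x w v)
  pos : ∀ x ∈ S, ∀ v, v ≠ 0 → 0 < (H x v v).re
  smooth : ∀ x₀ i j, ContDiffOn ℝ ∞ (fun u => gram r H x₀ u i j) (frameDomain r E x₀ S)

/-- The matrix `A_j = G⁻¹ ∂_j G` of the Chern connection in a holomorphic frame with Gram
matrix `G`. -/
def chernForm (H : ∀ x, E x →ₗ⋆[ℂ] E x →ₗ[ℂ] ℂ) (x₀ : X) (j : Fin 3) (u : Fin 3 → ℂ) :
    Matrix (Fin r) (Fin r) ℂ :=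
  (gram r H x₀ u)⁻¹ * Matrix.of fun a b => dz j (fun v => gram r H x₀ v a b) u

/-- The coefficient `F_{j k̄} = - ∂̄_k (G⁻¹ ∂_j G)` at `x` of the curvature
`F = ∑ F_{j k̄} dz_j ∧ dz̄_k` of the Chern connection of `H`, in the preferred chart and frame
around `x`. -/
def chernCurvature (H : ∀ x, E x →ₗ⋆[ℂ] E x →ₗ[ℂ] ℂ) (x : X) (j k : Fin 3) :
    Matrix (Fin r) (Fin r) ℂ :=
  Matrix.of fun a b =>
    - dzbar k (fun u => chernForm r H x j u a b) (chartAt (Fin 3 → ℂ) x x)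

end Bundle

section Kahler

variable {X : Type*} [TopologicalSpace X] [ChartedSpace (Fin 3 → ℂ) X]
  [IsManifold 𝓘(ℂ, Fin 3 → ℂ) ω X]

/-- A field of sesquilinear forms `h` on the tangent spaces, antilinear in the first variable. If
`h` is a Hermitian metric then `Re h` is the Riemannian metric and `Im h` the fundamental form. -/
abbrev TangentForm (X : Type*) [TopologicalSpace X] [ChartedSpace (Fin 3 → ℂ) X] :=
  ∀ x : X, TangentSpace 𝓘(ℂ, Fin 3 → ℂ) x →ₗ⋆[ℂ] TangentSpace 𝓘(ℂ, Fin 3 → ℂ) x →ₗ[ℂ] ℂ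

/-- `h` is a smooth Kähler metric over the open set `S`. With `h_{k̄ j} = h(∂_k, ∂_j)` the
fundamental form is `(i/2) ∑ h_{k̄ j} dz_j ∧ dz̄_k`; the second condition says that it is closed. -/
def IsKahlerOn (h : TangentForm X) (S : Set X) : Prop :=
  IsHermitianMetricOn 3 h S ∧
  ∀ x ∈ S, ∀ j k l : Fin 3,
    dz l (fun u => gram 3 h x u k j) (chartAt (Fin 3 → ℂ) x x) =
      dz j (fun u => gram 3 h x u k l) (chartAt (Fin 3 → ℂ) x x)

variable (r : ℕ) {E : X → Type*} [∀ x, AddCommGroup (E x)] [∀ x, Module ℂ (E x)]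
  [∀ x, TopologicalSpace (E x)] [TopologicalSpace (Bundle.TotalSpace (Fin r → ℂ) E)]
  [FiberBundle (Fin r → ℂ) E] [VectorBundle ℂ (Fin r → ℂ) E]

/-- `F̂_H = (F_H, ω) = Λ_ω F_H` at `x`, as a matrix in the frame around `x`. The normalization is
the one for which `Λ_ω ω = 3`. -/
def Fhat (h : TangentForm X) (H : ∀ x, E x →ₗ⋆[ℂ] E x →ₗ[ℂ] ℂ) (x : X) :
    Matrix (Fin r) (Fin r) ℂ :=
  ∑ j, ∑ k, (-2 * Complex.I * (gram 3 h x (chartAt (Fin 3 → ℂ) x x))⁻¹ j k) •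
    chernCurvature r H x j k

/-- The Gram matrix of `H` at the point `x`, in the frame around `x`. -/
def gramAt (H : ∀ x, E x →ₗ⋆[ℂ] E x →ₗ[ℂ] ℂ) (x : X) : Matrix (Fin r) (Fin r) ℂ :=
  gram r H x (chartAt (Fin 3 → ℂ) x x)

/-- The energy density `ê = |F̂_H|_H² = tr (F̂ F̂^*)`, where `F̂^* = G⁻¹ F̂ᴴ G` is the
adjoint of `F̂` with respect to `H`. -/
def energyDensity (h : TangentForm X) (H : ∀ x, E x →ₗ⋆[ℂ] E x →ₗ[ℂ] ℂ) (x : X) : ℝ :=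
  (Matrix.trace (Fhat r h H x *
    ((gramAt r H x)⁻¹ * (Fhat r h H x)ᴴ * gramAt r H x))).re

/-- `H t`, `0 ≤ t ≤ T`, is a smooth solution over the open set `S`, uniformly equivalent to `H₀`, of
the evolution equation `H⁻¹ ∂H/∂t = -2 i F̂_H`, `H 0 = H₀`. -/
structure IsFlow (h : TangentForm X) (S : Set X) (H₀ : ∀ x, E x →ₗ⋆[ℂ] E x →ₗ[ℂ] ℂ) (T : ℝ)
    (H : ℝ → ∀ x, E x →ₗ⋆[ℂ] E x →ₗ[ℂ] ℂ) : Prop where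
  metric : ∀ t ∈ Icc 0 T, IsHermitianMetricOn r (H t) S
  smooth : ∀ x₀ i j, ContDiffOn ℝ ∞ (fun p : ℝ × (Fin 3 → ℂ) => gram r (H p.1) x₀ p.2 i j)
    (Icc 0 T ×ˢ frameDomain r E x₀ S)
  initial : ∀ x ∈ S, H 0 x = H₀ x
  evolution : ∀ t ∈ Icc 0 T, ∀ x ∈ S, ∀ i j,
    HasDerivWithinAt (fun τ => gramAt r (H τ) x i j)
      ((gramAt r (H t) x * ((-2 * Complex.I) • Fhat r h (H t) x)) i j) (Icc 0 T) t
  bounded : ∃ K : ℝ, ∀ t ∈ Icc 0 T, ∀ x ∈ S, ∀ v : E x,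
    (H t x v v).re ≤ K * (H₀ x v v).re ∧ (H₀ x v v).re ≤ K * (H t x v v).re

/-- An asymptotically cylindrical Kähler structure on the complement `W = X \ D` of a smooth
divisor `D` in a compact complex threefold `X`. -/
structure ACylKahler (X : Type*) [TopologicalSpace X] [ChartedSpace (Fin 3 → ℂ) X]
    [IsManifold 𝓘(ℂ, Fin 3 → ℂ) ω X] where
  /-- the divisor at infinity -/
  D : Set X
  /-- the tubular neighbourhood of infinity -/
  U : Set X
  isOpen_U : IsOpen U
  isClosed_D : IsClosed D
  D_subset : D ⊆ U
  /-- the holomorphic coordinate `z = exp (-s - iα)` on `U` (its values off `U` are not used) -/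
  z : X → ℂ
  /-- the smooth projection `U → D` (its values off `U` are not used) -/
  proj : X → X
  holomorphic_z : MDifferentiableOn 𝓘(ℂ, Fin 3 → ℂ) 𝓘(ℂ, ℂ) z U
  dz_ne : ∀ x ∈ U, mfderiv 𝓘(ℂ, Fin 3 → ℂ) 𝓘(ℂ, ℂ) z x ≠ 0
  D_eq : D = {x ∈ U | z x = 0}
  proj_D : ∀ x ∈ D, proj x = x
  smooth_proj : ContMDiffOn 𝓘(ℝ, Fin 3 → ℂ) 𝓘(ℝ, Fin 3 → ℂ) ∞ proj U
  /-- `(proj, z)` is a homeomorphism `U ≃ D × {|z| < 1}` ... -/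
  tube : ∃ e : U ≃ₜ D × Metric.ball (0 : ℂ) 1,
    ∀ x : U, ((e x).1 : X) = proj x ∧ ((e x).2 : ℂ) = z x
  /-- ... with injective differential, hence a diffeomorphism -/
  immersion : ∀ x ∈ U, ∀ v : Fin 3 → ℂ,
    mfderiv 𝓘(ℝ, Fin 3 → ℂ) 𝓘(ℝ, Fin 3 → ℂ) proj x v = 0 →
    mfderiv 𝓘(ℂ, Fin 3 → ℂ) 𝓘(ℂ, ℂ) z x v = 0 → v = 0
  /-- the Kähler metric on `X \ D` -/
  h : TangentForm X
  kahler : IsKahlerOn h Dᶜ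
  /-- a smooth Hermitian metric on `X`; only its restriction to `D` is used, and every smooth
  Hermitian metric on `D` is such a restriction -/
  κ : TangentForm X
  hermitian_κ : IsHermitianMetricOn 3 κ univ
  /-- the exponential rate -/
  rate : ℝ
  rate_pos : 0 < rate
  /-- `|ω - ω_∞| = O(exp (-rate * s))` as `s → ∞`, with respect to the cylindrical metric, where
  `ω_∞ = κ|_D + ds ∧ dα`, `ds + i dα = - dz / z` and `exp (-s) = |z|` -/
  asymptotic : ∃ A ρ : ℝ, 0 < ρ ∧ ∀ x ∈ U \ D, ‖z x‖ < ρ → ∀ v w : Fin 3 → ℂ,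
    let dπ : (Fin 3 → ℂ) → TangentSpace 𝓘(ℂ, Fin 3 → ℂ) (proj x) :=
      fun v => mfderiv 𝓘(ℝ, Fin 3 → ℂ) 𝓘(ℝ, Fin 3 → ℂ) proj x v
    let dz' : (Fin 3 → ℂ) → ℂ := fun v => mfderiv 𝓘(ℂ, Fin 3 → ℂ) 𝓘(ℂ, ℂ) z x v
    let hinf : (Fin 3 → ℂ) → (Fin 3 → ℂ) → ℂ :=
      fun v w => κ (proj x) (dπ v) (dπ w) + conj (dz' v / z x) * (dz' w / z x)
    |(h x v w).im - (hinf v w).im| ≤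
      A * ‖z x‖ ^ rate * (√(hinf v v).re * √(hinf w w).re)

namespace ACylKahler

variable (W : ACylKahler X)

/-- The noncompact threefold `W = X \ D`. -/
def carrier : Set X := W.Dᶜ

/-- The length coordinate `s = - log |z|` along the cylindrical end `U \ D`. -/
def s (x : X) : ℝ := - Real.log ‖W.z x‖

open Classical in
/-- `ε = exp (-s)` along the cylindrical end, `ε = 1` on the compact part. -/
def ε (x : X) : ℝ := if x ∈ W.U then Real.exp (-W.s x) else 1

/-- `H₀` is a smooth Hermitian metric on `E → X` whose restriction to `D` is Hermitian Yang-Mills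
with respect to `κ|_D`. The curvature of the restriction is the restriction of the curvature to the
tangent spaces `ker dz` of `D`, and its contraction with the fundamental form of `κ|_D` is
`-2 i ∑ₐ F(eₐ, ēₐ)` for a `κ`-orthonormal complex basis `e₀, e₁` of `ker dz`. -/
structure IsReferenceMetric (r : ℕ) {E : X → Type*} [∀ x, AddCommGroup (E x)]
    [∀ x, Module ℂ (E x)]
    [∀ x, TopologicalSpace (E x)] [TopologicalSpace (Bundle.TotalSpace (Fin r → ℂ) E)]
    [FiberBundle (Fin r → ℂ) E] [VectorBundle ℂ (Fin r → ℂ) E]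
    (H₀ : ∀ x, E x →ₗ⋆[ℂ] E x →ₗ[ℂ] ℂ) : Prop where
  metric : IsHermitianMetricOn r H₀ univ
  hym : ∀ x ∈ W.D, ∀ e : Fin 2 → (Fin 3 → ℂ),
    (∀ a, mfderiv 𝓘(ℂ, Fin 3 → ℂ) 𝓘(ℂ, ℂ) W.z x (e a) = 0) →
    (∀ a b, W.κ x (e a) (e b) = if a = b then 1 else 0) →
    (-2 * Complex.I) • ∑ a, ∑ j, ∑ k,
      (e a j * conj (e a k)) • chernCurvature r H₀ x j k = 0

end ACylKahler

end Kahler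

end

/-!
The evolution equation says that the velocity `H⁻¹ ∂H/∂t` is `-2 i F̂_H`, so that decay of `F̂_{H_t}`
is a statement about how far `H_t` moves in a short time. It is obtained from a maximum principle for
pairs of metrics, without an evolution equation for the energy density.

**The comparison principle.** Let `H` and `G` be two families of metrics which solve the evolution
equation up to defects. At a space-time maximum of `log (H(v,v) / G(v,v)) - f`, over all points and
all vectors `v`, extend `v` to the local holomorphic section which is parallel for `G` at the point.
The Bochner formula bounds `Δ log |S|²` from below by the mean curvature for every holomorphic
section `S`, with equality for a parallel one, so the difference of the mean curvatures is at most
`Δ f` (`ACylKahler.meanCurvature_sub_le_lap`). The barrier function is `f = A(t) Ψ + δ (1 + 5 t + q)`,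
where `Ψ = min 1 ((ε / ρ) ^ a)` and `q = (max 0 (log ρ - log ε)) ^ 2`. As `log |z|` is pluriharmonic
and, far out on the end, has gradient of length at most `√2`
(`ACylKahler.exists_norm_dz_div_z_sq_le`), the Laplacians of `Ψ` and `q`, in the sense of smooth
functions touching from above, are at most `Ψ / 2` for `a ≤ 1 / 2` and at most `4`. The function `q`
is proper, which turns the assumption that the metrics are uniformly equivalent into the existence of
a maximum. The result is `ACylKahler.comparison`: an inequality `H ≤ exp (A Ψ) G` persists if
`A' ≥ A / 2 + c`, where `c Ψ` bounds the defects.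

**Part 2.** Comparing `H_t` with the constant family `H₀`, whose defect is its own mean curvature
`≤ 2 √B Ψ`, gives `|log (H_τ / H₀)| ≤ 2 √B τ exp (τ / 2) Ψ` (`ACylKahler.flow_initial_bound`).
Comparing `H_{t + τ}` with `H_t`, with this bound at `t = 0`, gives
`|log (H_{t + τ} / H_t)| ≤ 2 √B τ exp ((t + τ) / 2) Ψ` (`ACylKahler.flow_shift_bound`). Division by
`τ → 0` bounds the eigenvalues of the velocity by `2 √B exp (t / 2) Ψ`
(`ACylKahler.flow_meanCurvature_le`), hence the energy density by a constant times
`B exp t ε ^ μ`, with `a = μ / 2`.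

**Part 1.** Near the divisor the mean curvature is computed in a frame consisting of lifts of a
`κ`-orthonormal frame of the divisor and of the radial vector `z ∂_z`. By the asymptotics of the
Kähler form this frame is unitary up to `O(ε ^ min 1 λ)` (`ACylKahler.exists_adapted_frame`). As the
radial vector has length `O(ε)` in `X`, the mean curvature of `H₀` is the mean curvature of its
restriction to the divisor, which vanishes, up to `O(ε ^ min 1 λ)`
(`ACylKahler.exists_energyDensity_le`). Part 3 combines the two.
-/

noncomputable section

open scoped ComplexOrder

set_option linter.unusedSectionVars false

/-! ### Wirtinger derivatives in a constant direction -/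

section Wirtinger

variable {n r : ℕ}

/-- The `(1,0)` derivative `∂_ξ f = ∑ ξ_j ∂f/∂z_j` in the constant direction `ξ`. -/
def dzDir (ξ : Fin n → ℂ) (f : (Fin n → ℂ) → ℂ) (u : Fin n → ℂ) : ℂ :=
  (fderiv ℝ f u ξ - Complex.I * fderiv ℝ f u (Complex.I • ξ)) / 2

/-- The `(0,1)` derivative `∂̄_ξ f = ∑ ξ̄_k ∂f/∂z̄_k` in the constant direction `ξ`. -/
def dzbarDir (ξ : Fin n → ℂ) (f : (Fin n → ℂ) → ℂ) (u : Fin n → ℂ) : ℂ :=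
  (fderiv ℝ f u ξ + Complex.I * fderiv ℝ f u (Complex.I • ξ)) / 2

theorem I_smul_single (j : Fin n) :
    Complex.I • (Pi.single j 1 : Fin n → ℂ) = Pi.single j Complex.I := by
  rw [← Pi.single_smul, smul_eq_mul, mul_one]

theorem dz_eq_dzDir (j : Fin n) (f : (Fin n → ℂ) → ℂ) (u : Fin n → ℂ) :
    dz j f u = dzDir (Pi.single j 1) f u := by
  rw [dz, dzDir, I_smul_single]

theorem dzbar_eq_dzbarDir (j : Fin n) (f : (Fin n → ℂ) → ℂ) (u : Fin n → ℂ) :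
    dzbar j f u = dzbarDir (Pi.single j 1) f u := by
  rw [dzbar, dzbarDir, I_smul_single]

theorem apply_eq_sum_re_im (L : (Fin n → ℂ) →L[ℝ] ℂ) (ξ : Fin n → ℂ) :
    L ξ = ∑ j, ((ξ j).re * L (Pi.single j 1) + (ξ j).im * L (Pi.single j Complex.I)) := by
  have h : ξ = ∑ j, ((ξ j).re • (Pi.single j 1 : Fin n → ℂ) +
      (ξ j).im • (Pi.single j Complex.I : Fin n → ℂ)) := by
    funext k
    rw [Finset.sum_apply, Finset.sum_eq_single k]
    · simp only [Pi.add_apply, Pi.smul_apply, Pi.single_eq_same, Complex.real_smul, mul_one]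
      exact (Complex.re_add_im _).symm
    · intro j _ hj
      simp [Pi.single_eq_of_ne (Ne.symm hj)]
    · simp
  conv_lhs => rw [h]
  simp [map_sum, map_add]

theorem dzDir_eq_sum (ξ : Fin n → ℂ) (f : (Fin n → ℂ) → ℂ) (u : Fin n → ℂ) :
    dzDir ξ f u = ∑ j, ξ j * dz j f u := by
  rw [dzDir, apply_eq_sum_re_im _ ξ, apply_eq_sum_re_im _ (Complex.I • ξ), Finset.mul_sum,
    ← Finset.sum_sub_distrib, Finset.sum_div]
  refine Finset.sum_congr rfl fun j _ => ?_
  rw [dz]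
  conv_rhs => rw [← Complex.re_add_im (ξ j)]
  simp only [Pi.smul_apply, smul_eq_mul, Complex.mul_re, Complex.mul_im, Complex.I_re,
    Complex.I_im]
  push_cast
  linear_combination (-(1 : ℂ) / 2 * ((ξ j).im : ℂ) * fderiv ℝ f u (Pi.single j Complex.I)) * Complex.I_sq +
    ((ξ j).im : ℂ) * fderiv ℝ f u (Pi.single j Complex.I) * Complex.I_sq

theorem dzbarDir_eq_sum (ξ : Fin n → ℂ) (f : (Fin n → ℂ) → ℂ) (u : Fin n → ℂ) :
    dzbarDir ξ f u = ∑ j, conj (ξ j) * dzbar j f u := by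
  rw [dzbarDir, apply_eq_sum_re_im _ ξ, apply_eq_sum_re_im _ (Complex.I • ξ), Finset.mul_sum,
    ← Finset.sum_add_distrib, Finset.sum_div]
  refine Finset.sum_congr rfl fun j _ => ?_
  rw [dzbar]
  have : conj (ξ j) = (ξ j).re - (ξ j).im * Complex.I := by
    apply Complex.ext <;> simp
  rw [this]
  simp only [Pi.smul_apply, smul_eq_mul, Complex.mul_re, Complex.mul_im, Complex.I_re,
    Complex.I_im]
  push_cast
  linear_combination ((ξ j).im : ℂ) * fderiv ℝ f u (Pi.single j Complex.I) * Complex.I_sq * (1 / 2)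

section Rules

variable {f g : (Fin n → ℂ) → ℂ} {u ξ : Fin n → ℂ}

theorem dzDir_congr (h : f =ᶠ[nhds u] g) : dzDir ξ f u = dzDir ξ g u := by
  rw [dzDir, dzDir, h.fderiv_eq]

theorem dzbarDir_congr (h : f =ᶠ[nhds u] g) : dzbarDir ξ f u = dzbarDir ξ g u := by
  rw [dzbarDir, dzbarDir, h.fderiv_eq]

theorem dzDir_mul (hf : DifferentiableAt ℝ f u) (hg : DifferentiableAt ℝ g u) :
    dzDir ξ (fun v => f v * g v) u = dzDir ξ f u * g u + f u * dzDir ξ g u := by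
  simp only [dzDir]
  rw [fderiv_fun_mul hf hg]
  simp
  ring

theorem dzbarDir_mul (hf : DifferentiableAt ℝ f u) (hg : DifferentiableAt ℝ g u) :
    dzbarDir ξ (fun v => f v * g v) u = dzbarDir ξ f u * g u + f u * dzbarDir ξ g u := by
  simp only [dzbarDir]
  rw [fderiv_fun_mul hf hg]
  simp
  ring

theorem dzDir_sum {ι : Type*} (s : Finset ι) {f : ι → (Fin n → ℂ) → ℂ}
    (hf : ∀ i ∈ s, DifferentiableAt ℝ (f i) u) :
    dzDir ξ (fun v => ∑ i ∈ s, f i v) u = ∑ i ∈ s, dzDir ξ (f i) u := by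
  simp only [dzDir]
  rw [fderiv_fun_sum hf]
  simp only [sum_apply, Finset.mul_sum]
  rw [← Finset.sum_sub_distrib, Finset.sum_div]

theorem dzbarDir_sum {ι : Type*} (s : Finset ι) {f : ι → (Fin n → ℂ) → ℂ}
    (hf : ∀ i ∈ s, DifferentiableAt ℝ (f i) u) :
    dzbarDir ξ (fun v => ∑ i ∈ s, f i v) u = ∑ i ∈ s, dzbarDir ξ (f i) u := by
  simp only [dzbarDir]
  rw [fderiv_fun_sum hf]
  simp only [sum_apply, Finset.mul_sum]
  rw [← Finset.sum_add_distrib, Finset.sum_div]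

theorem dzbarDir_add (hf : DifferentiableAt ℝ f u) (hg : DifferentiableAt ℝ g u) :
    dzbarDir ξ (fun v => f v + g v) u = dzbarDir ξ f u + dzbarDir ξ g u := by
  simp only [dzbarDir]
  rw [fderiv_fun_add hf hg]
  simp
  ring

theorem fderiv_real_conj (f : (Fin n → ℂ) → ℂ) (u v : Fin n → ℂ) :
    fderiv ℝ (fun w => conj (f w)) u v = conj (fderiv ℝ f u v) := by
  have := (Complex.conjCLE : ℂ ≃L[ℝ] ℂ).comp_fderiv (f := f) (x := u)
  exact congrArg (fun L : (Fin n → ℂ) →L[ℝ] ℂ => L v) this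

theorem dzDir_conj : dzDir ξ (fun v => conj (f v)) u = conj (dzbarDir ξ f u) := by
  simp only [dzDir, dzbarDir, fderiv_real_conj]
  simp [sub_eq_add_neg, map_ofNat (starRingEnd ℂ) 2]

theorem dzbarDir_conj : dzbarDir ξ (fun v => conj (f v)) u = conj (dzDir ξ f u) := by
  simp only [dzDir, dzbarDir, fderiv_real_conj]
  simp [sub_eq_add_neg, map_ofNat (starRingEnd ℂ) 2]

theorem fderiv_real_apply_of_holomorphic {m : ℕ} {f : (Fin n → ℂ) → (Fin m → ℂ)} (hf : DifferentiableAt ℂ f u)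
    (v : Fin n → ℂ) : fderiv ℝ f u v = fderiv ℂ f u v := by
  rw [hf.fderiv_restrictScalars ℝ]; rfl

theorem dzDir_of_holomorphic (hf : DifferentiableAt ℂ f u) : dzDir ξ f u = fderiv ℂ f u ξ := by
  rw [dzDir, hf.fderiv_restrictScalars ℝ]
  simp only [ContinuousLinearMap.coe_restrictScalars', map_smul, smul_eq_mul]
  linear_combination (-(1 : ℂ) / 2 * fderiv ℂ f u ξ) * Complex.I_sq

theorem dzbarDir_of_holomorphic (hf : DifferentiableAt ℂ f u) : dzbarDir ξ f u = 0 := by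
  rw [dzbarDir, hf.fderiv_restrictScalars ℝ]
  simp only [ContinuousLinearMap.coe_restrictScalars', map_smul, smul_eq_mul]
  linear_combination ((1 : ℂ) / 2 * fderiv ℂ f u ξ) * Complex.I_sq

/-- The chain rule for a holomorphic inner function: no derivatives of the other type appear. -/
theorem dzDir_comp {m : ℕ} {f : (Fin m → ℂ) → ℂ} {τ : (Fin n → ℂ) → (Fin m → ℂ)}
    (hf : DifferentiableAt ℝ f (τ u)) (hτ : DifferentiableAt ℂ τ u) :
    dzDir ξ (fun w => f (τ w)) u = dzDir (fderiv ℂ τ u ξ) f (τ u) := by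
  have h := fderiv_comp u hf (hτ.restrictScalars ℝ)
  have h' : (fun w => f (τ w)) = f ∘ τ := rfl
  simp only [dzDir, h', h, ContinuousLinearMap.comp_apply, fderiv_real_apply_of_holomorphic hτ,
    map_smul]

theorem dzbarDir_comp {m : ℕ} {f : (Fin m → ℂ) → ℂ} {τ : (Fin n → ℂ) → (Fin m → ℂ)}
    (hf : DifferentiableAt ℝ f (τ u)) (hτ : DifferentiableAt ℂ τ u) :
    dzbarDir ξ (fun w => f (τ w)) u = dzbarDir (fderiv ℂ τ u ξ) f (τ u) := by
  have h := fderiv_comp u hf (hτ.restrictScalars ℝ)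
  have h' : (fun w => f (τ w)) = f ∘ τ := rfl
  simp only [dzbarDir, h', h, ContinuousLinearMap.comp_apply, fderiv_real_apply_of_holomorphic hτ,
    map_smul]

theorem contDiffAt_dzDir {k : WithTop ℕ∞} {l : WithTop ℕ∞} (hf : ContDiffAt ℝ k f u) (hkl : l + 1 ≤ k) :
    ContDiffAt ℝ l (dzDir ξ f) u := by
  have h := hf.fderiv_right hkl
  have h1 : ContDiffAt ℝ l (fun w => fderiv ℝ f w ξ) u := h.clm_apply contDiffAt_const
  have h2 : ContDiffAt ℝ l (fun w => fderiv ℝ f w (Complex.I • ξ)) u :=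
    h.clm_apply contDiffAt_const
  exact (h1.sub (contDiffAt_const.mul h2)).div_const 2

theorem contDiffAt_dzbarDir {k : WithTop ℕ∞} {l : WithTop ℕ∞} (hf : ContDiffAt ℝ k f u) (hkl : l + 1 ≤ k) :
    ContDiffAt ℝ l (dzbarDir ξ f) u := by
  have h := hf.fderiv_right hkl
  have h1 : ContDiffAt ℝ l (fun w => fderiv ℝ f w ξ) u := h.clm_apply contDiffAt_const
  have h2 : ContDiffAt ℝ l (fun w => fderiv ℝ f w (Complex.I • ξ)) u :=
    h.clm_apply contDiffAt_const
  exact (h1.add (contDiffAt_const.mul h2)).div_const 2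

end Rules

/-! ### Matrix-valued functions -/

/-- A matrix-valued function is `C^k` at `u` if its entries are. -/
def MatContDiffAt (k : WithTop ℕ∞) (A : (Fin n → ℂ) → Matrix (Fin r) (Fin r) ℂ) (u : Fin n → ℂ) :
    Prop :=
  ∀ i j, ContDiffAt ℝ k (fun v => A v i j) u

/-- Entrywise `(1,0)` derivative of a matrix-valued function. -/
def matDz (ξ : Fin n → ℂ) (A : (Fin n → ℂ) → Matrix (Fin r) (Fin r) ℂ) (u : Fin n → ℂ) :
    Matrix (Fin r) (Fin r) ℂ :=
  Matrix.of fun i j => dzDir ξ (fun v => A v i j) u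

/-- Entrywise `(0,1)` derivative of a matrix-valued function. -/
def matDzbar (ξ : Fin n → ℂ) (A : (Fin n → ℂ) → Matrix (Fin r) (Fin r) ℂ) (u : Fin n → ℂ) :
    Matrix (Fin r) (Fin r) ℂ :=
  Matrix.of fun i j => dzbarDir ξ (fun v => A v i j) u

section MatrixRules

variable {A B : (Fin n → ℂ) → Matrix (Fin r) (Fin r) ℂ} {u ξ : Fin n → ℂ} {k l : WithTop ℕ∞}

theorem MatContDiffAt.differentiableAt (hA : MatContDiffAt k A u) (hk : 1 ≤ k) (i j : Fin r) :
    DifferentiableAt ℝ (fun v => A v i j) u :=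
  (hA i j).differentiableAt (by rintro rfl; simp at hk)

theorem MatContDiffAt.of_le (hA : MatContDiffAt k A u) (h : l ≤ k) : MatContDiffAt l A u :=
  fun i j => (hA i j).of_le h

theorem MatContDiffAt.mul (hA : MatContDiffAt k A u) (hB : MatContDiffAt k B u) :
    MatContDiffAt k (fun v => A v * B v) u := by
  intro i j
  simp only [Matrix.mul_apply]
  exact ContDiffAt.sum fun m _ => (hA i m).mul (hB m j)

theorem contDiffAt_det {m : ℕ} {A : (Fin n → ℂ) → Matrix (Fin m) (Fin m) ℂ}
    (hA : MatContDiffAt k A u) : ContDiffAt ℝ k (fun v => (A v).det) u := by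
  simp only [Matrix.det_apply]
  refine ContDiffAt.sum fun σ _ => ContDiffAt.const_smul _ ?_
  exact contDiffAt_prod fun i _ => hA _ _

theorem MatContDiffAt.inv (hA : MatContDiffAt k A u) (h0 : IsUnit (A u).det) :
    MatContDiffAt k (fun v => (A v)⁻¹) u := by
  intro i j
  simp only [Matrix.inv_def, Matrix.smul_apply, smul_eq_mul, Ring.inverse_eq_inv']
  refine ContDiffAt.mul ((contDiffAt_det hA).inv h0.ne_zero) ?_
  simp only [Matrix.adjugate_apply]
  refine contDiffAt_det fun a b => ?_
  by_cases h : a = j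
  · subst h; simp only [Matrix.updateRow_self]; exact contDiffAt_const
  · simp only [Matrix.updateRow_ne h]; exact hA a b

theorem MatContDiffAt.matDz (hA : MatContDiffAt k A u) (hkl : l + 1 ≤ k) :
    MatContDiffAt l (matDz ξ A) u :=
  fun i j => contDiffAt_dzDir (hA i j) hkl

theorem MatContDiffAt.matDzbar (hA : MatContDiffAt k A u) (hkl : l + 1 ≤ k) :
    MatContDiffAt l (matDzbar ξ A) u :=
  fun i j => contDiffAt_dzbarDir (hA i j) hkl

theorem matDz_congr (h : A =ᶠ[nhds u] B) : matDz ξ A u = matDz ξ B u := by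
  ext i j
  exact dzDir_congr (h.mono fun v hv => by simp [hv])

theorem matDzbar_congr (h : A =ᶠ[nhds u] B) : matDzbar ξ A u = matDzbar ξ B u := by
  ext i j
  exact dzbarDir_congr (h.mono fun v hv => by simp [hv])

theorem matDz_mul (hA : MatContDiffAt 1 A u) (hB : MatContDiffAt 1 B u) :
    matDz ξ (fun v => A v * B v) u = matDz ξ A u * B u + A u * matDz ξ B u := by
  ext i j
  simp only [matDz, Matrix.of_apply, Matrix.add_apply, Matrix.mul_apply]
  rw [dzDir_sum (f := fun m v => A v i m * B v m j) _ fun m _ =>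
    (hA.differentiableAt le_rfl i m).mul (hB.differentiableAt le_rfl m j),
    ← Finset.sum_add_distrib]
  exact Finset.sum_congr rfl fun m _ =>
    dzDir_mul (hA.differentiableAt le_rfl i m) (hB.differentiableAt le_rfl m j)

theorem matDzbar_mul (hA : MatContDiffAt 1 A u) (hB : MatContDiffAt 1 B u) :
    matDzbar ξ (fun v => A v * B v) u = matDzbar ξ A u * B u + A u * matDzbar ξ B u := by
  ext i j
  simp only [matDzbar, Matrix.of_apply, Matrix.add_apply, Matrix.mul_apply]
  rw [dzbarDir_sum (f := fun m v => A v i m * B v m j) _ fun m _ =>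
    (hA.differentiableAt le_rfl i m).mul (hB.differentiableAt le_rfl m j),
    ← Finset.sum_add_distrib]
  exact Finset.sum_congr rfl fun m _ =>
    dzbarDir_mul (hA.differentiableAt le_rfl i m) (hB.differentiableAt le_rfl m j)

theorem matDzbar_add (hA : MatContDiffAt 1 A u) (hB : MatContDiffAt 1 B u) :
    matDzbar ξ (fun v => A v + B v) u = matDzbar ξ A u + matDzbar ξ B u := by
  ext i j
  exact dzbarDir_add (hA.differentiableAt le_rfl i j) (hB.differentiableAt le_rfl i j)

theorem matDz_eq_sum (ξ : Fin n → ℂ) (A : (Fin n → ℂ) → Matrix (Fin r) (Fin r) ℂ)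
    (u : Fin n → ℂ) : matDz ξ A u = ∑ j, ξ j • matDz (Pi.single j 1) A u := by
  ext a b
  simp [matDz, dzDir_eq_sum ξ, dz_eq_dzDir, Matrix.sum_apply]

theorem matDzbar_eq_sum (ξ : Fin n → ℂ) (A : (Fin n → ℂ) → Matrix (Fin r) (Fin r) ℂ)
    (u : Fin n → ℂ) : matDzbar ξ A u = ∑ j, conj (ξ j) • matDzbar (Pi.single j 1) A u := by
  ext a b
  simp [matDzbar, dzbarDir_eq_sum ξ, dzbar_eq_dzbarDir, Matrix.sum_apply]

end MatrixRules

end Wirtinger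

/-! ### Curvature of the Chern connection in coordinates -/

section Curvature

variable {n r : ℕ}

/-- The curvature `F(ξ, η̄) = - ∂̄_η (G⁻¹ ∂_ξ G)` of the Chern connection with Gram matrix `G` in a
holomorphic frame. -/
def curvDir (G : (Fin n → ℂ) → Matrix (Fin r) (Fin r) ℂ) (ξ η : Fin n → ℂ) (u : Fin n → ℂ) :
    Matrix (Fin r) (Fin r) ℂ :=
  - matDzbar η (fun v => (G v)⁻¹ * matDz ξ G v) u

variable {G : (Fin n → ℂ) → Matrix (Fin r) (Fin r) ℂ} {u : Fin n → ℂ}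

theorem matContDiffAt_connection {k : WithTop ℕ∞} (hG : MatContDiffAt (k + 1) G u) (h0 : IsUnit (G u).det)
    (ξ : Fin n → ℂ) : MatContDiffAt k (fun v => (G v)⁻¹ * matDz ξ G v) u :=
  ((hG.of_le le_self_add).inv h0).mul (hG.matDz le_rfl)

theorem matDzbar_sum_smul {ι : Type*} (s : Finset ι) {c : ι → (Fin n → ℂ) → ℂ}
    {A : ι → (Fin n → ℂ) → Matrix (Fin r) (Fin r) ℂ} {η : Fin n → ℂ}
    (hc : ∀ i ∈ s, DifferentiableAt ℂ (c i) u) (hA : ∀ i ∈ s, MatContDiffAt 1 (A i) u) :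
    matDzbar η (fun v => ∑ i ∈ s, c i v • A i v) u = ∑ i ∈ s, c i u • matDzbar η (A i) u := by
  ext a b
  simp only [matDzbar, Matrix.of_apply, Matrix.sum_apply, Matrix.smul_apply, smul_eq_mul]
  rw [dzbarDir_sum (f := fun i v => c i v * A i v a b) _ fun i hi =>
    ((hc i hi).restrictScalars ℝ).mul ((hA i hi).differentiableAt le_rfl a b)]
  refine Finset.sum_congr rfl fun i hi => ?_
  rw [dzbarDir_mul ((hc i hi).restrictScalars ℝ) ((hA i hi).differentiableAt le_rfl a b),
    dzbarDir_of_holomorphic (hc i hi), zero_mul, zero_add]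

/-- The curvature is linear in `ξ` and antilinear in `η`. The hypothesis `C²` is needed to
differentiate the connection form. -/
theorem curvDir_eq_sum (hG : MatContDiffAt 2 G u) (h0 : IsUnit (G u).det) (ξ η : Fin n → ℂ) :
    curvDir G ξ η u =
      ∑ j, ∑ k, (ξ j * conj (η k)) • curvDir G (Pi.single j 1) (Pi.single k 1) u := by
  have h1 : (fun v => (G v)⁻¹ * matDz ξ G v) =
      fun v => ∑ j, ξ j • ((G v)⁻¹ * matDz (Pi.single j 1) G v) := by
    funext v
    rw [matDz_eq_sum ξ, Finset.mul_sum]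
    simp
  rw [curvDir, h1, matDzbar_sum_smul (c := fun j _ => ξ j) _
    (fun _ _ => differentiableAt_const _)
    (fun j _ => matContDiffAt_connection (by simpa [one_add_one_eq_two] using hG) h0 _),
    ← Finset.sum_neg_distrib]
  refine Finset.sum_congr rfl fun j _ => ?_
  rw [matDzbar_eq_sum η, Finset.smul_sum, ← Finset.sum_neg_distrib]
  refine Finset.sum_congr rfl fun k _ => ?_
  rw [curvDir, smul_neg, smul_smul]

theorem curvDir_congr {G' : (Fin n → ℂ) → Matrix (Fin r) (Fin r) ℂ} (h : G =ᶠ[nhds u] G')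
    (ξ η : Fin n → ℂ) : curvDir G ξ η u = curvDir G' ξ η u := by
  rw [curvDir, curvDir]
  congr 1
  refine matDzbar_congr ?_
  filter_upwards [h, h.eventuallyEq_nhds] with v hv hv'
  rw [hv, matDz_congr hv']

theorem MatContDiffAt.curvDir {k : WithTop ℕ∞} (hG : MatContDiffAt (k + 1 + 1) G u) (h0 : IsUnit (G u).det)
    (ξ η : Fin n → ℂ) : MatContDiffAt k (curvDir G ξ η) u :=
  fun i j => ((matContDiffAt_connection hG h0 ξ).matDzbar (ξ := η) le_rfl i j).neg

theorem isUnit_det_eventually {k : WithTop ℕ∞} (hG : MatContDiffAt k G u) (h0 : IsUnit (G u).det) :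
    ∀ᶠ v in nhds u, IsUnit (G v).det := by
  have h := (contDiffAt_det hG).continuousAt.eventually_ne h0.ne_zero
  exact h.mono fun v hv => isUnit_iff_ne_zero.2 hv

/-- The formula `G F(ξ, η̄) = ∂̄_η G G⁻¹ ∂_ξ G - ∂̄_η ∂_ξ G`. -/
theorem mul_curvDir (hG : MatContDiffAt 2 G u) (h0 : IsUnit (G u).det) (ξ η : Fin n → ℂ) :
    G u * curvDir G ξ η u =
      matDzbar η G u * ((G u)⁻¹ * matDz ξ G u) - matDzbar η (matDz ξ G) u := by
  have hG1 : MatContDiffAt (1 + 1) G u := by simpa [one_add_one_eq_two] using hG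
  have h1 : matDz ξ G =ᶠ[nhds u] fun v => G v * ((G v)⁻¹ * matDz ξ G v) := by
    filter_upwards [isUnit_det_eventually hG h0] with v hv
    rw [Matrix.mul_nonsing_inv_cancel_left _ _ hv]
  rw [matDzbar_congr h1, matDzbar_mul (hG.of_le (by norm_num)) (matContDiffAt_connection hG1 h0 ξ),
    curvDir]
  simp

theorem matDzbar_eq_zero {g : (Fin n → ℂ) → Matrix (Fin r) (Fin r) ℂ} {w η : Fin n → ℂ}
    (hg : ∀ i j, DifferentiableAt ℂ (fun v => g v i j) w) : matDzbar η g w = 0 := by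
  ext i j; exact dzbarDir_of_holomorphic (hg i j)

theorem matDz_conjTranspose_eq_zero {g : (Fin n → ℂ) → Matrix (Fin r) (Fin r) ℂ} {w ξ : Fin n → ℂ}
    (hg : ∀ i j, DifferentiableAt ℂ (fun v => g v i j) w) : matDz ξ (fun v => (g v)ᴴ) w = 0 := by
  ext i j
  have := dzDir_conj (ξ := ξ) (u := w) (f := fun v => g v j i)
  rw [dzbarDir_of_holomorphic (hg j i), map_zero] at this
  exact this

theorem MatContDiffAt.conjTranspose {k : WithTop ℕ∞} (hG : MatContDiffAt k G u) :
    MatContDiffAt k (fun v => (G v)ᴴ) u := fun i j =>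
  (Complex.conjCLE : ℂ ≃L[ℝ] ℂ).contDiff.contDiffAt.comp u (hG j i)

theorem MatContDiffAt.comp {m : ℕ} {k : WithTop ℕ∞} {A : (Fin m → ℂ) → Matrix (Fin r) (Fin r) ℂ}
    {τ : (Fin n → ℂ) → (Fin m → ℂ)} {w : Fin n → ℂ} (hA : MatContDiffAt k A (τ w))
    (hτ : ContDiffAt ℝ k τ w) : MatContDiffAt k (fun v => A (τ v)) w :=
  fun i j => ContDiffAt.comp w (hA i j) hτ

/-- Tensoriality of the curvature: under a holomorphic change of coordinates `τ` and a holomorphic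
change of frame `g`, the curvature is conjugated by `g` and pulled back by the derivative of `τ`. -/
theorem curvDir_transform {m : ℕ} {G' : (Fin n → ℂ) → Matrix (Fin r) (Fin r) ℂ}
    {G : (Fin m → ℂ) → Matrix (Fin r) (Fin r) ℂ}
    {τ : (Fin n → ℂ) → (Fin m → ℂ)} {g : (Fin n → ℂ) → Matrix (Fin r) (Fin r) ℂ}
    {w : Fin n → ℂ} (hτ : ContDiffAt ℂ 2 τ w) (hg : ∀ i j, ContDiffAt ℂ 2 (fun v => g v i j) w)
    (hg0 : IsUnit (g w).det) (hG : MatContDiffAt 2 G (τ w)) (hG0 : IsUnit (G (τ w)).det)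
    (h : G' =ᶠ[nhds w] fun v => (g v)ᴴ * G (τ v) * g v) (ξ η : Fin n → ℂ) :
    curvDir G' ξ η w =
      (g w)⁻¹ * curvDir G (fderiv ℂ τ w ξ) (fderiv ℂ τ w η) (τ w) * g w := by
  rw [curvDir_congr h]
  have hgR : MatContDiffAt 2 g w := fun i j => (hg i j).restrict_scalars ℝ
  have hτR : ContDiffAt ℝ 2 τ w := hτ.restrict_scalars ℝ
  have hτd : ∀ᶠ v in nhds w, DifferentiableAt ℂ τ v :=
    (hτ.eventually (by decide)).mono fun v hv => hv.differentiableAt (by decide)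
  have hgd : ∀ᶠ v in nhds w, ∀ i j, DifferentiableAt ℂ (fun v => g v i j) v := by
    simp only [Filter.eventually_all]
    exact fun i j => ((hg i j).eventually (by decide)).mono fun v hv => hv.differentiableAt (by decide)
  have hgC : ∀ᶠ v in nhds w, MatContDiffAt 1 g v := by
    unfold MatContDiffAt
    simp only [Filter.eventually_all]
    exact fun i j => ((hgR i j).eventually (by decide)).mono fun v hv => hv.of_le (by norm_num)
  have hGC : ∀ᶠ v in nhds (τ w), MatContDiffAt 1 G v := by
    unfold MatContDiffAt
    simp only [Filter.eventually_all]
    exact fun i j => ((hG i j).eventually (by decide)).mono fun v hv => hv.of_le (by norm_num)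
  have hGC2 : ∀ᶠ v in nhds w, MatContDiffAt 1 G (τ v) := hτR.continuousAt.eventually hGC
  have hGu : ∀ᶠ v in nhds w, IsUnit (G (τ v)).det :=
    hτR.continuousAt.eventually (isUnit_det_eventually hG hG0)
  have hgu := isUnit_det_eventually hgR hg0
  have hτC : ∀ᶠ v in nhds w, ContDiffAt ℝ 1 τ v :=
    (hτR.eventually (by decide)).mono fun v hv => hv.of_le (by norm_num)
  -- the connection form of the transformed metric
  set K : (Fin n → ℂ) → Matrix (Fin r) (Fin r) ℂ := fun v =>
    ∑ l, (fderiv ℂ τ v ξ) l • ((G (τ v))⁻¹ * matDz (Pi.single l 1) G (τ v)) with hK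
  have hconn : (fun v => ((g v)ᴴ * G (τ v) * g v)⁻¹ *
      matDz ξ (fun v => (g v)ᴴ * G (τ v) * g v) v) =ᶠ[nhds w]
      fun v => (g v)⁻¹ * K v * g v + (g v)⁻¹ * matDz ξ g v := by
    filter_upwards [hτd, hgd, hgC, hGC2, hGu, hgu, hτC] with v h1 h2 h3 h4 h5 h6 h7
    have hGτ : MatContDiffAt 1 (fun v => G (τ v)) v := fun i j =>
      ContDiffAt.comp v (h4 i j) h7
    have hdG : matDz ξ (fun v => G (τ v)) v = G (τ v) * K v := by
      have : matDz ξ (fun v => G (τ v)) v = matDz (fderiv ℂ τ v ξ) G (τ v) := by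
        ext i j
        exact dzDir_comp (h4.differentiableAt le_rfl i j) h1
      rw [this, matDz_eq_sum, hK]
      simp only [Finset.mul_sum, Matrix.mul_smul, Matrix.mul_nonsing_inv_cancel_left _ _ h5]
    have h8 : IsUnit ((g v)ᴴ).det := by
      rw [Matrix.det_conjTranspose]; exact h6.star
    rw [matDz_mul (h3.conjTranspose.mul hGτ) h3, matDz_mul h3.conjTranspose hGτ,
      matDz_conjTranspose_eq_zero h2, hdG, Matrix.mul_inv_rev, Matrix.mul_inv_rev]
    simp only [Matrix.zero_mul, zero_add, Matrix.mul_add, Matrix.mul_assoc,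
      Matrix.nonsing_inv_mul_cancel_left _ _ h8, Matrix.nonsing_inv_mul_cancel_left _ _ h5]
  -- the derivative of `τ` is holomorphic, so that `∂̄` only falls on the connection form of `G`
  have hJ : ∀ l, DifferentiableAt ℂ (fun v => (fderiv ℂ τ v ξ) l) w := fun l => by
    have h1 : DifferentiableAt ℂ (fun v => fderiv ℂ τ v ξ) w :=
      ((hτ.fderiv_right (m := 1) (by norm_num [one_add_one_eq_two])).differentiableAt
        (by norm_num)).clm_apply (differentiableAt_const _)
    exact (differentiableAt_pi.1 h1) l
  have hG11 : MatContDiffAt (1 + 1) G (τ w) := by simpa [one_add_one_eq_two] using hG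
  have hconn1 : ∀ l : Fin m, MatContDiffAt 1
      (fun v => (G (τ v))⁻¹ * matDz (Pi.single l 1) G (τ v)) w := fun l i j =>
    MatContDiffAt.comp (matContDiffAt_connection hG11 hG0 (Pi.single l 1))
      (hτR.of_le (by norm_num)) i j
  have hKC : MatContDiffAt 1 K w := by
    intro i j
    simp only [hK, Matrix.sum_apply, Matrix.smul_apply, smul_eq_mul]
    refine ContDiffAt.sum fun l _ => ContDiffAt.mul ?_ (hconn1 l i j)
    have h1 : ContDiffAt ℂ 1 (fun v => fderiv ℂ τ v ξ) w :=
      (hτ.fderiv_right (m := 1) (by norm_num [one_add_one_eq_two])).clm_apply contDiffAt_const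
    exact ((contDiffAt_pi.1 h1) l).restrict_scalars ℝ
  have hKd : matDzbar η K w = - curvDir G (fderiv ℂ τ w ξ) (fderiv ℂ τ w η) (τ w) := by
    rw [hK, matDzbar_sum_smul _ (fun l _ => hJ l) (fun l _ => hconn1 l), curvDir_eq_sum hG hG0,
      ← Finset.sum_neg_distrib]
    refine Finset.sum_congr rfl fun l _ => ?_
    have h1 : matDzbar η (fun v => (G (τ v))⁻¹ * matDz (Pi.single l 1) G (τ v)) w =
        matDzbar (fderiv ℂ τ w η) (fun v => (G v)⁻¹ * matDz (Pi.single l 1) G v) (τ w) := by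
      ext i j
      exact dzbarDir_comp ((matContDiffAt_connection hG11 hG0
        (Pi.single l 1)).differentiableAt le_rfl i j) (hτ.differentiableAt (by decide))
    rw [h1, matDzbar_eq_sum (fderiv ℂ τ w η), Finset.smul_sum, ← Finset.sum_neg_distrib]
    refine Finset.sum_congr rfl fun k _ => ?_
    rw [curvDir, smul_neg, neg_neg, smul_smul]
  have hgd0 := hgd.self_of_nhds
  have hgC0 := hgC.self_of_nhds
  have hgi : MatContDiffAt 1 (fun v => (g v)⁻¹) w := hgC0.inv hg0
  -- `g⁻¹` and `∂_ξ g` are holomorphic, so that the terms from `∂̄_η` of the change of frame vanish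
  have hgi0 : matDzbar η (fun v => (g v)⁻¹) w = 0 := by
    have h1 : (fun v => (g v)⁻¹ * g v) =ᶠ[nhds w] fun _ => 1 :=
      hgu.mono fun v hv => Matrix.nonsing_inv_mul _ hv
    have h2 := matDzbar_congr (ξ := η) h1
    rw [matDzbar_mul hgi hgC0, matDzbar_eq_zero hgd0,
      matDzbar_eq_zero (g := fun _ => 1) (fun i j => differentiableAt_const _), Matrix.mul_zero, add_zero] at h2
    calc _ = matDzbar η (fun v => (g v)⁻¹) w * g w * (g w)⁻¹ := by
            rw [Matrix.mul_nonsing_inv_cancel_right _ _ hg0]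
      _ = 0 := by rw [h2, Matrix.zero_mul]
  have hdg : matDzbar η (matDz ξ g) w = 0 := by
    have h1 : matDz ξ g =ᶠ[nhds w] fun v => Matrix.of fun i j => fderiv ℂ (fun v => g v i j) v ξ := by
      filter_upwards [hgd] with v hv
      ext i j
      exact dzDir_of_holomorphic (hv i j)
    rw [matDzbar_congr h1]
    refine matDzbar_eq_zero fun i j => ?_
    exact (((hg i j).fderiv_right (m := 1) (by norm_num [one_add_one_eq_two])).differentiableAt
        (by norm_num)).clm_apply (differentiableAt_const _)
  have hdgC : MatContDiffAt 1 (matDz ξ g) w := hgR.matDz (by norm_num [one_add_one_eq_two])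
  rw [curvDir, matDzbar_congr hconn, matDzbar_add ((hgi.mul hKC).mul hgC0) (hgi.mul hdgC),
    matDzbar_mul (hgi.mul hKC) hgC0, matDzbar_mul hgi hKC, matDzbar_mul hgi hdgC, hgi0,
    hdg, hKd, matDzbar_eq_zero hgd0]
  simp

end Curvature

/-! ### The Laplacian on complex lines -/

section Levi

variable {n r : ℕ} {u ξ : Fin n → ℂ}

/-- The Laplacian `4 ∂̄_ξ ∂_ξ f`, at `u`, of the restriction of the real function `f` to the complex
line through `u` in the direction `ξ`. -/
def levi (ξ : Fin n → ℂ) (f : (Fin n → ℂ) → ℝ) (u : Fin n → ℂ) : ℝ :=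
  4 * (dzbarDir ξ (dzDir ξ fun v => (f v : ℂ)) u).re

theorem fderiv_ofReal {f : (Fin n → ℂ) → ℝ} (hf : DifferentiableAt ℝ f u) (v : Fin n → ℂ) :
    fderiv ℝ (fun w => (f w : ℂ)) u v = (fderiv ℝ f u v : ℝ) := by
  have h := (Complex.ofRealCLM.hasFDerivAt.comp u hf.hasFDerivAt).fderiv
  exact congrArg (fun L : (Fin n → ℂ) →L[ℝ] ℂ => L v) h

/-- On a complex line the Laplacian is the sum of two second real derivatives, in the directions `ξ`
and `i ξ`. -/
theorem levi_eq {f : (Fin n → ℂ) → ℝ} (hf : ContDiffAt ℝ 2 f u) (ξ : Fin n → ℂ) :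
    levi ξ f u = fderiv ℝ (fderiv ℝ f) u ξ ξ +
      fderiv ℝ (fderiv ℝ f) u (Complex.I • ξ) (Complex.I • ξ) := by
  have h1 : ContDiffAt ℝ 1 (fderiv ℝ f) u := hf.fderiv_right (by norm_num [one_add_one_eq_two])
  have hd : DifferentiableAt ℝ (fderiv ℝ f) u := h1.differentiableAt (by norm_num)
  have h2 : (dzDir ξ fun v => (f v : ℂ)) =ᶠ[nhds u] fun v =>
      (((fderiv ℝ f v ξ : ℝ) : ℂ) - Complex.I * ((fderiv ℝ f v (Complex.I • ξ) : ℝ) : ℂ)) / 2 := by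
    filter_upwards [hf.eventually (by decide)] with v hv
    rw [dzDir, fderiv_ofReal (hv.differentiableAt (by decide)),
      fderiv_ofReal (hv.differentiableAt (by decide))]
  have h3 : ∀ η : Fin n → ℂ, HasFDerivAt (fun v => ((fderiv ℝ f v η : ℝ) : ℂ))
      (Complex.ofRealCLM.comp ((fderiv ℝ (fderiv ℝ f) u).flip η)) u := fun η => by
    have := (hd.hasFDerivAt.clm_apply (hasFDerivAt_const η u))
    have h := Complex.ofRealCLM.hasFDerivAt.comp u this
    refine h.congr_fderiv ?_
    ext; simp
  have h4 := ((h3 ξ).sub ((h3 (Complex.I • ξ)).const_mul Complex.I)).mul_const (2 : ℂ)⁻¹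
  have h5 := (h4.congr_of_eventuallyEq (h2.trans (Filter.Eventually.of_forall fun v => by
      simp [div_eq_mul_inv]))).fderiv
  rw [levi, dzbarDir, h5]
  simp
  ring

/-- The Laplacian is nonpositive at a local maximum, by the second derivative test on real lines. -/
theorem levi_nonpos_of_isLocalMax {f : (Fin n → ℂ) → ℝ} (hf : ContDiffAt ℝ 2 f u)
    (hmax : IsLocalMax f u) (ξ : Fin n → ℂ) : levi ξ f u ≤ 0 := by
  have key : ∀ η : Fin n → ℂ, fderiv ℝ (fderiv ℝ f) u η η ≤ 0 := by
    intro η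
    have h1 : ContDiffAt ℝ 1 (fderiv ℝ f) u := hf.fderiv_right (by norm_num [one_add_one_eq_two])
    have hd : DifferentiableAt ℝ (fderiv ℝ f) u := h1.differentiableAt (by norm_num)
    set l : ℝ → (Fin n → ℂ) := fun x => u + x • η with hl
    have hl0 : l 0 = u := by simp [hl]
    have hld : ∀ x, HasDerivAt l η x := fun x => by
      have h := ((hasDerivAt_id x).smul_const η).const_add u
      rw [one_smul] at h
      exact h
    have hlc : Filter.Tendsto l (nhds 0) (nhds u) := by
      have := (hld 0).continuousAt.tendsto; rwa [hl0] at this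
    have hdev : deriv (fun x => f (l x)) =ᶠ[nhds 0] fun x => fderiv ℝ f (l x) η := by
      filter_upwards [hlc.eventually (hf.eventually (by decide))] with x hx
      exact ((hx.differentiableAt (by decide)).hasFDerivAt.comp_hasDerivAt x (hld x)).deriv
    have hdd : deriv (deriv (fun x => f (l x))) 0 = fderiv ℝ (fderiv ℝ f) u η η := by
      rw [hdev.deriv_eq]
      have h2 : HasFDerivAt (fderiv ℝ f) (fderiv ℝ (fderiv ℝ f) u) (l 0) := by
        rw [hl0]; exact hd.hasFDerivAt
      have h3 := (h2.comp_hasDerivAt 0 (hld 0)).clm_apply (hasDerivAt_const 0 η)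
      simpa using h3.deriv
    have hm : IsLocalMax (fun x => f (l x)) 0 := by
      have := hlc.eventually hmax
      unfold IsLocalMax IsMaxFilter
      rw [← hl0] at this
      exact this
    by_contra hcon
    push Not at hcon
    have hcont : ContinuousAt (fun x => f (l x)) 0 := by
      refine ContinuousAt.comp (g := f) ?_ (hld 0).continuousAt
      rw [hl0]; exact hf.continuousAt
    have hmin := isLocalMin_of_deriv_deriv_pos (by rw [hdd]; exact hcon) hm.deriv_eq_zero hcont
    -- a point that is both a local maximum and a local minimum has vanishing second derivative
    have hconst : (fun x => f (l x)) =ᶠ[nhds 0] fun _ => f (l 0) := by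
      filter_upwards [hm, hmin] with x h1 h2 using le_antisymm h1 h2
    have h0 : deriv (deriv (fun x => f (l x))) 0 = 0 := by
      have := hconst.deriv.deriv_eq
      rw [this]; simp
    rw [hdd] at h0
    exact absurd h0 hcon.ne'
  rw [levi_eq hf]
  exact add_nonpos (key _) (key _)

theorem levi_sub {f g : (Fin n → ℂ) → ℝ} (hf : ContDiffAt ℝ 2 f u) (hg : ContDiffAt ℝ 2 g u) :
    levi ξ (fun v => f v - g v) u = levi ξ f u - levi ξ g u := by
  have h1 : fderiv ℝ (fun v => f v - g v) =ᶠ[nhds u] fun v => fderiv ℝ f v - fderiv ℝ g v := by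
    filter_upwards [hf.eventually (by decide), hg.eventually (by decide)] with v h1 h2
    exact fderiv_fun_sub (h1.differentiableAt (by decide)) (h2.differentiableAt (by decide))
  have hd : ∀ {f : (Fin n → ℂ) → ℝ}, ContDiffAt ℝ 2 f u → DifferentiableAt ℝ (fderiv ℝ f) u :=
    fun hf => (hf.fderiv_right (m := 1) (by norm_num [one_add_one_eq_two])).differentiableAt
      (by norm_num)
  rw [levi_eq (hf.sub hg), levi_eq hf, levi_eq hg, h1.fderiv_eq, fderiv_fun_sub (hd hf) (hd hg)]
  simp
  ring

theorem levi_const_mul {f : (Fin n → ℂ) → ℝ} (hf : ContDiffAt ℝ 2 f u) (c : ℝ) :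
    levi ξ (fun v => c * f v) u = c * levi ξ f u := by
  have h1 : fderiv ℝ (fun v => c * f v) =ᶠ[nhds u] fun v => c • fderiv ℝ f v := by
    filter_upwards [hf.eventually (by decide)] with v h1
    exact fderiv_const_mul (h1.differentiableAt (by decide)) c
  have hd : DifferentiableAt ℝ (fderiv ℝ f) u :=
    (hf.fderiv_right (m := 1) (by norm_num [one_add_one_eq_two])).differentiableAt (by norm_num)
  rw [levi_eq (contDiffAt_const.mul hf), levi_eq hf, h1.fderiv_eq, fderiv_fun_const_smul hd]
  simp
  ring

theorem levi_const (c : ℝ) : levi ξ (fun _ => c) u = 0 := by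
  rw [levi_eq contDiffAt_const]; simp

theorem levi_add {f g : (Fin n → ℂ) → ℝ} (hf : ContDiffAt ℝ 2 f u) (hg : ContDiffAt ℝ 2 g u) :
    levi ξ (fun v => f v + g v) u = levi ξ f u + levi ξ g u := by
  have h := levi_sub (ξ := ξ) hf (contDiffAt_const (c := (-1 : ℝ)) |>.mul hg)
  rw [levi_const_mul hg] at h
  simpa using h

theorem dzbarDir_ofReal (f : (Fin n → ℂ) → ℝ) :
    dzbarDir ξ (fun v => (f v : ℂ)) u = conj (dzDir ξ (fun v => (f v : ℂ)) u) := by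
  rw [← dzbarDir_conj]; simp

theorem dzDir_ofReal_comp {f : (Fin n → ℂ) → ℝ} {φ : ℝ → ℝ} {φ' : ℝ}
    (hf : DifferentiableAt ℝ f u) (hφ : HasDerivAt φ φ' (f u)) :
    dzDir ξ (fun v => ((φ (f v) : ℝ) : ℂ)) u = φ' * dzDir ξ (fun v => (f v : ℂ)) u := by
  have h := hφ.comp_hasFDerivAt u hf.hasFDerivAt
  have h' : fderiv ℝ (fun v => φ (f v)) u = φ' • fderiv ℝ f u := h.fderiv
  have h'' : DifferentiableAt ℝ (fun v => φ (f v)) u := h.differentiableAt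
  rw [dzDir, dzDir, fderiv_ofReal h'', fderiv_ofReal h'', fderiv_ofReal hf, fderiv_ofReal hf, h']
  simp
  ring

/-- The chain rule `Δ (φ ∘ f) = φ'(f) Δ f + φ''(f) |∇f|²` on a complex line. -/
theorem levi_comp {f : (Fin n → ℂ) → ℝ} {φ φ' : ℝ → ℝ} {φ'' : ℝ}
    (hf : ContDiffAt ℝ 2 f u) (hφ : ∀ᶠ y in nhds (f u), HasDerivAt φ (φ' y) y)
    (hφ' : HasDerivAt φ' φ'' (f u)) :
    levi ξ (fun v => φ (f v)) u =
      φ' (f u) * levi ξ f u + 4 * φ'' * ‖dzDir ξ (fun v => (f v : ℂ)) u‖ ^ 2 := by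
  have hfd : DifferentiableAt ℝ f u := hf.differentiableAt (by decide)
  have h1 : (dzDir ξ fun v => ((φ (f v) : ℝ) : ℂ)) =ᶠ[nhds u] fun v =>
      ((φ' (f v) : ℝ) : ℂ) * dzDir ξ (fun v => (f v : ℂ)) v := by
    filter_upwards [hf.eventually (by decide), hf.continuousAt.eventually hφ] with v h1 h2
    exact dzDir_ofReal_comp (h1.differentiableAt (by decide)) h2
  have hfc : ContDiffAt ℝ 2 (fun v => (f v : ℂ)) u := Complex.ofRealCLM.contDiff.contDiffAt.comp u hf
  have h2 : DifferentiableAt ℝ (fun v => ((φ' (f v) : ℝ) : ℂ)) u :=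
    Complex.ofRealCLM.differentiableAt.comp u (hφ'.differentiableAt.comp u hfd)
  have h3 : DifferentiableAt ℝ (dzDir ξ fun v => (f v : ℂ)) u :=
    (contDiffAt_dzDir (l := 1) hfc (by norm_num [one_add_one_eq_two])).differentiableAt (by norm_num)
  rw [levi, dzbarDir_congr h1, dzbarDir_mul h2 h3,
    dzbarDir_ofReal (fun v => φ' (f v)), dzDir_ofReal_comp hfd hφ', levi, map_mul, Complex.conj_ofReal,
    mul_assoc ((φ'' : ℂ)), mul_comm (conj _) _, Complex.mul_conj, Complex.normSq_eq_norm_sq]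
  rw [Complex.add_re, ← Complex.ofReal_mul, Complex.ofReal_re, Complex.re_ofReal_mul]
  ring

end Levi

section HolomorphicLog

variable {n : ℕ} {u ξ : Fin n → ℂ} {f : (Fin n → ℂ) → ℂ}

theorem contDiffAt_log_norm (hf : ContDiffAt ℂ 2 f u) (h0 : f u ≠ 0) :
    ContDiffAt ℝ 2 (fun v => Real.log ‖f v‖) u :=
  ((hf.restrict_scalars ℝ).norm ℝ h0).log (norm_ne_zero_iff.2 h0)

theorem dzDir_log_norm (hf : DifferentiableAt ℂ f u) (h0 : f u ≠ 0) :
    dzDir ξ (fun v => ((Real.log ‖f v‖ : ℝ) : ℂ)) u = fderiv ℂ f u ξ / f u / 2 := by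
  have hR : DifferentiableAt ℝ f u := hf.restrictScalars ℝ
  have hc : DifferentiableAt ℝ (fun v => conj (f v)) u :=
    (Complex.conjCLE : ℂ ≃L[ℝ] ℂ).differentiableAt.comp u hR
  have hN : DifferentiableAt ℝ (fun v => ‖f v‖ ^ 2) u := hR.norm_sq ℝ
  have h1 : (fun v => ((Real.log ‖f v‖ : ℝ) : ℂ)) =
      fun v => (((fun y => Real.log y / 2) (‖f v‖ ^ 2) : ℝ) : ℂ) := by
    funext v; simp
  have h2 : (fun v => ((‖f v‖ ^ 2 : ℝ) : ℂ)) = fun v => f v * conj (f v) := by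
    funext v; rw [Complex.mul_conj, Complex.normSq_eq_norm_sq]
  have h3 : HasDerivAt (fun y => Real.log y / 2) ((‖f u‖ ^ 2)⁻¹ / 2) (‖f u‖ ^ 2) :=
    (Real.hasDerivAt_log (by positivity)).div_const 2
  rw [h1, dzDir_ofReal_comp (f := fun v => ‖f v‖ ^ 2) hN h3, h2, dzDir_mul hR hc, dzDir_conj,
    dzbarDir_of_holomorphic hf, dzDir_of_holomorphic hf]
  have h4 : (((‖f u‖ ^ 2)⁻¹ / 2 : ℝ) : ℂ) = (f u * conj (f u))⁻¹ / 2 := by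
    rw [Complex.mul_conj, Complex.normSq_eq_norm_sq]; push_cast; rfl
  have h5 : conj (f u) ≠ 0 := by simpa using h0
  rw [h4]
  field_simp
  simp

/-- `log |f|` is pluriharmonic for a holomorphic function `f` without zeros. -/
theorem levi_log_norm (hf : ContDiffAt ℂ 2 f u) (h0 : f u ≠ 0) :
    levi ξ (fun v => Real.log ‖f v‖) u = 0 := by
  have h1 : (dzDir ξ fun v => ((Real.log ‖f v‖ : ℝ) : ℂ)) =ᶠ[nhds u]
      fun v => fderiv ℂ f v ξ / f v / 2 := by
    filter_upwards [hf.eventually (by decide), hf.continuousAt.eventually_ne h0] with v h1 h2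
    exact dzDir_log_norm (h1.differentiableAt (by decide)) h2
  have h2 : DifferentiableAt ℂ (fun v => fderiv ℂ f v ξ / f v / 2) u := by
    have h3 : DifferentiableAt ℂ (fun v => fderiv ℂ f v ξ) u :=
      ((hf.fderiv_right (m := 1) (by norm_num [one_add_one_eq_two])).differentiableAt
        (by norm_num)).clm_apply (differentiableAt_const _)
    simp only [div_eq_mul_inv]
    exact (h3.mul ((hf.differentiableAt (by decide)).inv h0)).mul_const _
  rw [levi, dzbarDir_congr h1, dzbarDir_of_holomorphic h2]
  simp

/-- The Laplacian of a function of `log |f|`, for `f` holomorphic. -/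
theorem levi_comp_log_norm (hf : ContDiffAt ℂ 2 f u) (h0 : f u ≠ 0) {φ φ' : ℝ → ℝ} {φ'' : ℝ}
    (hφ : ∀ᶠ y in nhds (Real.log ‖f u‖), HasDerivAt φ (φ' y) y)
    (hφ' : HasDerivAt φ' φ'' (Real.log ‖f u‖)) :
    levi ξ (fun v => φ (Real.log ‖f v‖)) u = φ'' * ‖fderiv ℂ f u ξ / f u‖ ^ 2 := by
  rw [levi_comp (f := fun v => Real.log ‖f v‖) (contDiffAt_log_norm hf h0) hφ hφ',
    levi_log_norm hf h0, dzDir_log_norm (hf.differentiableAt (by decide)) h0, norm_div]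
  simp
  ring

end HolomorphicLog

/-! ### Hermitian forms given by positive definite matrices -/

section Forms

variable {r : ℕ} {G : Matrix (Fin r) (Fin r) ℂ}

theorem exists_eq_conjTranspose_mul_self (hG : G.PosDef) :
    ∃ B : Matrix (Fin r) (Fin r) ℂ, IsUnit B.det ∧ G = Bᴴ * B := by
  obtain ⟨B, hB⟩ : ∃ B : Matrix (Fin r) (Fin r) ℂ, G = Bᴴ * B := by
    open scoped MatrixOrder in
    have h : 0 ≤ G := Matrix.nonneg_iff_posSemidef.2 hG.posSemidef
    obtain ⟨B, hB⟩ := CStarAlgebra.nonneg_iff_eq_star_mul_self.1 h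
    exact ⟨B, hB⟩
  refine ⟨B, ?_, hB⟩
  have h := (Matrix.isUnit_iff_isUnit_det _).1 hG.isUnit
  rw [hB, Matrix.det_mul] at h
  exact isUnit_of_mul_isUnit_right h

theorem star_dotProduct_self_eq (x : Fin r → ℂ) :
    star x ⬝ᵥ x = ((∑ i, ‖x i‖ ^ 2 : ℝ) : ℂ) := by
  simp only [dotProduct, Pi.star_apply, RCLike.star_def, Complex.conj_mul']
  push_cast
  rfl

theorem norm_star_dotProduct_sq_le (x y : Fin r → ℂ) :
    ‖star x ⬝ᵥ y‖ ^ 2 ≤ (∑ i, ‖x i‖ ^ 2) * ∑ i, ‖y i‖ ^ 2 := by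
  have h1 : ‖star x ⬝ᵥ y‖ ≤ ∑ i, ‖x i‖ * ‖y i‖ := by
    refine (norm_sum_le _ _).trans (Finset.sum_le_sum fun i _ => ?_)
    simp
  calc _ ≤ (∑ i, ‖x i‖ * ‖y i‖) ^ 2 := by gcongr
    _ ≤ _ := Finset.sum_mul_sq_le_sq_mul_sq _ _ _

theorem star_dotProduct_factor (B : Matrix (Fin r) (Fin r) ℂ) (x y : Fin r → ℂ) :
    star x ⬝ᵥ ((Bᴴ * B) *ᵥ y) = star (B *ᵥ x) ⬝ᵥ (B *ᵥ y) := by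
  rw [← Matrix.mulVec_mulVec, Matrix.star_mulVec, ← Matrix.dotProduct_mulVec]

/-- Cauchy-Schwarz for the Hermitian form with Gram matrix `G`. -/
theorem norm_form_sq_le (hG : G.PosDef) (x y : Fin r → ℂ) :
    ‖star x ⬝ᵥ (G *ᵥ y)‖ ^ 2 ≤ (star x ⬝ᵥ (G *ᵥ x)).re * (star y ⬝ᵥ (G *ᵥ y)).re := by
  obtain ⟨B, -, rfl⟩ := exists_eq_conjTranspose_mul_self hG
  simp only [star_dotProduct_factor, star_dotProduct_self_eq, Complex.ofReal_re]
  exact norm_star_dotProduct_sq_le _ _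

theorem form_re_pos (hG : G.PosDef) {x : Fin r → ℂ} (hx : x ≠ 0) :
    0 < (star x ⬝ᵥ (G *ᵥ x)).re :=
  (Complex.pos_iff.1 (hG.dotProduct_mulVec_pos hx)).1

theorem form_re_nonneg (hG : G.PosDef) (x : Fin r → ℂ) :
    0 ≤ (star x ⬝ᵥ (G *ᵥ x)).re :=
  (Complex.nonneg_iff.1 (hG.posSemidef.dotProduct_mulVec_nonneg x)).1

theorem form_im_eq_zero (hG : G.IsHermitian) (x : Fin r → ℂ) :
    (star x ⬝ᵥ (G *ᵥ x)).im = 0 := by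
  have h : conj (star x ⬝ᵥ (G *ᵥ x)) = star x ⬝ᵥ (G *ᵥ x) := by
    have h1 : star (star x ⬝ᵥ (G *ᵥ x)) = star (G *ᵥ x) ⬝ᵥ x := by
      rw [Matrix.star_dotProduct, star_star]
    rw [← RCLike.star_def, h1, Matrix.star_mulVec, hG.eq, ← Matrix.dotProduct_mulVec]
  exact Complex.conj_eq_iff_im.1 h

end Forms

/-! ### The Laplacian of the logarithm of the norm of a holomorphic section -/

section LogNorm

variable {n r : ℕ} {G : (Fin n → ℂ) → Matrix (Fin r) (Fin r) ℂ} {S : (Fin n → ℂ) → (Fin r → ℂ)}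
  {u : Fin n → ℂ}

/-- The square of the norm of the section with components `S` in a frame with Gram matrix `G`. -/
def normSqSection (G : (Fin n → ℂ) → Matrix (Fin r) (Fin r) ℂ) (S : (Fin n → ℂ) → (Fin r → ℂ))
    (u : Fin n → ℂ) : ℝ :=
  (star (S u) ⬝ᵥ (G u *ᵥ S u)).re

theorem contDiffAt_normSqSection (hG : MatContDiffAt 2 G u) (hS : ContDiffAt ℂ 2 S u) :
    ContDiffAt ℝ 2 (normSqSection G S) u := by
  have hS' : ∀ i, ContDiffAt ℝ 2 (fun v => S v i) u := fun i =>
    (contDiffAt_pi.1 (hS.restrict_scalars ℝ)) i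
  refine Complex.reCLM.contDiff.contDiffAt.comp u ?_
  simp only [dotProduct, Matrix.mulVec]
  exact ContDiffAt.sum fun i _ => ContDiffAt.mul
    ((Complex.conjCLE : ℂ ≃L[ℝ] ℂ).contDiff.contDiffAt.comp u (hS' i))
    (ContDiffAt.sum fun j _ => (hG i j).mul (hS' j))

theorem contDiffAt_log_normSqSection (hG : MatContDiffAt 2 G u) (hP : (G u).PosDef)
    (hS : ContDiffAt ℂ 2 S u) (h0 : S u ≠ 0) :
    ContDiffAt ℝ 2 (fun v => Real.log (normSqSection G S v)) u :=
  (contDiffAt_normSqSection hG hS).log (form_re_pos hP h0).ne'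

theorem levi_log {f : (Fin n → ℂ) → ℝ} (hf : ContDiffAt ℝ 2 f u) (h0 : 0 < f u) (ξ : Fin n → ℂ) :
    levi ξ (fun v => Real.log (f v)) u =
      levi ξ f u / f u - 4 * ‖dzDir ξ (fun v => (f v : ℂ)) u‖ ^ 2 / f u ^ 2 := by
  have h1 : ∀ᶠ y in nhds (f u), HasDerivAt Real.log ((fun y => y⁻¹) y) y := by
    filter_upwards [lt_mem_nhds h0] with y hy using Real.hasDerivAt_log hy.ne'
  rw [levi_comp hf h1 (hasDerivAt_inv h0.ne')]
  field_simp
  ring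

/-- First and second derivatives of the norm of a holomorphic section `S`, with `D = ∇_ξ S`:
`∂_ξ |S|² = ⟨S, D⟩` and `∂̄_ξ ∂_ξ |S|² = |D|² - ⟨S, F(ξ, ξ̄) S⟩`. -/
theorem normSqSection_derivs (hG : MatContDiffAt 2 G u) (hH : ∀ᶠ v in nhds u, (G v).IsHermitian)
    (h0 : IsUnit (G u).det) (hS : ContDiffAt ℂ 2 S u) (ξ : Fin n → ℂ) {D : Fin r → ℂ}
    (hD : D = fderiv ℂ S u ξ + ((G u)⁻¹ * matDz ξ G u) *ᵥ S u) :
    dzDir ξ (fun v => (normSqSection G S v : ℂ)) u = star (S u) ⬝ᵥ (G u *ᵥ D) ∧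
    levi ξ (normSqSection G S) u = 4 * ((star D ⬝ᵥ (G u *ᵥ D)).re -
      (star (S u) ⬝ᵥ ((G u * curvDir G ξ ξ u) *ᵥ S u)).re) := by
  rcases Nat.eq_zero_or_pos r with rfl | hr
  · have : normSqSection G S = fun _ => 0 := by
      funext v; simp [normSqSection]
    rw [this, levi_const]
    simp only [dotProduct, Finset.univ_eq_empty, Finset.sum_empty]
    simp [dzDir]
  obtain ⟨a⟩ : Nonempty (Fin r) := ⟨⟨0, hr⟩⟩
  -- the section, written as a square matrix with equal columns
  set M : (Fin n → ℂ) → Matrix (Fin r) (Fin r) ℂ := fun v => Matrix.of fun i _ => S v i with hM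
  set Dm : Matrix (Fin r) (Fin r) ℂ := Matrix.of fun i _ => D i with hDm
  have entry : ∀ (x y : Fin r → ℂ) (A : Matrix (Fin r) (Fin r) ℂ),
      ((Matrix.of fun i (_ : Fin r) => x i)ᴴ * (A * Matrix.of fun i (_ : Fin r) => y i)) a a =
        star x ⬝ᵥ (A *ᵥ y) := by
    intro x y A
    simp [Matrix.mul_apply, dotProduct, Matrix.mulVec]
  have hSi : ∀ i, ContDiffAt ℂ 2 (fun v => S v i) u := fun i => contDiffAt_pi.1 hS i
  have hM2 : MatContDiffAt 2 M u := fun i j => (hSi i).restrict_scalars ℝ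
  have hMd : ∀ᶠ v in nhds u, ∀ i j, DifferentiableAt ℂ (fun v => M v i j) v := by
    simp only [Filter.eventually_all]
    exact fun i j => ((hSi i).eventually (by decide)).mono fun v hv =>
      hv.differentiableAt (by decide)
  have hMC : ∀ᶠ v in nhds u, MatContDiffAt 1 M v := by
    unfold MatContDiffAt
    simp only [Filter.eventually_all]
    exact fun i j => ((hM2 i j).eventually (by decide)).mono fun v hv => hv.of_le (by norm_num)
  have hGC : ∀ᶠ v in nhds u, MatContDiffAt 1 G v := by
    unfold MatContDiffAt
    simp only [Filter.eventually_all]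
    exact fun i j => ((hG i j).eventually (by decide)).mono fun v hv => hv.of_le (by norm_num)
  have hM1 := hMC.self_of_nhds
  have hG1 := hGC.self_of_nhds
  have hMd0 := hMd.self_of_nhds
  have hmatM : matDz ξ M u = Matrix.of fun i _ => fderiv ℂ S u ξ i := by
    ext i j
    have h1 := dzDir_of_holomorphic (ξ := ξ) ((hSi i).differentiableAt (by decide))
    have h2 : fderiv ℂ (fun v => S v i) u ξ = fderiv ℂ S u ξ i := by
      rw [fderiv_apply (hS.differentiableAt (by decide))]; rfl
    exact h1.trans h2
  have hP : (fun v => (normSqSection G S v : ℂ)) =ᶠ[nhds u] fun v => ((M v)ᴴ * (G v * M v)) a a := by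
    filter_upwards [hH] with v hv
    rw [entry]
    exact Complex.ext rfl (by simpa using (form_im_eq_zero hv (S v)).symm)
  have hMG : matDz ξ (fun v => (M v)ᴴ * (G v * M v)) =ᶠ[nhds u]
      fun v => (M v)ᴴ * (matDz ξ G v * M v + G v * matDz ξ M v) := by
    filter_upwards [hMC, hGC, hMd] with v h1 h2 h3
    rw [matDz_mul h1.conjTranspose (h2.mul h1), matDz_mul h2 h1, matDz_conjTranspose_eq_zero h3,
      Matrix.zero_mul, zero_add]
  -- `G D = ∂_ξ G S + G ∂_ξ S`, by the definition of the covariant derivative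
  have hGD : matDz ξ G u * M u + G u * matDz ξ M u = G u * Dm := by
    have : Dm = matDz ξ M u + (G u)⁻¹ * (matDz ξ G u * M u) := by
      rw [hmatM]
      ext i j
      simp only [hDm, hD, Matrix.of_apply, Pi.add_apply, Matrix.add_apply]
      rw [← Matrix.mulVec_mulVec]
      rfl
    rw [this, Matrix.mul_add, Matrix.mul_nonsing_inv_cancel_left _ _ h0, add_comm]
  -- for Hermitian `G` the derivatives of the two types are adjoint to each other
  have hGadj : matDzbar ξ G u = (matDz ξ G u)ᴴ := by
    have h1 : G =ᶠ[nhds u] fun v => (G v)ᴴ := hH.mono fun v hv => hv.eq.symm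
    rw [matDzbar_congr h1]
    ext i j
    exact dzbarDir_conj (ξ := ξ) (u := u) (f := fun v => G v j i)
  have hMadj : matDzbar ξ (fun v => (M v)ᴴ) u = (matDz ξ M u)ᴴ := by
    ext i j
    exact dzbarDir_conj (ξ := ξ) (u := u) (f := fun v => M v j i)
  have hddM : matDzbar ξ (matDz ξ M) u = 0 := by
    have h1 : matDz ξ M =ᶠ[nhds u] fun v => Matrix.of fun i j => fderiv ℂ (fun v => M v i j) v ξ := by
      filter_upwards [hMd] with v hv
      ext i j
      exact dzDir_of_holomorphic (hv i j)
    rw [matDzbar_congr h1]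
    refine matDzbar_eq_zero fun i j => ?_
    exact (((hSi i).fderiv_right (m := 1) (by norm_num [one_add_one_eq_two])).differentiableAt
        (by norm_num)).clm_apply (differentiableAt_const _)
  have hdG1 : MatContDiffAt 1 (matDz ξ G) u := hG.matDz (by norm_num [one_add_one_eq_two])
  have hdM1 : MatContDiffAt 1 (matDz ξ M) u := hM2.matDz (by norm_num [one_add_one_eq_two])
  have hHu := hH.self_of_nhds
  -- the mixed second derivative of `Mᴴ G M`
  have second : matDzbar ξ (matDz ξ (fun v => (M v)ᴴ * (G v * M v))) u =
      Dmᴴ * (G u * Dm) - (M u)ᴴ * ((G u * curvDir G ξ ξ u) * M u) := by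
    have hA1 : MatContDiffAt 1 (fun v => matDz ξ G v * M v + G v * matDz ξ M v) u := fun i j =>
      ((hdG1.mul hM1) i j).add ((hG1.mul hdM1) i j)
    have hdM : matDz ξ M u = Dm - (G u)⁻¹ * (matDz ξ G u * M u) := by
      rw [eq_sub_iff_add_eq, ← Matrix.nonsing_inv_mul_cancel_left (A := G u) (matDz ξ M u) h0,
        ← Matrix.mul_add, add_comm, hGD, Matrix.nonsing_inv_mul_cancel_left _ _ h0]
    rw [matDzbar_congr hMG, matDzbar_mul hM1.conjTranspose hA1, hGD, hMadj,
      matDzbar_add (hdG1.mul hM1) (hG1.mul hdM1), matDzbar_mul hdG1 hM1, matDzbar_mul hG1 hdM1,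
      matDzbar_eq_zero hMd0, hddM, mul_curvDir hG h0, hGadj, hdM]
    simp only [Matrix.conjTranspose_sub, Matrix.conjTranspose_mul, Matrix.conjTranspose_nonsing_inv,
      hHu.eq, Matrix.sub_mul, Matrix.mul_sub, Matrix.mul_assoc, Matrix.mul_zero, add_zero,
      Matrix.nonsing_inv_mul_cancel_left _ _ h0, Matrix.mul_add]
    abel
  refine ⟨?_, ?_⟩
  · rw [dzDir_congr hP]
    have : dzDir ξ (fun v => ((M v)ᴴ * (G v * M v)) a a) u =
      matDz ξ (fun v => (M v)ᴴ * (G v * M v)) u a a := rfl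
    rw [this, hMG.self_of_nhds]
    simp only [hGD]
    rw [hM, hDm, entry]
  · have hP' : (dzDir ξ fun v => (normSqSection G S v : ℂ)) =ᶠ[nhds u]
        fun v => matDz ξ (fun v => (M v)ᴴ * (G v * M v)) v a a := by
      filter_upwards [hP.eventuallyEq_nhds] with v hv
      exact dzDir_congr hv
    rw [levi, dzbarDir_congr hP']
    have : dzbarDir ξ (fun v => matDz ξ (fun v => (M v)ᴴ * (G v * M v)) v a a) u =
      matDzbar ξ (matDz ξ (fun v => (M v)ᴴ * (G v * M v))) u a a := rfl
    rw [this, second, Matrix.sub_apply, hM, hDm, entry, entry, Complex.sub_re]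

/-- The curvature bounds the Laplacian of `log |S|²` from below, for a holomorphic section `S`. -/
theorem levi_log_normSqSection_ge (hG : MatContDiffAt 2 G u)
    (hH : ∀ᶠ v in nhds u, (G v).IsHermitian) (hP : (G u).PosDef) (hS : ContDiffAt ℂ 2 S u)
    (h0 : S u ≠ 0) (ξ : Fin n → ℂ) :
    -4 * (star (S u) ⬝ᵥ ((G u * curvDir G ξ ξ u) *ᵥ S u)).re / normSqSection G S u ≤
      levi ξ (fun v => Real.log (normSqSection G S v)) u := by
  have hN : 0 < normSqSection G S u := form_re_pos hP h0
  obtain ⟨h1, h2⟩ := normSqSection_derivs hG hH ((Matrix.isUnit_iff_isUnit_det _).1 hP.isUnit) hS ξ rfl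
  rw [levi_log (contDiffAt_normSqSection hG hS) hN, h1, h2]
  set D := fderiv ℂ S u ξ + ((G u)⁻¹ * matDz ξ G u) *ᵥ S u
  have h3 := norm_form_sq_le hP (S u) D
  have h4 : 4 * ‖star (S u) ⬝ᵥ (G u *ᵥ D)‖ ^ 2 / normSqSection G S u ^ 2 ≤
      4 * (star D ⬝ᵥ (G u *ᵥ D)).re / normSqSection G S u := by
    rw [div_le_div_iff₀ (by positivity) hN]
    have : (star (S u) ⬝ᵥ (G u *ᵥ S u)).re = normSqSection G S u := rfl
    rw [this] at h3
    nlinarith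
  have h5 : 4 * ((star D ⬝ᵥ (G u *ᵥ D)).re -
      (star (S u) ⬝ᵥ ((G u * curvDir G ξ ξ u) *ᵥ S u)).re) / normSqSection G S u =
      4 * (star D ⬝ᵥ (G u *ᵥ D)).re / normSqSection G S u +
      -4 * (star (S u) ⬝ᵥ ((G u * curvDir G ξ ξ u) *ᵥ S u)).re / normSqSection G S u := by
    rw [← add_div]; ring
  linarith

/-- For a holomorphic section that is parallel at the point, the bound is an equality. -/
theorem levi_log_normSqSection_eq (hG : MatContDiffAt 2 G u)
    (hH : ∀ᶠ v in nhds u, (G v).IsHermitian) (hP : (G u).PosDef) (hS : ContDiffAt ℂ 2 S u)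
    (h0 : S u ≠ 0) (ξ : Fin n → ℂ)
    (hpar : fderiv ℂ S u ξ + ((G u)⁻¹ * matDz ξ G u) *ᵥ S u = 0) :
    levi ξ (fun v => Real.log (normSqSection G S v)) u =
      -4 * (star (S u) ⬝ᵥ ((G u * curvDir G ξ ξ u) *ᵥ S u)).re / normSqSection G S u := by
  have hN : 0 < normSqSection G S u := form_re_pos hP h0
  obtain ⟨h1, h2⟩ := normSqSection_derivs hG hH ((Matrix.isUnit_iff_isUnit_det _).1 hP.isUnit) hS ξ rfl
  rw [levi_log (contDiffAt_normSqSection hG hS) hN, h1, h2, hpar]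
  simp

/-- A holomorphic section with a prescribed value that is parallel at the point. -/
theorem exists_parallel_section (G : (Fin n → ℂ) → Matrix (Fin r) (Fin r) ℂ) (u : Fin n → ℂ)
    (v : Fin r → ℂ) : ∃ S : (Fin n → ℂ) → (Fin r → ℂ), ContDiffAt ℂ 2 S u ∧ S u = v ∧
      ∀ ξ, fderiv ℂ S u ξ + ((G u)⁻¹ * matDz ξ G u) *ᵥ S u = 0 := by
  set L : (Fin n → ℂ) →L[ℂ] (Fin r → ℂ) := LinearMap.toContinuousLinearMap
    (Matrix.mulVecLin (Matrix.of fun i j => -(((G u)⁻¹ * matDz (Pi.single j 1) G u) *ᵥ v) i)) with hL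
  have hd : ∀ w, HasFDerivAt (fun w => v + L (w - u)) L w := fun w => by
    have := (L.hasFDerivAt (x := w - u)).comp w ((hasFDerivAt_id w).sub_const u)
    exact this.const_add v
  refine ⟨fun w => v + L (w - u), ?_, by simp, fun ξ => ?_⟩
  · exact contDiffAt_const.add (L.contDiff.contDiffAt.comp u (contDiffAt_id.sub contDiffAt_const))
  · rw [(hd u).fderiv, matDz_eq_sum ξ]
    simp only [sub_self, map_zero, add_zero]
    ext i
    simp only [hL, LinearMap.coe_toContinuousLinearMap', Matrix.mulVecLin_apply, Pi.add_apply,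
      Finset.mul_sum, Matrix.mul_smul, Pi.zero_apply, Matrix.sum_mulVec, Matrix.smul_mulVec,
      Finset.sum_apply, Pi.smul_apply, smul_eq_mul]
    simp only [Matrix.mulVec, dotProduct, Matrix.of_apply]
    rw [← Finset.sum_add_distrib]
    refine Finset.sum_eq_zero fun j _ => ?_
    ring

end LogNorm

/-! ### Regularity of holomorphic functions of several variables -/

section SeveralVariables

variable {n : ℕ} {f : (Fin n → ℂ) → ℂ} {U : Set (Fin n → ℂ)} {y : Fin n → ℂ} {R M : ℝ}

/-- The Cauchy estimate for the full derivative, from the one-variable estimate on complex lines. -/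
theorem norm_fderiv_le_of_forall_mem_closedBall_norm_le (hU : IsOpen U) (hf : DifferentiableOn ℂ f U) (hR : 0 < R)
    (hsub : Metric.closedBall y R ⊆ U) (hM : ∀ w ∈ Metric.closedBall y R, ‖f w‖ ≤ M) :
    ‖fderiv ℂ f y‖ ≤ M / R := by
  have hM0 : 0 ≤ M := (norm_nonneg _).trans (hM y (Metric.mem_closedBall_self hR.le))
  refine ContinuousLinearMap.opNorm_le_bound _ (by positivity) fun η => ?_
  rcases eq_or_ne η 0 with rfl | hη
  · simp
  have hη' : 0 < ‖η‖ := norm_pos_iff.2 hη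
  have hmem : ∀ ζ ∈ Metric.closedBall (0 : ℂ) (R / ‖η‖), y + ζ • η ∈ Metric.closedBall y R := by
    intro ζ hζ
    rw [mem_closedBall_zero_iff] at hζ
    rw [mem_closedBall_iff_norm, add_sub_cancel_left, norm_smul]
    exact (le_div_iff₀ hη').1 hζ
  have hl : ∀ ζ : ℂ, HasDerivAt (fun ζ : ℂ => y + ζ • η) η ζ := fun ζ => by
    have h := ((hasDerivAt_id ζ).smul_const η).const_add y
    rw [one_smul] at h
    exact h
  have hd : ∀ ζ ∈ Metric.closedBall (0 : ℂ) (R / ‖η‖),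
      HasDerivAt (fun ζ : ℂ => f (y + ζ • η)) (fderiv ℂ f (y + ζ • η) η) ζ := fun ζ hζ =>
    (((hf _ (hsub (hmem ζ hζ))).differentiableAt (hU.mem_nhds (hsub (hmem ζ hζ)))).hasFDerivAt).comp_hasDerivAt
      ζ (hl ζ)
  have h := Complex.norm_deriv_le_of_forall_mem_sphere_norm_le (f := fun ζ : ℂ => f (y + ζ • η))
    (c := 0) (R := R / ‖η‖) (C := M) (by positivity)
    (DifferentiableOn.diffContOnCl fun ζ hζ =>
      (hd ζ (Metric.closure_ball_subset_closedBall hζ)).differentiableAt.differentiableWithinAt)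
    (fun ζ hζ => hM _ (hmem ζ (Metric.sphere_subset_closedBall hζ)))
  rw [(hd 0 (Metric.mem_closedBall_self (by positivity))).deriv] at h
  simp only [zero_smul, add_zero] at h
  calc _ ≤ M / (R / ‖η‖) := h
    _ = M / R * ‖η‖ := by field_simp

/-- Directional derivatives of a holomorphic function are holomorphic: differentiate Cauchy's
formula on a circle in the given direction. -/
theorem differentiableOn_fderiv_apply (hU : IsOpen U) (hf : DifferentiableOn ℂ f U)
    (ξ : Fin n → ℂ) : DifferentiableOn ℂ (fun u => fderiv ℂ f u ξ) U := by
  intro u₀ hu₀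
  refine DifferentiableAt.differentiableWithinAt ?_
  rcases eq_or_ne ξ 0 with rfl | hξ
  · simp
  have hξ' : 0 < ‖ξ‖ := norm_pos_iff.2 hξ
  obtain ⟨ε, hε, hεU⟩ := Metric.isOpen_iff.1 hU u₀ hu₀
  set δ := ε / 4 with hδ
  have hδ0 : 0 < δ := by positivity
  have hsub : Metric.closedBall u₀ (3 * δ) ⊆ U := fun w hw => hεU (by
    rw [Metric.mem_closedBall] at hw; rw [Metric.mem_ball]; linarith)
  obtain ⟨M, hM⟩ := (isCompact_closedBall u₀ (3 * δ)).exists_bound_of_continuousOn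
    (hf.continuousOn.mono hsub)
  set R := δ / ‖ξ‖ with hRdef
  have hR : 0 < R := by positivity
  have hcirc : ∀ u ∈ Metric.ball u₀ δ, ∀ ζ ∈ Metric.closedBall (0 : ℂ) R,
      u + ζ • ξ ∈ Metric.closedBall u₀ (2 * δ) := by
    intro u hu ζ hζ
    rw [mem_closedBall_zero_iff, hRdef, le_div_iff₀ hξ'] at hζ
    rw [mem_ball_iff_norm] at hu
    rw [mem_closedBall_iff_norm]
    calc ‖u + ζ • ξ - u₀‖ = ‖(u - u₀) + ζ • ξ‖ := by congr 1; abel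
      _ ≤ ‖u - u₀‖ + ‖ζ • ξ‖ := norm_add_le _ _
      _ ≤ 2 * δ := by rw [norm_smul]; linarith
  have h23 : Metric.closedBall u₀ (2 * δ) ⊆ Metric.closedBall u₀ (3 * δ) :=
    Metric.closedBall_subset_closedBall (by linarith)
  have hdiff : ∀ w ∈ Metric.closedBall u₀ (2 * δ), DifferentiableAt ℂ f w := fun w hw =>
    (hf w (hsub (h23 hw))).differentiableAt (hU.mem_nhds (hsub (h23 hw)))
  -- the bound of the derivative needed for differentiation under the integral sign
  have hbd : ∀ w ∈ Metric.closedBall u₀ (2 * δ), ‖fderiv ℂ f w‖ ≤ M / δ := by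
    intro w hw
    have hs : Metric.closedBall w δ ⊆ Metric.closedBall u₀ (3 * δ) := by
      refine Metric.closedBall_subset_closedBall' ?_
      rw [Metric.mem_closedBall] at hw; linarith
    exact norm_fderiv_le_of_forall_mem_closedBall_norm_le hU hf hδ0 (hs.trans hsub) fun v hv => hM v (hs hv)
  have hl : ∀ (u : Fin n → ℂ) (ζ : ℂ), HasDerivAt (fun ζ : ℂ => u + ζ • ξ) ξ ζ := fun u ζ => by
    have h := ((hasDerivAt_id ζ).smul_const ξ).const_add u
    rw [one_smul] at h
    exact h
  -- Cauchy's formula for the derivative along the line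
  have hcauchy : ∀ u ∈ Metric.ball u₀ δ, fderiv ℂ f u ξ = (2 * Real.pi * Complex.I)⁻¹ *
      ∫ θ in (0 : ℝ)..2 * Real.pi, deriv (circleMap 0 R) θ * (1 / (circleMap 0 R θ) ^ 2) *
        f (u + circleMap 0 R θ • ξ) := by
    intro u hu
    have hd : ∀ ζ ∈ Metric.closedBall (0 : ℂ) R,
        HasDerivAt (fun ζ : ℂ => f (u + ζ • ξ)) (fderiv ℂ f (u + ζ • ξ) ξ) ζ := fun ζ hζ =>
      (hdiff _ (hcirc u hu ζ hζ)).hasFDerivAt.comp_hasDerivAt ζ (hl u ζ)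
    have h := DifferentiableOn.deriv_eq_smul_circleIntegral (f := fun ζ : ℂ => f (u + ζ • ξ))
      (c := 0) hR fun ζ hζ => (hd ζ hζ).differentiableAt.differentiableWithinAt
    rw [(hd 0 (Metric.mem_closedBall_self hR.le)).deriv] at h
    simp only [zero_smul, add_zero, sub_zero, smul_eq_mul, circleIntegral] at h
    have hpi : (2 * Real.pi * Complex.I : ℂ) ≠ 0 := by
      simp [Real.pi_ne_zero]
    rw [eq_inv_mul_iff_mul_eq₀ hpi, ← h]
    simp only [mul_assoc]
  have hcirc0 : ∀ θ, circleMap 0 R θ ∈ Metric.closedBall (0 : ℂ) R := fun θ =>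
    circleMap_mem_closedBall 0 hR.le θ
  set c : ℝ → ℂ := fun θ => deriv (circleMap 0 R) θ * (1 / (circleMap 0 R θ) ^ 2) with hc
  have hccont : Continuous c := by
    simp only [hc, deriv_circleMap]
    refine Continuous.mul (by fun_prop) (Continuous.div continuous_const (by fun_prop) fun θ => ?_)
    simp [circleMap_ne_center hR.ne', pow_eq_zero_iff]
  have hFcont : ∀ u ∈ Metric.ball u₀ δ, Continuous fun θ => c θ * f (u + circleMap 0 R θ • ξ) := by
    intro u hu
    refine hccont.mul (continuous_iff_continuousAt.2 fun θ => ?_)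
    refine ContinuousAt.comp (g := f) (hdiff _ (hcirc u hu _ (hcirc0 θ))).continuousAt ?_
    fun_prop
  have hball : Metric.ball u₀ δ ∈ nhds u₀ := Metric.ball_mem_nhds _ hδ0
  -- differentiate under the integral sign
  have key := intervalIntegral.hasFDerivAt_integral_of_dominated_of_fderiv_le
    (μ := MeasureTheory.volume) (𝕜 := ℂ) (a := 0) (b := 2 * Real.pi) (x₀ := u₀)
    (F := fun u θ => c θ * f (u + circleMap 0 R θ • ξ))
    (F' := fun u θ => c θ • fderiv ℂ f (u + circleMap 0 R θ • ξ))
    (bound := fun θ => ‖c θ‖ * (M / δ)) hball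
    (Filter.eventually_of_mem hball fun u hu => (hFcont u hu).aestronglyMeasurable)
    ((hFcont u₀ (Metric.mem_ball_self hδ0)).intervalIntegrable _ _)
    (by
      refine (hccont.aestronglyMeasurable).smul ?_
      have h1 : Measurable fun θ => fderiv ℂ f (u₀ + circleMap 0 R θ • ξ) :=
        (measurable_fderiv ℂ f).comp (by fun_prop : Continuous fun θ => u₀ + circleMap 0 R θ • ξ).measurable
      exact h1.aestronglyMeasurable)
    (MeasureTheory.ae_of_all _ fun θ _ u hu => by
      rw [norm_smul]
      exact mul_le_mul_of_nonneg_left (hbd _ (hcirc u hu _ (hcirc0 θ))) (norm_nonneg _))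
    ((hccont.norm.mul continuous_const).intervalIntegrable _ _)
    (MeasureTheory.ae_of_all _ fun θ _ u hu => by
      have h1 := (hdiff _ (hcirc u hu _ (hcirc0 θ))).hasFDerivAt
      have h2 : HasFDerivAt (fun u : Fin n → ℂ => u + circleMap 0 R θ • ξ)
        (ContinuousLinearMap.id ℂ _) u := (hasFDerivAt_id u).add_const _
      have h3 := (h1.comp u h2).const_mul (c θ)
      exact h3)
  refine ((key.const_mul (2 * Real.pi * Complex.I : ℂ)⁻¹).differentiableAt).congr_of_eventuallyEq ?_
  exact Filter.eventually_of_mem hball fun u hu => hcauchy u hu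

/-- Complex differentiable functions of several variables are smooth; by induction, as their directional
derivatives are again complex differentiable. -/
theorem contDiffOn_nat_of_differentiableOn (hU : IsOpen U) (k : ℕ) :
    ∀ f : (Fin n → ℂ) → ℂ, DifferentiableOn ℂ f U → ContDiffOn ℂ k f U := by
  induction k with
  | zero => exact fun f hf => contDiffOn_zero.2 hf.continuousOn
  | succ k ih =>
    intro f hf
    push_cast
    rw [contDiffOn_succ_iff_fderiv_of_isOpen hU]
    refine ⟨hf, by simp, ?_⟩
    rw [contDiffOn_clm_apply]
    exact fun ξ => ih _ (differentiableOn_fderiv_apply hU hf ξ)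

theorem contDiffAt_two_of_differentiableOn (hU : IsOpen U) (hf : DifferentiableOn ℂ f U)
    {u : Fin n → ℂ} (hu : u ∈ U) : ContDiffAt ℂ 2 f u := by
  have := contDiffOn_nat_of_differentiableOn hU 2 f hf
  exact (this u hu).contDiffAt (hU.mem_nhds hu)

end SeveralVariables

/-! ### Frames and changes of frame -/

section Frames

variable {X : Type*} [TopologicalSpace X] [ChartedSpace (Fin 3 → ℂ) X]
variable (r : ℕ) {E : X → Type*} [∀ x, AddCommGroup (E x)] [∀ x, Module ℂ (E x)]
  [∀ x, TopologicalSpace (E x)] [TopologicalSpace (Bundle.TotalSpace (Fin r → ℂ) E)]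
  [FiberBundle (Fin r → ℂ) E] [VectorBundle ℂ (Fin r → ℂ) E]

/-- The Gram matrix of `H` at the point `y` in the frame around `x₀`. -/
def gramPt (H : ∀ x, E x →ₗ⋆[ℂ] E x →ₗ[ℂ] ℂ) (x₀ y : X) : Matrix (Fin r) (Fin r) ℂ :=
  Matrix.of fun i j => H y (localFrame r x₀ i y) (localFrame r x₀ j y)

/-- The vector at `y` with components `c` in the frame around `x₀`. -/
def frameVec (x₀ y : X) (c : Fin r → ℂ) : E y := ∑ i, c i • localFrame r x₀ i y

variable {r}

theorem gram_chart (H : ∀ x, E x →ₗ⋆[ℂ] E x →ₗ[ℂ] ℂ) {x₀ y : X}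
    (hy : y ∈ (chartAt (Fin 3 → ℂ) x₀).source) :
    gram r H x₀ (chartAt (Fin 3 → ℂ) x₀ y) = gramPt r H x₀ y :=
  congrArg (gramPt r H x₀) ((chartAt (Fin 3 → ℂ) x₀).left_inv hy)

theorem gramAt_eq (H : ∀ x, E x →ₗ⋆[ℂ] E x →ₗ[ℂ] ℂ) (x : X) : gramAt r H x = gramPt r H x x :=
  gram_chart H (mem_chart_source _ x)

theorem form_frameVec (H : ∀ x, E x →ₗ⋆[ℂ] E x →ₗ[ℂ] ℂ) (x₀ y : X) (c d : Fin r → ℂ) :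
    H y (frameVec r x₀ y c) (frameVec r x₀ y d) = star c ⬝ᵥ (gramPt r H x₀ y *ᵥ d) := by
  simp only [frameVec, map_sum, LinearMap.sum_apply, LinearMap.map_smulₛₗ, LinearMap.smul_apply,
    map_smul, dotProduct, Matrix.mulVec, gramPt, Matrix.of_apply, Pi.star_apply, smul_eq_mul,
    RCLike.star_def, Finset.mul_sum]
  rw [Finset.sum_comm]
  refine Finset.sum_congr rfl fun i _ => Finset.sum_congr rfl fun j _ => ?_
  ring

theorem frameVec_eq_symm {x₀ y : X} (hy : y ∈ (trivializationAt (Fin r → ℂ) E x₀).baseSet)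
    (c : Fin r → ℂ) : (frameVec r x₀ y c : E y) = (trivializationAt (Fin r → ℂ) E x₀).symm y c := by
  have h : c = ∑ i, c i • (Pi.single i 1 : Fin r → ℂ) := by
    funext k; simp [Finset.sum_apply, Pi.single_apply]
  conv_rhs => rw [h]
  simp only [frameVec, localFrame]
  rw [← Bundle.Trivialization.coe_symmₗ (R := ℂ) _ hy, map_sum]
  simp

theorem exists_eq_frameVec {x₀ y : X} (hy : y ∈ (trivializationAt (Fin r → ℂ) E x₀).baseSet)
    (v : E y) : ∃ c : Fin r → ℂ, frameVec r x₀ y c = v :=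
  ⟨(trivializationAt (Fin r → ℂ) E x₀).linearMapAt ℂ y v, by
    rw [frameVec_eq_symm hy, ← Bundle.Trivialization.coe_symmₗ (R := ℂ) _ hy,
      Bundle.Trivialization.symmₗ_linearMapAt _ hy]⟩

theorem frameVec_ne_zero {x₀ y : X} (hy : y ∈ (trivializationAt (Fin r → ℂ) E x₀).baseSet)
    {c : Fin r → ℂ} (hc : c ≠ 0) : (frameVec r x₀ y c : E y) ≠ 0 := by
  rw [frameVec_eq_symm hy, ← Bundle.Trivialization.coe_symmₗ (R := ℂ) _ hy]
  intro h
  have := Bundle.Trivialization.linearMapAt_symmₗ (R := ℂ) (trivializationAt (Fin r → ℂ) E x₀) hy c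
  rw [h, map_zero] at this
  exact hc this.symm

theorem frameVec_zero (x₀ y : X) : (frameVec r x₀ y 0 : E y) = 0 := by simp [frameVec]

theorem posDef_gramPt {H : ∀ x, E x →ₗ⋆[ℂ] E x →ₗ[ℂ] ℂ} {S : Set X}
    (hH : IsHermitianMetricOn r H S) {x₀ y : X}
    (hy : y ∈ (trivializationAt (Fin r → ℂ) E x₀).baseSet) (hyS : y ∈ S) :
    (gramPt r H x₀ y).PosDef := by
  refine Matrix.PosDef.of_dotProduct_mulVec_pos ?_ fun c hc => ?_
  · ext i j
    rw [Matrix.conjTranspose_apply]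
    exact (hH.symm y hyS _ _).symm
  · rw [← form_frameVec]
    refine Complex.pos_iff.2 ⟨hH.pos y hyS _ (frameVec_ne_zero hy hc), ?_⟩
    have := hH.symm y hyS (frameVec r x₀ y c) (frameVec r x₀ y c)
    exact (Complex.conj_eq_iff_im.1 this.symm).symm

theorem IsHermitianMetricOn.mono {H : ∀ x, E x →ₗ⋆[ℂ] E x →ₗ[ℂ] ℂ} {S S' : Set X}
    (hH : IsHermitianMetricOn r H S') (hS : S ⊆ S') : IsHermitianMetricOn r H S :=
  ⟨fun x hx => hH.symm x (hS hx), fun x hx => hH.pos x (hS hx),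
    fun x₀ i j => (hH.smooth x₀ i j).mono fun _ hu => ⟨hu.1, hu.2.1, hS hu.2.2⟩⟩

theorem isOpen_frameDomain (x₀ : X) {S : Set X} (hS : IsOpen S) :
    IsOpen (frameDomain r E x₀ S) :=
  (chartAt (Fin 3 → ℂ) x₀).symm.isOpen_inter_preimage
    ((trivializationAt (Fin r → ℂ) E x₀).open_baseSet.inter hS)

theorem mem_frameDomain {x₀ y : X} {S : Set X} (hy : y ∈ (chartAt (Fin 3 → ℂ) x₀).source)
    (hy' : y ∈ (trivializationAt (Fin r → ℂ) E x₀).baseSet) (hyS : y ∈ S) :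
    chartAt (Fin 3 → ℂ) x₀ y ∈ frameDomain r E x₀ S := by
  refine ⟨(chartAt (Fin 3 → ℂ) x₀).map_source hy, ?_⟩
  rw [mem_preimage, (chartAt (Fin 3 → ℂ) x₀).left_inv hy]
  exact ⟨hy', hyS⟩

theorem matContDiffAt_gram {H : ∀ x, E x →ₗ⋆[ℂ] E x →ₗ[ℂ] ℂ} {S : Set X} (hS : IsOpen S)
    (hH : IsHermitianMetricOn r H S) {x₀ : X} {u : Fin 3 → ℂ} (hu : u ∈ frameDomain r E x₀ S) :
    MatContDiffAt ∞ (gram r H x₀) u := fun i j =>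
  (hH.smooth x₀ i j u hu).contDiffAt ((isOpen_frameDomain x₀ hS).mem_nhds hu)

theorem posDef_gram {H : ∀ x, E x →ₗ⋆[ℂ] E x →ₗ[ℂ] ℂ} {S : Set X}
    (hH : IsHermitianMetricOn r H S) {x₀ : X} {u : Fin 3 → ℂ} (hu : u ∈ frameDomain r E x₀ S) :
    (gram r H x₀ u).PosDef :=
  posDef_gramPt hH hu.2.1 hu.2.2

/-- The matrix of the change from the frame around `x₁` to the frame around `x₀`. -/
def frameChange (r : ℕ) (E : X → Type*) [∀ x, AddCommGroup (E x)] [∀ x, Module ℂ (E x)]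
    [∀ x, TopologicalSpace (E x)] [TopologicalSpace (Bundle.TotalSpace (Fin r → ℂ) E)]
    [FiberBundle (Fin r → ℂ) E] [VectorBundle ℂ (Fin r → ℂ) E] (x₀ x₁ y : X) :
    Matrix (Fin r) (Fin r) ℂ :=
  Matrix.of fun i j => (trivializationAt (Fin r → ℂ) E x₁).coordChangeL ℂ
    (trivializationAt (Fin r → ℂ) E x₀) y (Pi.single j 1) i

theorem frameChange_mulVec (x₀ x₁ y : X) (c : Fin r → ℂ) :
    frameChange r E x₀ x₁ y *ᵥ c = (trivializationAt (Fin r → ℂ) E x₁).coordChangeL ℂ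
      (trivializationAt (Fin r → ℂ) E x₀) y c := by
  have h : c = ∑ i, c i • (Pi.single i 1 : Fin r → ℂ) := by
    funext k; simp [Finset.sum_apply, Pi.single_apply]
  conv_rhs => rw [h]
  rw [map_sum]
  ext i
  simp [frameChange, Matrix.mulVec, dotProduct, mul_comm, Finset.sum_apply]

theorem frameVec_frameChange {x₀ x₁ y : X}
    (h₀ : y ∈ (trivializationAt (Fin r → ℂ) E x₀).baseSet)
    (h₁ : y ∈ (trivializationAt (Fin r → ℂ) E x₁).baseSet) (c : Fin r → ℂ) :
    (frameVec r x₁ y c : E y) = frameVec r x₀ y (frameChange r E x₀ x₁ y *ᵥ c) := by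
  rw [frameChange_mulVec, frameVec_eq_symm h₀, frameVec_eq_symm h₁,
    Bundle.Trivialization.coordChangeL_apply _ _ ⟨h₁, h₀⟩]
  exact ((trivializationAt (Fin r → ℂ) E x₀).symm_apply_apply_mk h₀ _).symm

theorem isUnit_frameChange (x₀ x₁ y : X) : IsUnit (frameChange r E x₀ x₁ y).det := by
  rw [← Matrix.isUnit_iff_isUnit_det, ← Matrix.mulVec_injective_iff_isUnit]
  intro c d hcd
  rw [frameChange_mulVec, frameChange_mulVec] at hcd
  exact ContinuousLinearEquiv.injective _ hcd

theorem dotProduct_conjTranspose_mul_mul (g A : Matrix (Fin r) (Fin r) ℂ) (c d : Fin r → ℂ) :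
    star c ⬝ᵥ ((gᴴ * A * g) *ᵥ d) = star (g *ᵥ c) ⬝ᵥ (A *ᵥ (g *ᵥ d)) := by
  rw [Matrix.mul_assoc, ← Matrix.mulVec_mulVec, ← Matrix.mulVec_mulVec, Matrix.star_mulVec,
    Matrix.dotProduct_mulVec]

/-- A matrix is determined by its sesquilinear form. -/
theorem matrix_ext_of_form {A B : Matrix (Fin r) (Fin r) ℂ}
    (h : ∀ c d : Fin r → ℂ, star c ⬝ᵥ (A *ᵥ d) = star c ⬝ᵥ (B *ᵥ d)) : A = B := by
  ext i j
  have := h (Pi.single i 1) (Pi.single j 1)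
  simpa [← Pi.single_star, Matrix.mulVec_single_one] using this

theorem gramPt_frameChange (H : ∀ x, E x →ₗ⋆[ℂ] E x →ₗ[ℂ] ℂ) {x₀ x₁ y : X}
    (h₀ : y ∈ (trivializationAt (Fin r → ℂ) E x₀).baseSet)
    (h₁ : y ∈ (trivializationAt (Fin r → ℂ) E x₁).baseSet) :
    gramPt r H x₁ y = (frameChange r E x₀ x₁ y)ᴴ * gramPt r H x₀ y * frameChange r E x₀ x₁ y := by
  refine matrix_ext_of_form fun c d => ?_
  rw [dotProduct_conjTranspose_mul_mul, ← form_frameVec, ← form_frameVec,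
    frameVec_frameChange h₀ h₁, frameVec_frameChange h₀ h₁]

end Frames

/-! ### Charts and tangent vectors -/

section Tangent

variable {X : Type*} [TopologicalSpace X] [ChartedSpace (Fin 3 → ℂ) X]
  [IsManifold 𝓘(ℂ, Fin 3 → ℂ) ω X]

/-- The change of coordinates from the chart around `x₀` to the chart around `x₁`. -/
def transition (x₀ x₁ : X) (u : Fin 3 → ℂ) : Fin 3 → ℂ :=
  chartAt (Fin 3 → ℂ) x₁ ((chartAt (Fin 3 → ℂ) x₀).symm u)

theorem contDiffAt_transition {x₀ x₁ y : X} (h₀ : y ∈ (chartAt (Fin 3 → ℂ) x₀).source)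
    (h₁ : y ∈ (chartAt (Fin 3 → ℂ) x₁).source) :
    ContDiffAt ℂ ω (transition x₀ x₁) (chartAt (Fin 3 → ℂ) x₀ y) := by
  have h := contDiffWithinAt_ext_coord_change (I := 𝓘(ℂ, Fin 3 → ℂ)) (n := ω) (M := X) x₁ x₀
    (y := chartAt (Fin 3 → ℂ) x₀ y) (by
      simp only [PartialEquiv.trans_source, mfld_simps]
      refine ⟨(chartAt (Fin 3 → ℂ) x₀).map_source h₀, ?_⟩
      rwa [(chartAt (Fin 3 → ℂ) x₀).left_inv h₀])
  change ContDiffAt ℂ ω (chartAt (Fin 3 → ℂ) x₁ ∘ (chartAt (Fin 3 → ℂ) x₀).symm) _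
  simpa [contDiffWithinAt_univ] using h

/-- In the tangent bundle, the frame around `x₀` is related to the identification of the tangent space at
`y` with the model space by the derivative of the change of charts. -/
theorem tangent_frameVec {x₀ y : X} (hy : y ∈ (chartAt (Fin 3 → ℂ) x₀).source) (c : Fin 3 → ℂ) :
    (frameVec 3 x₀ y c : TangentSpace 𝓘(ℂ, Fin 3 → ℂ) y) =
      fderiv ℂ (transition x₀ y) (chartAt (Fin 3 → ℂ) x₀ y) c := by
  have hb : y ∈ (trivializationAt (Fin 3 → ℂ) (TangentSpace 𝓘(ℂ, Fin 3 → ℂ)) x₀).baseSet := hy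
  rw [frameVec_eq_symm hb, ← Bundle.Trivialization.symmL_apply (R := ℂ) _ hb,
    TangentBundle.symmL_trivializationAt_eq_core hy, tangentBundleCore_coordChange_achart]
  simp only [mfld_simps, fderivWithin_univ]
  rfl

theorem transition_comp {x₀ x₁ x₂ y : X} (h₀ : y ∈ (chartAt (Fin 3 → ℂ) x₀).source)
    (h₁ : y ∈ (chartAt (Fin 3 → ℂ) x₁).source) :
    (fun u => transition x₁ x₂ (transition x₀ x₁ u)) =ᶠ[nhds (chartAt (Fin 3 → ℂ) x₀ y)]
      transition x₀ x₂ := by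
  have h := (chartAt (Fin 3 → ℂ) x₀).continuousAt_symm ((chartAt (Fin 3 → ℂ) x₀).map_source h₀)
  have h2 := h.eventually ((chartAt (Fin 3 → ℂ) x₁).open_source.mem_nhds (by
    rwa [(chartAt (Fin 3 → ℂ) x₀).left_inv h₀]))
  filter_upwards [h2] with u hu
  simp only [transition]
  rw [(chartAt (Fin 3 → ℂ) x₁).left_inv hu]

theorem transition_self {x₀ y : X} (h₀ : y ∈ (chartAt (Fin 3 → ℂ) x₀).source) :
    transition x₀ x₀ =ᶠ[nhds (chartAt (Fin 3 → ℂ) x₀ y)] id := by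
  filter_upwards [(chartAt (Fin 3 → ℂ) x₀).open_target.mem_nhds
    ((chartAt (Fin 3 → ℂ) x₀).map_source h₀)] with u hu
  exact (chartAt (Fin 3 → ℂ) x₀).right_inv hu

theorem transition_chart {x₀ y : X} (x₁ : X) (h₀ : y ∈ (chartAt (Fin 3 → ℂ) x₀).source) :
    transition x₀ x₁ (chartAt (Fin 3 → ℂ) x₀ y) = chartAt (Fin 3 → ℂ) x₁ y := by
  rw [transition, (chartAt (Fin 3 → ℂ) x₀).left_inv h₀]

/-- The derivatives of the two changes of coordinates are inverse to each other. -/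
theorem fderiv_transition_transition {x₀ x₁ y : X} (h₀ : y ∈ (chartAt (Fin 3 → ℂ) x₀).source)
    (h₁ : y ∈ (chartAt (Fin 3 → ℂ) x₁).source) (c : Fin 3 → ℂ) :
    fderiv ℂ (transition x₁ x₀) (chartAt (Fin 3 → ℂ) x₁ y)
      (fderiv ℂ (transition x₀ x₁) (chartAt (Fin 3 → ℂ) x₀ y) c) = c := by
  have h1 : DifferentiableAt ℂ (transition x₁ x₀) (transition x₀ x₁ (chartAt (Fin 3 → ℂ) x₀ y)) := by
    rw [transition_chart _ h₀]
    exact (contDiffAt_transition h₁ h₀).differentiableAt (by simp)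
  have h2 := (contDiffAt_transition h₀ h₁).differentiableAt (by simp)
  have h3 := fderiv_comp (chartAt (Fin 3 → ℂ) x₀ y) h1 h2
  have h4 : transition x₁ x₀ ∘ transition x₀ x₁ =ᶠ[nhds (chartAt (Fin 3 → ℂ) x₀ y)] id :=
    (transition_comp h₀ h₁).trans (transition_self h₀)
  rw [h4.fderiv_eq, transition_chart _ h₀, fderiv_id] at h3
  exact (congrArg (fun L : (Fin 3 → ℂ) →L[ℂ] (Fin 3 → ℂ) => L c) h3).symm

theorem gramPt_self_tangent (h : TangentForm X) (x : X) (c d : Fin 3 → ℂ) :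
    h x c d = star c ⬝ᵥ (gramPt 3 h x x *ᵥ d) := by
  rw [← form_frameVec, tangent_frameVec (mem_chart_source _ x),
    tangent_frameVec (mem_chart_source _ x), (transition_self (mem_chart_source _ x)).fderiv_eq,
    fderiv_id]
  rfl

end Tangent

/-! ### The mean curvature in arbitrary frames -/

section MeanCurvature

variable {X : Type*} [TopologicalSpace X] [ChartedSpace (Fin 3 → ℂ) X]
  [IsManifold 𝓘(ℂ, Fin 3 → ℂ) ω X]
variable {r : ℕ} {E : X → Type*} [∀ x, AddCommGroup (E x)] [∀ x, Module ℂ (E x)]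
  [∀ x, TopologicalSpace (E x)] [TopologicalSpace (Bundle.TotalSpace (Fin r → ℂ) E)]
  [FiberBundle (Fin r → ℂ) E] [VectorBundle ℂ (Fin r → ℂ) E]

/-- The coefficients of the curvature are its values on coordinate vectors. -/
theorem chernCurvature_eq (H : ∀ x, E x →ₗ⋆[ℂ] E x →ₗ[ℂ] ℂ) (x : X) (j k : Fin 3) :
    chernCurvature r H x j k =
      curvDir (gram r H x) (Pi.single j 1) (Pi.single k 1) (chartAt (Fin 3 → ℂ) x x) := by
  ext a b
  simp only [chernCurvature, curvDir, chernForm, dz_eq_dzDir, dzbar_eq_dzbarDir]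
  rfl

theorem sum_chernCurvature {H : ∀ x, E x →ₗ⋆[ℂ] E x →ₗ[ℂ] ℂ} {S : Set X} (hS : IsOpen S)
    (hH : IsHermitianMetricOn r H S) {x : X} (hx : x ∈ S) (a b : Fin 3 → ℂ) :
    ∑ j, ∑ k, (a j * conj (b k)) • chernCurvature r H x j k =
      curvDir (gram r H x) a b (chartAt (Fin 3 → ℂ) x x) := by
  have hu : chartAt (Fin 3 → ℂ) x x ∈ frameDomain r E x S :=
    mem_frameDomain (mem_chart_source _ x) (FiberBundle.mem_baseSet_trivializationAt' x) hx
  rw [curvDir_eq_sum ((matContDiffAt_gram hS hH hu).of_le ENat.LEInfty.out)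
    ((Matrix.isUnit_iff_isUnit_det _).1 (posDef_gram hH hu).isUnit)]
  simp only [chernCurvature_eq]

/-- The mean curvature computed from a basis of the tangent space, the columns of `P`, with Gram
matrix `M`. -/
theorem Fhat_eq_sum_basis {h : TangentForm X} {H : ∀ x, E x →ₗ⋆[ℂ] E x →ₗ[ℂ] ℂ} {S : Set X}
    (hS : IsOpen S) (hH : IsHermitianMetricOn r H S) {x : X} (hx : x ∈ S)
    (P M : Matrix (Fin 3) (Fin 3) ℂ) (hM : IsUnit M.det)
    (hPM : ∀ a b, h x (fun j => P j a) (fun j => P j b) = M a b) :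
    Fhat r h H x = (-2 * Complex.I) • ∑ a, ∑ b, M⁻¹ a b •
      curvDir (gram r H x) (fun j => P j a) (fun j => P j b) (chartAt (Fin 3 → ℂ) x x) := by
  have hM' : Pᴴ * gramPt 3 h x x * P = M := by
    ext a b
    rw [← hPM, gramPt_self_tangent, Matrix.mul_assoc]
    rfl
  have hPdet : IsUnit P.det := by
    rw [← hM', Matrix.det_mul] at hM
    exact isUnit_of_mul_isUnit_right hM
  have hPdet' : IsUnit (Pᴴ).det := by rw [Matrix.det_conjTranspose]; exact hPdet.star
  -- the change of basis formula `g⁻¹ = P M⁻¹ Pᴴ` for the inverse metric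
  have hinv : (gramPt 3 h x x)⁻¹ = P * M⁻¹ * Pᴴ := by
    rw [← hM', Matrix.mul_inv_rev, Matrix.mul_inv_rev, Matrix.mul_nonsing_inv_cancel_left _ _ hPdet,
      Matrix.nonsing_inv_mul_cancel_right _ _ hPdet']
  have hgram : gram 3 h x (chartAt (Fin 3 → ℂ) x x) = gramPt 3 h x x :=
    gram_chart h (mem_chart_source _ x)
  rw [Fhat, hgram, hinv]
  simp only [← sum_chernCurvature hS hH hx, Finset.smul_sum, smul_smul]
  have e1 : ∀ j k, (P * M⁻¹ * Pᴴ) j k = ∑ a, ∑ b, M⁻¹ a b * (P j a * conj (P k b)) := by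
    intro j k
    simp only [Matrix.mul_apply, Matrix.conjTranspose_apply, Finset.sum_mul, RCLike.star_def]
    rw [Finset.sum_comm]
    refine Finset.sum_congr rfl fun a _ => Finset.sum_congr rfl fun b _ => ?_
    ring
  simp only [e1, Finset.mul_sum, Finset.sum_smul]
  calc _ = ∑ j, ∑ a, ∑ k, ∑ b, (-2 * Complex.I * (M⁻¹ a b * (P j a * conj (P k b)))) •
        chernCurvature r H x j k := Finset.sum_congr rfl fun j _ => Finset.sum_comm
    _ = ∑ a, ∑ j, ∑ k, ∑ b, (-2 * Complex.I * (M⁻¹ a b * (P j a * conj (P k b)))) •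
        chernCurvature r H x j k := Finset.sum_comm
    _ = ∑ a, ∑ j, ∑ b, ∑ k, (-2 * Complex.I * (M⁻¹ a b * (P j a * conj (P k b)))) •
        chernCurvature r H x j k :=
        Finset.sum_congr rfl fun a _ => Finset.sum_congr rfl fun j _ => Finset.sum_comm
    _ = ∑ a, ∑ b, ∑ j, ∑ k, (-2 * Complex.I * (M⁻¹ a b * (P j a * conj (P k b)))) •
        chernCurvature r H x j k := Finset.sum_congr rfl fun a _ => Finset.sum_comm
    _ = _ := by
        refine Finset.sum_congr rfl fun a _ => Finset.sum_congr rfl fun b _ =>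
          Finset.sum_congr rfl fun j _ => Finset.sum_congr rfl fun k _ => ?_
        congr 1

variable [ContMDiffVectorBundle ω (Fin r → ℂ) E 𝓘(ℂ, Fin 3 → ℂ)]

theorem contDiffAt_frameChange {x₀ x₁ y : X}
    (hy : y ∈ (chartAt (Fin 3 → ℂ) x₁).source)
    (h₀ : y ∈ (trivializationAt (Fin r → ℂ) E x₀).baseSet)
    (h₁ : y ∈ (trivializationAt (Fin r → ℂ) E x₁).baseSet) (i j : Fin r) :
    ContDiffAt ℂ ω (fun w => frameChange r E x₀ x₁ ((chartAt (Fin 3 → ℂ) x₁).symm w) i j)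
      (chartAt (Fin 3 → ℂ) x₁ y) := by
  have h := contMDiffAt_coordChangeL (IB := 𝓘(ℂ, Fin 3 → ℂ)) (n := ω)
    (e := trivializationAt (Fin r → ℂ) E x₁) (e' := trivializationAt (Fin r → ℂ) E x₀) h₁ h₀
  have h2 := contMDiffOn_chart_symm (I := 𝓘(ℂ, Fin 3 → ℂ)) (n := ω) (x := x₁)
  have hmem := (chartAt (Fin 3 → ℂ) x₁).map_source hy
  have h3 := h2.contMDiffAt ((chartAt (Fin 3 → ℂ) x₁).open_target.mem_nhds hmem)
  have hl : (chartAt (Fin 3 → ℂ) x₁).symm (chartAt (Fin 3 → ℂ) x₁ y) = y :=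
    (chartAt (Fin 3 → ℂ) x₁).left_inv hy
  have h4 : ContMDiffAt 𝓘(ℂ, Fin 3 → ℂ) 𝓘(ℂ, (Fin r → ℂ) →L[ℂ] (Fin r → ℂ)) ω
      (fun w => ((trivializationAt (Fin r → ℂ) E x₁).coordChangeL ℂ
        (trivializationAt (Fin r → ℂ) E x₀) ((chartAt (Fin 3 → ℂ) x₁).symm w) :
          (Fin r → ℂ) →L[ℂ] (Fin r → ℂ))) (chartAt (Fin 3 → ℂ) x₁ y) := by
    rw [← hl] at h
    exact ContMDiffAt.comp (M' := X) (I' := 𝓘(ℂ, Fin 3 → ℂ)) (chartAt (Fin 3 → ℂ) x₁ y) h h3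
  have h5 := h4.contDiffAt
  have h6 := h5.clm_apply (contDiffAt_const (c := (Pi.single j 1 : Fin r → ℂ)))
  exact contDiffAt_pi.1 h6 i

/-- The curvature in the chart and frame around `x`, in terms of the chart and frame around `x₀`. -/
theorem curvDir_frameChange {H : ∀ x, E x →ₗ⋆[ℂ] E x →ₗ[ℂ] ℂ} {S : Set X} (hS : IsOpen S)
    (hH : IsHermitianMetricOn r H S) {x x₀ : X} (hx : x ∈ S)
    (hc : x ∈ (chartAt (Fin 3 → ℂ) x₀).source)
    (hb : x ∈ (trivializationAt (Fin r → ℂ) E x₀).baseSet) (a b : Fin 3 → ℂ) :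
    curvDir (gram r H x)
        (fderiv ℂ (transition x₀ x) (chartAt (Fin 3 → ℂ) x₀ x) a)
        (fderiv ℂ (transition x₀ x) (chartAt (Fin 3 → ℂ) x₀ x) b)
        (chartAt (Fin 3 → ℂ) x x) =
      (frameChange r E x₀ x x)⁻¹ * curvDir (gram r H x₀) a b (chartAt (Fin 3 → ℂ) x₀ x) *
        frameChange r E x₀ x x := by
  have hxc := mem_chart_source (Fin 3 → ℂ) x
  have hxb := FiberBundle.mem_baseSet_trivializationAt' (F := Fin r → ℂ) (E := E) x
  have hl : (chartAt (Fin 3 → ℂ) x).symm (chartAt (Fin 3 → ℂ) x x) = x :=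
    (chartAt (Fin 3 → ℂ) x).left_inv hxc
  have ht : transition x x₀ (chartAt (Fin 3 → ℂ) x x) = chartAt (Fin 3 → ℂ) x₀ x :=
    transition_chart x₀ hxc
  have hu := mem_frameDomain (S := S) hc hb hx
  have h := curvDir_transform (G' := gram r H x) (G := gram r H x₀) (τ := transition x x₀)
    (g := fun w => frameChange r E x₀ x ((chartAt (Fin 3 → ℂ) x).symm w))
    (w := chartAt (Fin 3 → ℂ) x x) ((contDiffAt_transition hxc hc).of_le le_top)
    (fun i j => (contDiffAt_frameChange hxc hb hxb i j).of_le le_top) (isUnit_frameChange _ _ _)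
    (by rw [ht]; exact (matContDiffAt_gram hS hH hu).of_le ENat.LEInfty.out)
    (by rw [ht]; exact (Matrix.isUnit_iff_isUnit_det _).1 (posDef_gram hH hu).isUnit)
    (by
      have hcont := (chartAt (Fin 3 → ℂ) x).continuousAt_symm ((chartAt (Fin 3 → ℂ) x).map_source hxc)
      have h1 := hcont.eventually ((chartAt (Fin 3 → ℂ) x₀).open_source.mem_nhds (by rwa [hl]))
      have h2 := hcont.eventually ((trivializationAt (Fin r → ℂ) E x₀).open_baseSet.mem_nhds
        (by rwa [hl]))
      have h3 := hcont.eventually ((trivializationAt (Fin r → ℂ) E x).open_baseSet.mem_nhds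
        (by rwa [hl]))
      filter_upwards [h1, h2, h3] with w h1 h2 h3
      have : gram r H x₀ (transition x x₀ w) = gramPt r H x₀ ((chartAt (Fin 3 → ℂ) x).symm w) :=
        gram_chart H h1
      rw [this]
      exact gramPt_frameChange H h2 h3)
    (fderiv ℂ (transition x₀ x) (chartAt (Fin 3 → ℂ) x₀ x) a)
    (fderiv ℂ (transition x₀ x) (chartAt (Fin 3 → ℂ) x₀ x) b)
  rw [h, ht, hl, fderiv_transition_transition hc hxc, fderiv_transition_transition hc hxc]

end MeanCurvature

/-! ### The distance function to the divisor -/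

namespace ACylKahler

variable {X : Type*} [TopologicalSpace X] [T2Space X] [CompactSpace X]
  [ChartedSpace (Fin 3 → ℂ) X] [IsManifold 𝓘(ℂ, Fin 3 → ℂ) ω X] (W : ACylKahler X)

open Classical in
/-- The function `|z|` on the tube `U`, extended by `1`. Off the divisor it coincides with `ε`; on
the divisor it vanishes, so that it is continuous on all of `X`. -/
def radius (x : X) : ℝ := if x ∈ W.U then ‖W.z x‖ else 1

theorem norm_z_lt_one {x : X} (hx : x ∈ W.U) : ‖W.z x‖ < 1 := by
  obtain ⟨e, he⟩ := W.tube
  have h := (e ⟨x, hx⟩).2.2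
  rw [(he ⟨x, hx⟩).2] at h
  simpa using h

theorem proj_mem {x : X} (hx : x ∈ W.U) : W.proj x ∈ W.D := by
  obtain ⟨e, he⟩ := W.tube
  rw [← (he ⟨x, hx⟩).1]
  exact (e ⟨x, hx⟩).1.2

theorem z_eq_zero_iff {x : X} (hx : x ∈ W.U) : W.z x = 0 ↔ x ∈ W.D := by
  rw [W.D_eq]
  exact ⟨fun h => ⟨hx, h⟩, fun h => h.2⟩

theorem continuousAt_z {x : X} (hx : x ∈ W.U) : ContinuousAt W.z x :=
  (W.holomorphic_z.mdifferentiableAt (W.isOpen_U.mem_nhds hx)).continuousAt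

theorem radius_of_mem {x : X} (hx : x ∈ W.U) : W.radius x = ‖W.z x‖ := if_pos hx

theorem radius_of_notMem {x : X} (hx : x ∉ W.U) : W.radius x = 1 := if_neg hx

theorem radius_le_one (x : X) : W.radius x ≤ 1 := by
  by_cases hx : x ∈ W.U
  · rw [W.radius_of_mem hx]; exact (W.norm_z_lt_one hx).le
  · rw [W.radius_of_notMem hx]

theorem radius_nonneg (x : X) : 0 ≤ W.radius x := by
  by_cases hx : x ∈ W.U
  · rw [W.radius_of_mem hx]; exact norm_nonneg _
  · rw [W.radius_of_notMem hx]; exact zero_le_one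

theorem mem_U_of_radius_lt_one {x : X} (hx : W.radius x < 1) : x ∈ W.U := by
  by_contra h
  rw [W.radius_of_notMem h] at hx
  exact lt_irrefl _ hx

theorem radius_pos {x : X} (hx : x ∉ W.D) : 0 < W.radius x := by
  by_cases h : x ∈ W.U
  · rw [W.radius_of_mem h]
    exact norm_pos_iff.2 fun h0 => hx ((W.z_eq_zero_iff h).1 h0)
  · rw [W.radius_of_notMem h]; exact zero_lt_one

theorem ε_eq_radius {x : X} (hx : x ∉ W.D) : W.ε x = W.radius x := by
  by_cases h : x ∈ W.U
  · have h0 : 0 < ‖W.z x‖ := by rw [← W.radius_of_mem h]; exact W.radius_pos hx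
    rw [ε, if_pos h, s, neg_neg, Real.exp_log h0, W.radius_of_mem h]
  · rw [ε, if_neg h, W.radius_of_notMem h]

/-- The closed tube `{|z| ≤ ρ}` is the image of the compact set `D × {|z| ≤ ρ}` under the inverse of
`(proj, z)`, hence closed in `X` and not only in `U`. -/
theorem isClosed_norm_z_le {ρ : ℝ} (hρ : ρ < 1) : IsClosed {x | x ∈ W.U ∧ ‖W.z x‖ ≤ ρ} := by
  obtain ⟨e, he⟩ := W.tube
  have : CompactSpace W.D := isCompact_iff_compactSpace.1 W.isClosed_D.isCompact
  have hK : IsCompact {b : Metric.ball (0 : ℂ) 1 | ‖(b : ℂ)‖ ≤ ρ} := by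
    rw [Topology.IsInducing.subtypeVal.isCompact_iff]
    have : ((↑) : Metric.ball (0 : ℂ) 1 → ℂ) '' {b | ‖(b : ℂ)‖ ≤ ρ} = Metric.closedBall 0 ρ := by
      ext y
      simp only [mem_image, mem_ofPred_eq, mem_closedBall_zero_iff]
      constructor
      · rintro ⟨b, hb, rfl⟩; exact hb
      · exact fun hy => ⟨⟨y, mem_ball_zero_iff.2 (hy.trans_lt hρ)⟩, hy, rfl⟩
    rw [this]
    exact isCompact_closedBall _ _
  have h2 := ((isCompact_univ (X := W.D)).prod hK).image e.symm.continuous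
  have h3 := (h2.image continuous_subtype_val).isClosed
  convert h3 using 1
  ext x
  simp only [mem_ofPred_eq, mem_image, mem_prod, mem_univ, true_and]
  constructor
  · rintro ⟨hx, hz⟩
    refine ⟨⟨x, hx⟩, ⟨e ⟨x, hx⟩, ?_, e.symm_apply_apply _⟩, rfl⟩
    rw [(he ⟨x, hx⟩).2]; exact hz
  · rintro ⟨y, ⟨p, hp, rfl⟩, rfl⟩
    refine ⟨(e.symm p).2, ?_⟩
    rw [← (he (e.symm p)).2, e.apply_symm_apply]; exact hp

/-- At boundary points of `U` continuity holds because the tubes `{|z| ≤ ρ}`, `ρ < 1`, are closed, so that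
`|z|` tends to `1`. -/
theorem continuous_radius : Continuous W.radius := by
  refine continuous_iff_continuousAt.2 fun x => ?_
  by_cases hx : x ∈ W.U
  · have h1 : (fun y => ‖W.z y‖) =ᶠ[nhds x] W.radius := by
      filter_upwards [W.isOpen_U.mem_nhds hx] with y hy using (W.radius_of_mem hy).symm
    exact (W.continuousAt_z hx).norm.congr h1
  · rw [ContinuousAt, W.radius_of_notMem hx]
    refine tendsto_order.2 ⟨fun c hc => ?_, fun c hc => ?_⟩
    · have h1 := (W.isClosed_norm_z_le hc).isOpen_compl.mem_nhds (x := x) (fun h => hx h.1)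
      filter_upwards [h1] with y hy
      by_cases hyU : y ∈ W.U
      · rw [W.radius_of_mem hyU]
        by_contra hcon
        exact hy ⟨hyU, not_lt.1 hcon⟩
      · rw [W.radius_of_notMem hyU]; exact hc
    · exact Filter.Eventually.of_forall fun y => (W.radius_le_one y).trans_lt hc

theorem isOpen_carrier : IsOpen W.carrier := W.isClosed_D.isOpen_compl

/-- Every neighbourhood of the divisor contains a tube `{|z| ≤ ρ}`. -/
theorem exists_radius_le_subset {N : Set X} (hN : IsOpen N) (hDN : W.D ⊆ N) :
    ∃ ρ : ℝ, 0 < ρ ∧ ρ < 1 ∧ ∀ x, W.radius x ≤ ρ → x ∈ N := by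
  rcases (Nᶜ).eq_empty_or_nonempty with h | h
  · exact ⟨1 / 2, by norm_num, by norm_num, fun x _ => by
      by_contra hx
      exact (h ▸ (show x ∈ Nᶜ from hx) : x ∈ (∅ : Set X))⟩
  · obtain ⟨x₀, hx₀, hmin⟩ := hN.isClosed_compl.isCompact.exists_isMinOn h
      W.continuous_radius.continuousOn
    have h0 : 0 < W.radius x₀ := W.radius_pos fun hD => hx₀ (hDN hD)
    refine ⟨W.radius x₀ / 2, by linarith, by linarith [W.radius_le_one x₀], fun x hx => ?_⟩
    by_contra hxN
    have := hmin hxN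
    simp only [mem_ofPred_eq] at this
    linarith

end ACylKahler

/-! ### Frames adapted to the divisor: linear algebra -/

section AdaptedLinear

theorem norm_dotProduct_mulVec_le {n : ℕ} {K : Matrix (Fin n) (Fin n) ℂ} {k : ℝ} (hK : ∀ i j, ‖K i j‖ ≤ k)
    (v w : Fin n → ℂ) : ‖star v ⬝ᵥ (K *ᵥ w)‖ ≤ (n * n * k) * ‖v‖ * ‖w‖ := by
  simp only [dotProduct, Matrix.mulVec, Pi.star_apply, Finset.mul_sum]
  refine (norm_sum_le _ _).trans ?_
  calc _ ≤ ∑ _i : Fin n, ∑ _j : Fin n, k * ‖v‖ * ‖w‖ := by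
        refine Finset.sum_le_sum fun i _ => (norm_sum_le _ _).trans (Finset.sum_le_sum fun j _ => ?_)
        rw [norm_mul, norm_mul, norm_star]
        have h1 := norm_le_pi_norm v i
        have h2 := norm_le_pi_norm w j
        have h3 := hK i j
        have h0 : 0 ≤ k := (norm_nonneg _).trans h3
        calc ‖v i‖ * (‖K i j‖ * ‖w j‖) ≤ ‖v‖ * (k * ‖w‖) := by gcongr
          _ = k * ‖v‖ * ‖w‖ := by ring
    _ = _ := by simp; ring

/-- A positive definite Hermitian form on `ℂ³` has an orthonormal pair in the kernel of any
linear functional. -/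
theorem exists_orthonormal_ker {K : Matrix (Fin 3) (Fin 3) ℂ} (hK : K.PosDef)
    (l : (Fin 3 → ℂ) →ₗ[ℂ] ℂ) : ∃ e : Fin 2 → (Fin 3 → ℂ), (∀ a, l (e a) = 0) ∧
      ∀ a b, star (e a) ⬝ᵥ (K *ᵥ e b) = if a = b then 1 else 0 := by
  obtain ⟨B, hB, rfl⟩ := exists_eq_conjTranspose_mul_self hK
  -- in the coordinates given by `B` the form is the standard one
  set l' : EuclideanSpace ℂ (Fin 3) →ₗ[ℂ] ℂ :=
    l ∘ₗ (Matrix.mulVecLin B⁻¹) ∘ₗ (WithLp.linearEquiv 2 ℂ (Fin 3 → ℂ)).toLinearMap with hl'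
  have hdim : 2 ≤ Module.finrank ℂ (LinearMap.ker l') := by
    have h1 := LinearMap.finrank_range_add_finrank_ker l'
    have h2 : Module.finrank ℂ (LinearMap.range l') ≤ 1 :=
      (Submodule.finrank_le _).trans (by simp)
    have h3 : Module.finrank ℂ (EuclideanSpace ℂ (Fin 3)) = 3 := by simp
    omega
  set b := stdOrthonormalBasis ℂ (LinearMap.ker l')
  set f : Fin 2 → EuclideanSpace ℂ (Fin 3) := fun a => (b (Fin.castLE hdim a) : EuclideanSpace ℂ (Fin 3))
  have hf : ∀ a c, inner ℂ (f a) (f c) = if a = c then (1 : ℂ) else 0 := by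
    intro a c
    have h := orthonormal_iff_ite.1 b.orthonormal (Fin.castLE hdim a) (Fin.castLE hdim c)
    rw [Submodule.coe_inner] at h
    simpa using h
  refine ⟨fun a => B⁻¹ *ᵥ (WithLp.ofLp (f a)), fun a => ?_, fun a c => ?_⟩
  · exact LinearMap.mem_ker.1 (b (Fin.castLE hdim a)).2
  · rw [star_dotProduct_factor, Matrix.mulVec_mulVec, Matrix.mulVec_mulVec,
      Matrix.mul_nonsing_inv _ hB, Matrix.one_mulVec, Matrix.one_mulVec, ← hf a c,
      EuclideanSpace.inner_eq_star_dotProduct, dotProduct_comm]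

variable {l lq : (Fin 3 → ℂ) →L[ℂ] ℂ} {A Aq : (Fin 3 → ℂ) →L[ℝ] (Fin 3 → ℂ)}
  {K : Matrix (Fin 3) (Fin 3) ℂ} {n₀ : Fin 3 → ℂ} {e : Fin 2 → (Fin 3 → ℂ)} {L : ℝ} {ζ : ℂ}

/-- A pair of functionals `(A, l)`, close to a pair `(Aq, lq)` for which `Aq` is the identity on the
kernel of `lq`, has almost unitary frames `p` for the form
`(v, w) ↦ ⟨A v, A w⟩_K + conj (l v / ζ) (l w / ζ)`: correct an orthonormal pair `e` in the kernel of
`lq` by multiples of a vector `n₀` transverse to the kernel of `l`. -/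
theorem exists_almost_unitary_frame (hL : 1 ≤ L) (hζ0 : ζ ≠ 0) (hζ : ‖ζ‖ ≤ 1)
    (hl : ‖l - lq‖ ≤ L * (L * ‖ζ‖)) (hA : ‖A - Aq‖ ≤ L * (L * ‖ζ‖)) (hAL : ‖A‖ ≤ L)
    (hln : 1 ≤ L * ‖l n₀‖) (hn : ‖n₀‖ ≤ L) (hAq : ∀ c, lq c = 0 → Aq c = c)
    (hle : ∀ a, lq (e a) = 0) (heL : ∀ a, ‖e a‖ ≤ L)
    (hK : ∀ v w, ‖star v ⬝ᵥ (K *ᵥ w)‖ ≤ L * ‖v‖ * ‖w‖)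
    (heK : ∀ a b, star (e a) ⬝ᵥ (K *ᵥ e b) = if a = b then 1 else 0) :
    ∃ p : Fin 3 → (Fin 3 → ℂ),
      (l (p 0) = 0 ∧ l (p 1) = 0 ∧ l (p 2) = ζ) ∧
      (‖p 0 - e 0‖ ≤ 2 * L ^ 5 * ‖ζ‖ ∧ ‖p 1 - e 1‖ ≤ 2 * L ^ 5 * ‖ζ‖ ∧
        ‖p 2‖ ≤ 2 * L ^ 5 * ‖ζ‖) ∧
      ∀ a b, ∀ c : ℂ, c = 1 ∨ c = Complex.I →
        ‖star (A (p a)) ⬝ᵥ (K *ᵥ A (c • p b)) + conj (l (p a) / ζ) * (l (c • p b) / ζ) -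
          c * (if a = b then 1 else 0)‖ ≤ 24 * L ^ 13 * ‖ζ‖ ∧
        (star (A (c • p a)) ⬝ᵥ (K *ᵥ A (c • p a)) +
          conj (l (c • p a) / ζ) * (l (c • p a) / ζ)).re ≤ 17 * L ^ 13 := by
  set t := ‖ζ‖ with ht
  have ht0 : 0 ≤ t := norm_nonneg _
  have hL0 : 0 < L := by linarith
  have hln0 : l n₀ ≠ 0 := fun h => by rw [h] at hln; simp at hln; linarith
  have hln0' : 0 < ‖l n₀‖ := norm_pos_iff.2 hln0
  set E : Fin 3 → (Fin 3 → ℂ) := ![e 0, e 1, 0] with hE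
  set Θ : Fin 3 → ℂ := ![0, 0, 1] with hΘ
  -- `γ` is chosen such that `l (p b) = Θ b * ζ`: the first two vectors are corrected to lie in `ker l`,
  -- the third one is the multiple of `n₀` with `l (p 2) = ζ`
  set γ : Fin 3 → ℂ := fun b => (Θ b * ζ - l (E b)) / l n₀ with hγ
  set p : Fin 3 → (Fin 3 → ℂ) := fun b => E b + γ b • n₀ with hp
  have hElq : ∀ b, lq (E b) = 0 := by
    intro b; fin_cases b <;> simp [hE, hle]
  have hEL : ∀ b, ‖E b‖ ≤ L := by
    intro b; fin_cases b <;> simp [hE, heL, hL0.le]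
  have hΘ1 : ∀ b, ‖Θ b‖ ≤ 1 := by
    intro b; fin_cases b <;> simp [hΘ]
  have hlp : ∀ b, l (p b) = Θ b * ζ := by
    intro b
    simp only [hp, hγ, map_add, map_smul, smul_eq_mul]
    field_simp
    ring
  -- `e` is orthonormal in `ker lq`, and `l` is `O(|ζ|)`-close to `lq`
  have hlE : ∀ b, ‖l (E b)‖ ≤ L ^ 3 * t := by
    intro b
    have h1 : l (E b) = (l - lq) (E b) := by simp [hElq b]
    rw [h1]
    calc _ ≤ ‖l - lq‖ * ‖E b‖ := (l - lq).le_opNorm _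
      _ ≤ (L * (L * t)) * L := by gcongr; exact hEL b
      _ = L ^ 3 * t := by ring
  have hpow : ∀ {m k : ℕ}, m ≤ k → L ^ m ≤ L ^ k := fun h => pow_le_pow_right₀ hL h
  have hγb : ∀ b, ‖γ b‖ ≤ 2 * L ^ 4 * t := by
    intro b
    rw [hγ]
    simp only [norm_div]
    rw [div_le_iff₀ hln0']
    have h1 : ‖Θ b * ζ - l (E b)‖ ≤ t + L ^ 3 * t := by
      refine (norm_sub_le _ _).trans (add_le_add ?_ (hlE b))
      rw [norm_mul]
      calc _ ≤ 1 * t := by gcongr; exact hΘ1 b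
        _ = t := one_mul _
    have h2 : t ≤ L ^ 3 * t := le_mul_of_one_le_left ht0 (one_le_pow₀ hL)
    calc _ ≤ 2 * L ^ 3 * t * 1 := by linarith
      _ ≤ 2 * L ^ 3 * t * (L * ‖l n₀‖) := by gcongr
      _ = _ := by ring
  have hpE : ∀ b, ‖p b - E b‖ ≤ 2 * L ^ 5 * t := by
    intro b
    simp only [hp, add_sub_cancel_left, norm_smul]
    calc _ ≤ 2 * L ^ 4 * t * L := by gcongr; exact hγb b
      _ = _ := by ring
  -- `A` is almost the identity on `p`
  have hAp : ∀ b, ∀ c : ℂ, ‖c‖ = 1 → ‖A (c • p b) - c • E b‖ ≤ 3 * L ^ 6 * t := by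
    intro b c hc
    have h1 : A (c • p b) - c • E b = A (c • (p b - E b)) + (A - Aq) (c • E b) := by
      have h2 : Aq (c • E b) = c • E b := hAq _ (by rw [map_smul, hElq, smul_zero])
      rw [smul_sub, map_sub, sub_apply, h2]
      abel
    rw [h1]
    calc _ ≤ ‖A‖ * ‖c • (p b - E b)‖ + ‖A - Aq‖ * ‖c • E b‖ :=
          (norm_add_le _ _).trans (add_le_add (A.le_opNorm _) ((A - Aq).le_opNorm _))
      _ ≤ L * (2 * L ^ 5 * t) + L * (L * t) * L := by
          rw [norm_smul, norm_smul, hc, one_mul, one_mul]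
          gcongr
          · exact hpE b
          · exact hEL b
      _ = 2 * L ^ 6 * t + L ^ 3 * t := by ring
      _ ≤ 2 * L ^ 6 * t + L ^ 6 * t := by
          have h8 : L ^ 3 * t ≤ L ^ 6 * t := mul_le_mul_of_nonneg_right (hpow (by norm_num)) ht0
          linarith
      _ = _ := by ring
  have hApn : ∀ b, ∀ c : ℂ, ‖c‖ = 1 → ‖A (c • p b)‖ ≤ 4 * L ^ 6 := by
    intro b c hc
    have h1 : A (c • p b) = (A (c • p b) - c • E b) + c • E b := by abel
    rw [h1]
    refine (norm_add_le _ _).trans ?_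
    rw [norm_smul, hc, one_mul]
    have h2 := hAp b c hc
    have h3 := hEL b
    have h4 : L ≤ L ^ 6 := by simpa using hpow (m := 1) (k := 6) (by norm_num)
    have h5 : 3 * L ^ 6 * t ≤ 3 * L ^ 6 * 1 := by gcongr
    linarith
  -- the model form on the exact pair `(E, Θ)`
  have hEΘ : ∀ a b, star (E a) ⬝ᵥ (K *ᵥ E b) + conj (Θ a) * Θ b = if a = b then 1 else 0 := by
    intro a b
    fin_cases a <;> fin_cases b <;> simp [hE, hΘ, heK]
  refine ⟨p, ⟨by simp [hlp, hΘ], by simp [hlp, hΘ], by simp [hlp, hΘ]⟩,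
    ⟨by simpa [hE] using hpE 0, by simpa [hE] using hpE 1, by simpa [hE] using hpE 2⟩, ?_⟩
  intro a b c hc
  have hc1 : ‖c‖ = 1 := by rcases hc with rfl | rfl <;> simp
  have hθ : ∀ b, ∀ c : ℂ, l (c • p b) / ζ = c * Θ b := by
    intro b c
    rw [map_smul, hlp, smul_eq_mul]
    field_simp
  have hθ' : ∀ b, l (p b) / ζ = Θ b := fun b => by rw [hlp]; field_simp
  constructor
  · have h1 : star (A (p a)) ⬝ᵥ (K *ᵥ A (c • p b)) + conj (l (p a) / ζ) * (l (c • p b) / ζ) -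
        c * (if a = b then 1 else 0) =
        star (A (p a) - E a) ⬝ᵥ (K *ᵥ A (c • p b)) +
          star (E a) ⬝ᵥ (K *ᵥ (A (c • p b) - c • E b)) := by
      rw [hθ, hθ', ← hEΘ a b, star_sub, sub_dotProduct, Matrix.mulVec_sub, dotProduct_sub,
        Matrix.mulVec_smul, dotProduct_smul, smul_eq_mul]
      ring
    rw [h1]
    have h2 : ‖A (p a) - E a‖ ≤ 3 * L ^ 6 * t := by simpa using hAp a 1 (by simp)
    calc _ ≤ L * (3 * L ^ 6 * t) * (4 * L ^ 6) + L * L * (3 * L ^ 6 * t) := by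
          refine (norm_add_le _ _).trans (add_le_add ((hK _ _).trans ?_) ((hK _ _).trans ?_))
          · gcongr
            exact hApn b c hc1
          · gcongr
            · exact hEL a
            · exact hAp b c hc1
      _ = 12 * L ^ 13 * t + 3 * L ^ 8 * t := by ring
      _ ≤ 12 * L ^ 13 * t + 12 * L ^ 13 * t := by
          have : L ^ 8 * t ≤ L ^ 13 * t := by gcongr ?_ * _; exact hpow (by norm_num)
          have : 0 ≤ L ^ 13 * t := by positivity
          nlinarith
      _ = _ := by ring
  · rw [hθ, map_mul]
    refine (Complex.re_le_norm _).trans ((norm_add_le _ _).trans ?_)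
    have h1 : ‖conj c * conj (Θ a) * (c * Θ a)‖ ≤ 1 := by
      simp only [norm_mul, RCLike.norm_conj, hc1, one_mul]
      exact mul_le_one₀ (hΘ1 a) (norm_nonneg _) (hΘ1 a)
    have h2 : ‖star (A (c • p a)) ⬝ᵥ (K *ᵥ A (c • p a))‖ ≤ 16 * L ^ 13 := by
      calc _ ≤ L * (4 * L ^ 6) * (4 * L ^ 6) := by
            refine (hK _ _).trans ?_
            have := hApn a c hc1
            gcongr
        _ = _ := by ring
    have h3 : 1 ≤ L ^ 13 := one_le_pow₀ hL
    linarith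

end AdaptedLinear

/-! ### The divisor in local coordinates -/

/-- The underlying real smooth manifold. -/
theorem isManifold_real (X : Type*) [TopologicalSpace X] [ChartedSpace (Fin 3 → ℂ) X]
    [IsManifold 𝓘(ℂ, Fin 3 → ℂ) ω X] : IsManifold 𝓘(ℝ, Fin 3 → ℂ) ∞ X := by
  refine isManifold_of_contDiffOn _ _ _ fun e e' he he' => ?_
  have h1 := HasGroupoid.compatible (G := contDiffGroupoid ω 𝓘(ℂ, Fin 3 → ℂ)) he he'
  rw [contDiffGroupoid, mem_groupoid_of_pregroupoid] at h1
  have h2 : ContDiffOn ℂ ω _ _ := h1.1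
  exact (h2.restrict_scalars ℝ).of_le le_top

section CoordVec

variable {X : Type*} [TopologicalSpace X] [ChartedSpace (Fin 3 → ℂ) X]
  [IsManifold 𝓘(ℂ, Fin 3 → ℂ) ω X]

/-- The tangent vector at `y` with components `c` in the chart around `p`, as an element of the
model space (that is, expressed in the chart around `y`). -/
def coordVec (p y : X) (c : Fin 3 → ℂ) : Fin 3 → ℂ :=
  fderiv ℂ (transition p y) (chartAt (Fin 3 → ℂ) p y) c

theorem form_coordVec (h : TangentForm X) {p y : X} (hy : y ∈ (chartAt (Fin 3 → ℂ) p).source)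
    (c d : Fin 3 → ℂ) :
    h y (coordVec p y c) (coordVec p y d) = star c ⬝ᵥ (gramPt 3 h p y *ᵥ d) := by
  rw [← form_frameVec, tangent_frameVec hy, tangent_frameVec hy]
  rfl

theorem coordVec_ne_zero {p y : X} (hy : y ∈ (chartAt (Fin 3 → ℂ) p).source) {c : Fin 3 → ℂ}
    (hc : c ≠ 0) : coordVec p y c ≠ 0 := by
  intro h
  apply hc
  rw [← fderiv_transition_transition hy (mem_chart_source _ y) c]
  change fderiv ℂ _ _ (coordVec p y c) = 0
  rw [h, map_zero]

theorem coordVec_zero (p y : X) : coordVec p y 0 = 0 := map_zero _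

end CoordVec

namespace ACylKahler

variable {X : Type*} [TopologicalSpace X] [T2Space X] [CompactSpace X]
  [ChartedSpace (Fin 3 → ℂ) X] [IsManifold 𝓘(ℂ, Fin 3 → ℂ) ω X] (W : ACylKahler X)

/-- The function `z` in the chart around `p`. -/
def zCoord (p : X) (u : Fin 3 → ℂ) : ℂ := W.z ((chartAt (Fin 3 → ℂ) p).symm u)

/-- The projection to the divisor in the chart around `p`. -/
def projCoord (p : X) (u : Fin 3 → ℂ) : Fin 3 → ℂ :=
  chartAt (Fin 3 → ℂ) p (W.proj ((chartAt (Fin 3 → ℂ) p).symm u))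

theorem zCoord_chart {p y : X} (hy : y ∈ (chartAt (Fin 3 → ℂ) p).source) :
    W.zCoord p (chartAt (Fin 3 → ℂ) p y) = W.z y := by
  rw [zCoord, (chartAt (Fin 3 → ℂ) p).left_inv hy]

theorem projCoord_chart {p y : X} (hy : y ∈ (chartAt (Fin 3 → ℂ) p).source) :
    W.projCoord p (chartAt (Fin 3 → ℂ) p y) = chartAt (Fin 3 → ℂ) p (W.proj y) := by
  rw [projCoord, (chartAt (Fin 3 → ℂ) p).left_inv hy]

theorem contDiffAt_zCoord {p y : X} (hy : y ∈ (chartAt (Fin 3 → ℂ) p).source) (hyU : y ∈ W.U) :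
    ContDiffAt ℂ 2 (W.zCoord p) (chartAt (Fin 3 → ℂ) p y) := by
  have hopen : IsOpen ((chartAt (Fin 3 → ℂ) p).target ∩ (chartAt (Fin 3 → ℂ) p).symm ⁻¹' W.U) :=
    (chartAt (Fin 3 → ℂ) p).symm.isOpen_inter_preimage W.isOpen_U
  refine contDiffAt_two_of_differentiableOn hopen ?_ (u := chartAt (Fin 3 → ℂ) p y)
    ⟨(chartAt (Fin 3 → ℂ) p).map_source hy, by
      rwa [mem_preimage, (chartAt (Fin 3 → ℂ) p).left_inv hy]⟩
  have h := (mdifferentiableOn_iff.1 (W.holomorphic_z)).2 p 0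
  simp only [mfld_simps] at h
  exact h.mono fun u hu => ⟨hu.1, hu.2, trivial⟩

theorem mfderiv_z_coordVec {p y : X} (hy : y ∈ (chartAt (Fin 3 → ℂ) p).source) (hyU : y ∈ W.U)
    (c : Fin 3 → ℂ) :
    mfderiv 𝓘(ℂ, Fin 3 → ℂ) 𝓘(ℂ, ℂ) W.z y (coordVec p y c) =
      fderiv ℂ (W.zCoord p) (chartAt (Fin 3 → ℂ) p y) c := by
  have hxc := mem_chart_source (Fin 3 → ℂ) y
  have h1 := W.holomorphic_z.mdifferentiableAt (W.isOpen_U.mem_nhds hyU)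
  have h2 : mfderiv 𝓘(ℂ, Fin 3 → ℂ) 𝓘(ℂ, ℂ) W.z y =
      fderiv ℂ (W.zCoord y) (chartAt (Fin 3 → ℂ) y y) := by
    rw [h1.mfderiv]
    simp only [mfld_simps, fderivWithin_univ]
    rfl
  have ht : transition p y (chartAt (Fin 3 → ℂ) p y) = chartAt (Fin 3 → ℂ) y y :=
    transition_chart y hy
  have h3 : W.zCoord p =ᶠ[nhds (chartAt (Fin 3 → ℂ) p y)] W.zCoord y ∘ transition p y := by
    have h := (chartAt (Fin 3 → ℂ) p).continuousAt_symm ((chartAt (Fin 3 → ℂ) p).map_source hy)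
    filter_upwards [h.eventually ((chartAt (Fin 3 → ℂ) y).open_source.mem_nhds (by
      rwa [(chartAt (Fin 3 → ℂ) p).left_inv hy]))] with u hu
    simp only [Function.comp, transition, zCoord]
    rw [(chartAt (Fin 3 → ℂ) y).left_inv hu]
  have h4 : DifferentiableAt ℂ (W.zCoord y) (transition p y (chartAt (Fin 3 → ℂ) p y)) := by
    rw [ht]; exact (W.contDiffAt_zCoord hxc hyU).differentiableAt (by norm_num)
  rw [h2, h3.fderiv_eq, fderiv_comp _ h4
    ((contDiffAt_transition hy hxc).differentiableAt (by simp)), ht]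
  rfl

theorem contDiffAt_projCoord {p y : X} (hy : y ∈ (chartAt (Fin 3 → ℂ) p).source) (hyU : y ∈ W.U)
    (hpy : W.proj y ∈ (chartAt (Fin 3 → ℂ) p).source) :
    ContDiffAt ℝ ∞ (W.projCoord p) (chartAt (Fin 3 → ℂ) p y) := by
  have := isManifold_real X
  have h := (contMDiffAt_iff_of_mem_source (I := 𝓘(ℝ, Fin 3 → ℂ)) (I' := 𝓘(ℝ, Fin 3 → ℂ)) hy hpy).1
    (W.smooth_proj.contMDiffAt (W.isOpen_U.mem_nhds hyU))
  have h2 := h.2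
  simp only [mfld_simps, contDiffWithinAt_univ] at h2
  exact h2

theorem continuousAt_proj {y : X} (hyU : y ∈ W.U) : ContinuousAt W.proj y :=
  (W.smooth_proj.contMDiffAt (W.isOpen_U.mem_nhds hyU)).continuousAt

/-- The differential of the projection in the charts around the points equals its differential in the
chart around `p`. -/
theorem mfderiv_proj_coordVec {p y : X} (hy : y ∈ (chartAt (Fin 3 → ℂ) p).source) (hyU : y ∈ W.U)
    (hpy : W.proj y ∈ (chartAt (Fin 3 → ℂ) p).source) (c : Fin 3 → ℂ) :
    mfderiv 𝓘(ℝ, Fin 3 → ℂ) 𝓘(ℝ, Fin 3 → ℂ) W.proj y (coordVec p y c) =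
      coordVec p (W.proj y) (fderiv ℝ (W.projCoord p) (chartAt (Fin 3 → ℂ) p y) c) := by
  have hyc := mem_chart_source (Fin 3 → ℂ) y
  have hqc := mem_chart_source (Fin 3 → ℂ) (W.proj y)
  have h1 := (W.smooth_proj.contMDiffAt (W.isOpen_U.mem_nhds hyU)).mdifferentiableAt (by simp)
  have h2 : mfderiv 𝓘(ℝ, Fin 3 → ℂ) 𝓘(ℝ, Fin 3 → ℂ) W.proj y =
      fderiv ℝ (fun u => chartAt (Fin 3 → ℂ) (W.proj y)
        (W.proj ((chartAt (Fin 3 → ℂ) y).symm u))) (chartAt (Fin 3 → ℂ) y y) := by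
    rw [h1.mfderiv]
    simp only [mfld_simps, fderivWithin_univ]
    rfl
  have ht : transition y p (chartAt (Fin 3 → ℂ) y y) = chartAt (Fin 3 → ℂ) p y :=
    transition_chart p hyc
  have hτ := ((contDiffAt_transition hyc hy).restrict_scalars ℝ).differentiableAt (by simp)
  have hτ' := ((contDiffAt_transition hpy hqc).restrict_scalars ℝ).differentiableAt (by simp)
  have hP := (W.contDiffAt_projCoord hy hyU hpy).differentiableAt (by simp)
  have h3 : (fun u => chartAt (Fin 3 → ℂ) (W.proj y) (W.proj ((chartAt (Fin 3 → ℂ) y).symm u)))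
      =ᶠ[nhds (chartAt (Fin 3 → ℂ) y y)]
      transition p (W.proj y) ∘ (W.projCoord p ∘ transition y p) := by
    have h := (chartAt (Fin 3 → ℂ) y).continuousAt_symm ((chartAt (Fin 3 → ℂ) y).map_source hyc)
    have h' : ContinuousAt (fun u => W.proj ((chartAt (Fin 3 → ℂ) y).symm u))
        (chartAt (Fin 3 → ℂ) y y) := by
      refine ContinuousAt.comp ?_ h
      rw [(chartAt (Fin 3 → ℂ) y).left_inv hyc]
      exact W.continuousAt_proj hyU
    filter_upwards [h.eventually ((chartAt (Fin 3 → ℂ) p).open_source.mem_nhds (by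
      rwa [(chartAt (Fin 3 → ℂ) y).left_inv hyc])),
      h'.eventually ((chartAt (Fin 3 → ℂ) p).open_source.mem_nhds (by
      beta_reduce; rwa [(chartAt (Fin 3 → ℂ) y).left_inv hyc]))] with u hu hu'
    simp only [Function.comp, transition, projCoord]
    rw [(chartAt (Fin 3 → ℂ) p).left_inv hu, (chartAt (Fin 3 → ℂ) p).left_inv hu']
  have e1 : W.projCoord p (transition y p (chartAt (Fin 3 → ℂ) y y)) =
      chartAt (Fin 3 → ℂ) p (W.proj y) := by rw [ht, W.projCoord_chart hy]
  have h4 : HasFDerivAt (transition p (W.proj y) ∘ (W.projCoord p ∘ transition y p))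
      ((fderiv ℝ (transition p (W.proj y)) (chartAt (Fin 3 → ℂ) p (W.proj y))).comp
        ((fderiv ℝ (W.projCoord p) (chartAt (Fin 3 → ℂ) p y)).comp
          (fderiv ℝ (transition y p) (chartAt (Fin 3 → ℂ) y y)))) (chartAt (Fin 3 → ℂ) y y) := by
    refine HasFDerivAt.comp _ ?_ (HasFDerivAt.comp _ ?_ hτ.hasFDerivAt)
    · simp only [Function.comp]; rw [e1]; exact hτ'.hasFDerivAt
    · rw [ht]; exact hP.hasFDerivAt
  have e2 : fderiv ℝ (transition y p) (chartAt (Fin 3 → ℂ) y y) =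
      (fderiv ℂ (transition y p) (chartAt (Fin 3 → ℂ) y y)).restrictScalars ℝ :=
    ((contDiffAt_transition hyc hy).differentiableAt (by simp)).fderiv_restrictScalars ℝ
  have e3 : fderiv ℝ (transition p (W.proj y)) (chartAt (Fin 3 → ℂ) p (W.proj y)) =
      (fderiv ℂ (transition p (W.proj y)) (chartAt (Fin 3 → ℂ) p (W.proj y))).restrictScalars ℝ :=
    ((contDiffAt_transition hpy hqc).differentiableAt (by simp)).fderiv_restrictScalars ℝ
  rw [h2, h3.fderiv_eq, h4.fderiv, e2, e3]
  have := fderiv_transition_transition hy hyc c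
  exact congrArg (fun w => fderiv ℂ (transition p (W.proj y)) (chartAt (Fin 3 → ℂ) p (W.proj y))
    (fderiv ℝ (W.projCoord p) (chartAt (Fin 3 → ℂ) p y) w)) this

theorem injective_projCoord_zCoord {p y : X} (hy : y ∈ (chartAt (Fin 3 → ℂ) p).source)
    (hyU : y ∈ W.U) (hpy : W.proj y ∈ (chartAt (Fin 3 → ℂ) p).source) {c : Fin 3 → ℂ}
    (h1 : fderiv ℝ (W.projCoord p) (chartAt (Fin 3 → ℂ) p y) c = 0)
    (h2 : fderiv ℂ (W.zCoord p) (chartAt (Fin 3 → ℂ) p y) c = 0) : c = 0 := by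
  by_contra hc
  refine coordVec_ne_zero hy hc (W.immersion y hyU _ ?_ ?_)
  · exact (W.mfderiv_proj_coordVec hy hyU hpy c).trans
      ((congrArg (coordVec p (W.proj y)) h1).trans (coordVec_zero p (W.proj y)))
  · exact (W.mfderiv_z_coordVec hy hyU c).trans h2

theorem proj_proj {y : X} (hyU : y ∈ W.U) : W.proj (W.proj y) = W.proj y :=
  W.proj_D _ (W.proj_mem hyU)

theorem z_proj {y : X} (hyU : y ∈ W.U) : W.z (W.proj y) = 0 :=
  (W.z_eq_zero_iff (W.D_subset (W.proj_mem hyU))).2 (W.proj_mem hyU)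

/-- At points of the divisor the differential of the projection is the identity on `ker dz`: it is
idempotent with values in `ker dz`, and injective there. -/
theorem fderiv_projCoord_of_ker {p q : X} (hq : q ∈ (chartAt (Fin 3 → ℂ) p).source) (hqD : q ∈ W.D)
    {c : Fin 3 → ℂ} (hc : fderiv ℂ (W.zCoord p) (chartAt (Fin 3 → ℂ) p q) c = 0) :
    fderiv ℝ (W.projCoord p) (chartAt (Fin 3 → ℂ) p q) c = c := by
  have hqU := W.D_subset hqD
  have hpq : W.proj q = q := W.proj_D q hqD
  have hq' : W.proj q ∈ (chartAt (Fin 3 → ℂ) p).source := by rwa [hpq]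
  have hP := (W.contDiffAt_projCoord hq hqU hq').differentiableAt (by simp)
  have hz := ((W.contDiffAt_zCoord hq hqU).differentiableAt (by norm_num))
  have hfix : W.projCoord p (chartAt (Fin 3 → ℂ) p q) = chartAt (Fin 3 → ℂ) p q := by
    rw [W.projCoord_chart hq, hpq]
  have hcont := (chartAt (Fin 3 → ℂ) p).continuousAt_symm ((chartAt (Fin 3 → ℂ) p).map_source hq)
  have hl := (chartAt (Fin 3 → ℂ) p).left_inv hq
  have hcont' : ContinuousAt (fun u => W.proj ((chartAt (Fin 3 → ℂ) p).symm u))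
        (chartAt (Fin 3 → ℂ) p q) := by
    refine ContinuousAt.comp ?_ hcont
    rw [hl]; exact W.continuousAt_proj hqU
  have hU := hcont.eventually (W.isOpen_U.mem_nhds (by rwa [hl]))
  have hS := hcont'.eventually ((chartAt (Fin 3 → ℂ) p).open_source.mem_nhds (by beta_reduce; rwa [hl, hpq]))
  have e1 : W.projCoord p ∘ W.projCoord p =ᶠ[nhds (chartAt (Fin 3 → ℂ) p q)] W.projCoord p := by
    filter_upwards [hU, hS] with u hu hs
    simp only [Function.comp, projCoord]
    rw [(chartAt (Fin 3 → ℂ) p).left_inv hs, W.proj_proj hu]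
  have e2 : W.zCoord p ∘ W.projCoord p =ᶠ[nhds (chartAt (Fin 3 → ℂ) p q)] fun _ => 0 := by
    filter_upwards [hU, hS] with u hu hs
    simp only [Function.comp, projCoord, zCoord]
    rw [(chartAt (Fin 3 → ℂ) p).left_inv hs, W.z_proj hu]
  set A := fderiv ℝ (W.projCoord p) (chartAt (Fin 3 → ℂ) p q)
  have f1 : ∀ v, A (A v) = A v := by
    intro v
    have h := (HasFDerivAt.comp _ (g := W.projCoord p) (by rw [hfix]; exact hP.hasFDerivAt)
      hP.hasFDerivAt).fderiv
    rw [e1.fderiv_eq] at h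
    exact (congrArg (fun L : (Fin 3 → ℂ) →L[ℝ] (Fin 3 → ℂ) => L v) h).symm
  have f2 : ∀ v, fderiv ℂ (W.zCoord p) (chartAt (Fin 3 → ℂ) p q) (A v) = 0 := by
    intro v
    have h := (HasFDerivAt.comp (chartAt (Fin 3 → ℂ) p q) (g := W.zCoord p) (f := W.projCoord p)
      (by rw [hfix]; exact hz.hasFDerivAt.restrictScalars ℝ) hP.hasFDerivAt).fderiv
    rw [e2.fderiv_eq, fderiv_fun_const] at h
    exact (congrArg (fun L : (Fin 3 → ℂ) →L[ℝ] ℂ => L v) h).symm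
  -- `A c - c` lies in the kernels of `A` and `dz`
  have f3 : A c - c = 0 := W.injective_projCoord_zCoord hq hqU hq' (by
    rw [map_sub]; exact sub_eq_zero.2 (f1 c)) (by rw [map_sub, f2, hc, sub_zero])
  exact sub_eq_zero.1 f3

end ACylKahler

/-! ### Unitary frames adapted to the divisor -/

theorem MatContDiffAt.eventually_norm_le {n m : ℕ} {k : WithTop ℕ∞}
    {A : (Fin n → ℂ) → Matrix (Fin m) (Fin m) ℂ} {u : Fin n → ℂ} (hA : MatContDiffAt k A u) :
    ∃ C : ℝ, ∀ᶠ v in nhds u, ∀ i j, ‖A v i j‖ ≤ C := by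
  refine ⟨∑ i, ∑ j, (‖A u i j‖ + 1), ?_⟩
  simp only [Filter.eventually_all]
  intro i j
  have h1 : ∀ᶠ v in nhds u, ‖A v i j‖ < ‖A u i j‖ + 1 :=
    (hA i j).continuousAt.norm.eventually_lt_const (by linarith)
  filter_upwards [h1] with v hv
  have h2 : ‖A u i j‖ + 1 ≤ ∑ j, (‖A u i j‖ + 1) :=
    Finset.single_le_sum (f := fun j => ‖A u i j‖ + 1) (fun _ _ => by positivity) (Finset.mem_univ j)
  have h3 : ∑ j, (‖A u i j‖ + 1) ≤ ∑ i, ∑ j, (‖A u i j‖ + 1) :=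
    Finset.single_le_sum (f := fun i => ∑ j, (‖A u i j‖ + 1))
      (fun _ _ => Finset.sum_nonneg fun _ _ => by positivity) (Finset.mem_univ i)
  linarith

/-- The components of a vector are controlled by its length and the inverse Gram matrix. -/
theorem norm_apply_sq_le_form {n : ℕ} {K : Matrix (Fin n) (Fin n) ℂ} (hK : K.PosDef)
    (v : Fin n → ℂ) (i : Fin n) : ‖v i‖ ^ 2 ≤ ‖K⁻¹ i i‖ * (star v ⬝ᵥ (K *ᵥ v)).re := by
  have hdet : IsUnit K.det := (Matrix.isUnit_iff_isUnit_det _).1 hK.isUnit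
  have hKi : (K⁻¹)ᴴ = K⁻¹ := hK.isHermitian.inv
  -- `w` represents the functional `v ↦ v i` in the inner product `K`
  set w : Fin n → ℂ := K⁻¹ *ᵥ Pi.single i 1
  have hw : K *ᵥ w = Pi.single i 1 := by
    simp only [w, Matrix.mulVec_mulVec, Matrix.mul_nonsing_inv _ hdet, Matrix.one_mulVec]
  have h1 : star w ⬝ᵥ (K *ᵥ v) = v i := by
    simp only [w]
    rw [Matrix.star_mulVec, hKi, ← Matrix.dotProduct_mulVec, Matrix.mulVec_mulVec,
      Matrix.nonsing_inv_mul _ hdet, Matrix.one_mulVec, ← Pi.single_star]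
    simp
  have h2 : (star w ⬝ᵥ (K *ᵥ w)).re ≤ ‖K⁻¹ i i‖ := by
    rw [hw]
    have : star w ⬝ᵥ (Pi.single i 1 : Fin n → ℂ) = star (K⁻¹ i i) := by
      simp [w]
    rw [this, ← norm_star (K⁻¹ i i)]
    exact Complex.re_le_norm _
  have h3 := norm_form_sq_le hK w v
  rw [h1] at h3
  exact h3.trans (mul_le_mul_of_nonneg_right h2 (form_re_nonneg hK v))

namespace ACylKahler

variable {X : Type*} [TopologicalSpace X] [T2Space X] [CompactSpace X]
  [ChartedSpace (Fin 3 → ℂ) X] [IsManifold 𝓘(ℂ, Fin 3 → ℂ) ω X] (W : ACylKahler X)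

/-- Near a point of the divisor the distance from `x` to `proj x` is `O(|z x|)`, because
`(proj, z)` is an immersion. -/
theorem eventually_norm_sub_proj_le {p : X} (hp : p ∈ W.D) : ∃ L : ℝ, ∀ᶠ x in nhds p,
    ‖chartAt (Fin 3 → ℂ) p x - chartAt (Fin 3 → ℂ) p (W.proj x)‖ ≤ L * ‖W.z x‖ := by
  have hpc := mem_chart_source (Fin 3 → ℂ) p
  have hpU := W.D_subset hp
  have hpp : W.proj p = p := W.proj_D p hp
  have hpc' : W.proj p ∈ (chartAt (Fin 3 → ℂ) p).source := by rwa [hpp]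
  set φ := chartAt (Fin 3 → ℂ) p
  set Φ : (Fin 3 → ℂ) → (Fin 3 → ℂ) × ℂ := fun u => (W.projCoord p u, W.zCoord p u)
  set A := fderiv ℝ (W.projCoord p) (φ p) with hA
  set l := fderiv ℂ (W.zCoord p) (φ p) with hl
  have hs : HasStrictFDerivAt Φ (A.prod (l.restrictScalars ℝ)) (φ p) :=
    ((W.contDiffAt_projCoord hpc hpU hpc').hasStrictFDerivAt (by simp)).prodMk
      (((W.contDiffAt_zCoord hpc hpU).hasStrictFDerivAt (by norm_num)).restrictScalars ℝ)
  -- the differential of `(proj, z)` is injective, hence bounded below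
  obtain ⟨K, hK0, hK⟩ := LinearMap.exists_antilipschitzWith
    ((A.prod (l.restrictScalars ℝ)) : (Fin 3 → ℂ) →ₗ[ℝ] (Fin 3 → ℂ) × ℂ) (by
      rw [LinearMap.ker_eq_bot']
      intro c hc
      have hc' : (A c, l c) = 0 := hc
      rw [Prod.mk_eq_zero] at hc'
      exact W.injective_projCoord_zCoord hpc hpU hpc' hc'.1 hc'.2)
  have hK0' : (0 : ℝ) < K := by exact_mod_cast hK0
  have hlo := hs.isLittleO.def (c := 1 / (2 * K)) (by positivity)
  have ht : Filter.Tendsto (fun x => (φ x, φ (W.proj x))) (nhds p) (nhds (φ p, φ p)) := by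
    refine Filter.Tendsto.prodMk_nhds (φ.continuousAt hpc) ?_
    have h2 : ContinuousAt (φ ∘ W.proj) p := by
      refine ContinuousAt.comp ?_ (W.continuousAt_proj hpU)
      rw [hpp]; exact φ.continuousAt hpc
    have h3 : (φ ∘ W.proj) p = φ p := congrArg φ hpp
    rw [ContinuousAt, h3] at h2
    exact h2
  refine ⟨2 * K, ?_⟩
  filter_upwards [ht.eventually hlo, φ.open_source.mem_nhds hpc, W.isOpen_U.mem_nhds hpU,
    (W.continuousAt_proj hpU).eventually (φ.open_source.mem_nhds hpc')] with x hx hxs hxU hxp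
  have hxp : W.proj x ∈ φ.source := hxp
  set d := φ x - φ (W.proj x) with hd
  -- `x` and `proj x` have the same projection and differ only in `z`
  have e1 : Φ (φ x) - Φ (φ (W.proj x)) = (0, W.z x) := by
    have hq := W.D_subset (W.proj_mem hxU)
    simp only [Φ, Prod.mk_sub_mk]
    rw [W.projCoord_chart hxs, W.projCoord_chart hxp, W.proj_proj hxU, W.zCoord_chart hxs,
      W.zCoord_chart hxp, W.z_proj hxU, sub_self, sub_zero]
  have h4 : ‖(A.prod (l.restrictScalars ℝ)) d‖ ≤ ‖W.z x‖ + 1 / (2 * K) * ‖d‖ := by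
    have h5 : ‖(0, W.z x) - (A.prod (l.restrictScalars ℝ)) d‖ ≤ 1 / (2 * K) * ‖d‖ := by
      rw [← e1]; exact hx
    have h6 : ‖((0 : Fin 3 → ℂ), W.z x)‖ = ‖W.z x‖ := by simp [Prod.norm_def]
    have h7 := norm_sub_norm_le ((A.prod (l.restrictScalars ℝ)) d) (0, W.z x)
    rw [norm_sub_rev] at h7
    linarith
  have h8 := hK.le_mul_dist d 0
  rw [dist_zero_right, map_zero, dist_zero_right] at h8
  have h9 : ‖d‖ ≤ K * (‖W.z x‖ + 1 / (2 * K) * ‖d‖) :=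
    h8.trans (mul_le_mul_of_nonneg_left h4 hK0'.le)
  have h10 : K * (‖W.z x‖ + 1 / (2 * K) * ‖d‖) = K * ‖W.z x‖ + ‖d‖ / 2 := by field_simp
  linarith

theorem tendsto_chart_proj {p : X} (hp : p ∈ W.D) :
    Filter.Tendsto (fun x => chartAt (Fin 3 → ℂ) p (W.proj x)) (nhds p)
      (nhds (chartAt (Fin 3 → ℂ) p p)) := by
  have hpp : W.proj p = p := W.proj_D p hp
  have h2 : ContinuousAt (chartAt (Fin 3 → ℂ) p ∘ W.proj) p := by
    refine ContinuousAt.comp ?_ (W.continuousAt_proj (W.D_subset hp))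
    rw [hpp]; exact (chartAt (Fin 3 → ℂ) p).continuousAt (mem_chart_source _ p)
  have h3 : (chartAt (Fin 3 → ℂ) p ∘ W.proj) p = chartAt (Fin 3 → ℂ) p p :=
    congrArg (chartAt (Fin 3 → ℂ) p) hpp
  rw [ContinuousAt, h3] at h2
  exact h2

/-- A function which is `C¹` in the chart around a point of the divisor varies by `O(|z x|)`
between `x` and `proj x`. -/
theorem eventually_norm_sub_le {F : Type*} [NormedAddCommGroup F] [NormedSpace ℝ F] {p : X}
    (hp : p ∈ W.D) {f : (Fin 3 → ℂ) → F} (hf : ContDiffAt ℝ 1 f (chartAt (Fin 3 → ℂ) p p)) :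
    ∃ L : ℝ, ∀ᶠ x in nhds p, ‖f (chartAt (Fin 3 → ℂ) p x) -
      f (chartAt (Fin 3 → ℂ) p (W.proj x))‖ ≤ L * ‖W.z x‖ := by
  obtain ⟨K, t, ht, hK⟩ := hf.exists_lipschitzOnWith
  obtain ⟨L, hL⟩ := W.eventually_norm_sub_proj_le hp
  refine ⟨K * L, ?_⟩
  filter_upwards [hL, (W.tendsto_chart_proj hp).eventually ht,
    ((chartAt (Fin 3 → ℂ) p).continuousAt (mem_chart_source _ p)).eventually ht] with x h1 h2 h3
  calc _ ≤ K * ‖chartAt (Fin 3 → ℂ) p x - chartAt (Fin 3 → ℂ) p (W.proj x)‖ :=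
        hK.norm_sub_le h3 h2
    _ ≤ K * (L * ‖W.z x‖) := by gcongr
    _ = _ := by ring

end ACylKahler

section TangentGram

variable {X : Type*} [TopologicalSpace X] [ChartedSpace (Fin 3 → ℂ) X]
  [IsManifold 𝓘(ℂ, Fin 3 → ℂ) ω X]

theorem matContDiffAt_gram_tangent {h : TangentForm X} {S : Set X} (hS : IsOpen S)
    (hH : IsHermitianMetricOn 3 h S) {p y : X} (hy : y ∈ (chartAt (Fin 3 → ℂ) p).source)
    (hyS : y ∈ S) : MatContDiffAt ∞ (gram 3 h p) (chartAt (Fin 3 → ℂ) p y) :=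
  matContDiffAt_gram (E := TangentSpace 𝓘(ℂ, Fin 3 → ℂ)) hS hH
    (mem_frameDomain (E := TangentSpace 𝓘(ℂ, Fin 3 → ℂ)) hy hy hyS)

theorem posDef_gramPt_tangent {h : TangentForm X} {S : Set X}
    (hH : IsHermitianMetricOn 3 h S) {p y : X} (hy : y ∈ (chartAt (Fin 3 → ℂ) p).source)
    (hyS : y ∈ S) : (gramPt 3 h p y).PosDef :=
  posDef_gramPt (E := TangentSpace 𝓘(ℂ, Fin 3 → ℂ)) hH hy hyS

end TangentGram

theorem exists_common_bound (a b c d e f g : ℝ) :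
    ∃ L : ℝ, 1 ≤ L ∧ a ≤ L ∧ b ≤ L ∧ c ≤ L ∧ d ≤ L ∧ e ≤ L ∧ f ≤ L ∧ g ≤ L := by
  refine ⟨1 + |a| + |b| + |c| + |d| + |e| + |f| + |g|, ?_⟩
  have := abs_nonneg a; have := abs_nonneg b; have := abs_nonneg c; have := abs_nonneg d
  have := abs_nonneg e; have := abs_nonneg f; have := abs_nonneg g
  have := le_abs_self a; have := le_abs_self b; have := le_abs_self c; have := le_abs_self d
  have := le_abs_self e; have := le_abs_self f; have := le_abs_self g
  refine ⟨?_, ?_, ?_, ?_, ?_, ?_, ?_, ?_⟩ <;> linarith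

/-- The constant of `exists_adapted_frame`: the numerical factors are those of
`exists_almost_unitary_frame`. -/
theorem exists_frame_constant {L A : ℝ} (hL : 1 ≤ L) (hA : 0 ≤ A) :
    ∃ C : ℝ, C = 2 * (24 * L ^ 13 + A * (17 * L ^ 13)) ∧ 1 ≤ C ∧ 2 * L ^ 5 ≤ C ∧ L ≤ C := by
  have h13 : 1 ≤ L ^ 13 := one_le_pow₀ hL
  have h1 : 0 ≤ A * (17 * L ^ 13) := by positivity
  have h2 : L ^ 5 ≤ L ^ 13 := pow_le_pow_right₀ hL (by norm_num)
  have h3 : L ^ 1 ≤ L ^ 13 := pow_le_pow_right₀ hL (by norm_num)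
  rw [pow_one] at h3
  exact ⟨_, rfl, by linarith, by linarith, by linarith⟩

namespace ACylKahler

variable {X : Type*} [TopologicalSpace X] [T2Space X] [CompactSpace X]
  [ChartedSpace (Fin 3 → ℂ) X] [IsManifold 𝓘(ℂ, Fin 3 → ℂ) ω X] (W : ACylKahler X)

/-- The cylindrical model form in the chart around `p`. -/
def modelForm (p x : X) (c d : Fin 3 → ℂ) : ℂ :=
  star (fderiv ℝ (W.projCoord p) (chartAt (Fin 3 → ℂ) p x) c) ⬝ᵥ (gramPt 3 W.κ p (W.proj x) *ᵥ
    fderiv ℝ (W.projCoord p) (chartAt (Fin 3 → ℂ) p x) d) +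
  conj (fderiv ℂ (W.zCoord p) (chartAt (Fin 3 → ℂ) p x) c / W.z x) *
    (fderiv ℂ (W.zCoord p) (chartAt (Fin 3 → ℂ) p x) d / W.z x)

/-- The differential of `z` at `x`, as a function on the model space of the tangent spaces. -/
def dzAt (x : X) (v : Fin 3 → ℂ) : ℂ := mfderiv 𝓘(ℂ, Fin 3 → ℂ) 𝓘(ℂ, ℂ) W.z x v

/-- The differential of the projection at `x`, as a map of the model space of the tangent spaces. -/
def dprojAt (x : X) (v : Fin 3 → ℂ) : Fin 3 → ℂ :=
  mfderiv 𝓘(ℝ, Fin 3 → ℂ) 𝓘(ℝ, Fin 3 → ℂ) W.proj x v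

theorem dzAt_coordVec {p y : X} (hy : y ∈ (chartAt (Fin 3 → ℂ) p).source) (hyU : y ∈ W.U)
    (c : Fin 3 → ℂ) : W.dzAt y (coordVec p y c) =
      fderiv ℂ (W.zCoord p) (chartAt (Fin 3 → ℂ) p y) c := W.mfderiv_z_coordVec hy hyU c

theorem dprojAt_coordVec {p y : X} (hy : y ∈ (chartAt (Fin 3 → ℂ) p).source) (hyU : y ∈ W.U)
    (hpy : W.proj y ∈ (chartAt (Fin 3 → ℂ) p).source) (c : Fin 3 → ℂ) :
    W.dprojAt y (coordVec p y c) = coordVec p (W.proj y)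
      (fderiv ℝ (W.projCoord p) (chartAt (Fin 3 → ℂ) p y) c) := W.mfderiv_proj_coordVec hy hyU hpy c

/-- The cylindrical form of the asymptotic condition, in the chart around `p`. -/
theorem modelForm_eq {p x : X} (hxs : x ∈ (chartAt (Fin 3 → ℂ) p).source) (hxU : x ∈ W.U)
    (hxp : W.proj x ∈ (chartAt (Fin 3 → ℂ) p).source) (c d : Fin 3 → ℂ) :
    W.κ (W.proj x) (W.dprojAt x (coordVec p x c)) (W.dprojAt x (coordVec p x d)) +
      conj (W.dzAt x (coordVec p x c) / W.z x) * (W.dzAt x (coordVec p x d) / W.z x) =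
      W.modelForm p x c d := by
  rw [modelForm, W.dprojAt_coordVec hxs hxU hxp, W.dprojAt_coordVec hxs hxU hxp,
    W.dzAt_coordVec hxs hxU, W.dzAt_coordVec hxs hxU, form_coordVec W.κ hxp]

/-- The asymptotic condition on the Kähler form, in the chart around `p`. -/
theorem asymptotic_coordVec : ∃ A ρ : ℝ, 0 < ρ ∧ ∀ p x : X,
    x ∈ (chartAt (Fin 3 → ℂ) p).source → x ∈ W.U → W.proj x ∈ (chartAt (Fin 3 → ℂ) p).source →
    x ∉ W.D → ‖W.z x‖ < ρ → ∀ c d : Fin 3 → ℂ,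
    |(W.h x (coordVec p x c) (coordVec p x d)).im - (W.modelForm p x c d).im| ≤
      A * ‖W.z x‖ ^ W.rate * (√(W.modelForm p x c c).re * √(W.modelForm p x d d).re) := by
  obtain ⟨A, ρ, hρ, h⟩ := W.asymptotic
  refine ⟨A, ρ, hρ, fun p x hxs hxU hxp hxD hx c d => ?_⟩
  have h1 := h x ⟨hxU, hxD⟩ hx (coordVec p x c) (coordVec p x d)
  rw [← W.modelForm_eq hxs hxU hxp, ← W.modelForm_eq hxs hxU hxp, ← W.modelForm_eq hxs hxU hxp]
  exact h1
/-- Near a point `p` of the divisor, the points `x` have frames, close to a `κ`-orthonormal pair `e`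
in the tangent space of the divisor at `proj x` together with the radial direction, which are
unitary for `h` up to an exponentially small error. All vectors are expressed in the chart around
`p`. -/
theorem exists_adapted_frame {p : X} (hp : p ∈ W.D) : ∃ C : ℝ, 1 ≤ C ∧ ∀ᶠ x in nhds p,
    x ∈ (chartAt (Fin 3 → ℂ) p).source ∧ x ∈ W.U ∧ W.proj x ∈ (chartAt (Fin 3 → ℂ) p).source ∧
    ∃ e : Fin 2 → (Fin 3 → ℂ),
      (∀ a, fderiv ℂ (W.zCoord p) (chartAt (Fin 3 → ℂ) p (W.proj x)) (e a) = 0) ∧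
      (∀ a b, star (e a) ⬝ᵥ (gramPt 3 W.κ p (W.proj x) *ᵥ e b) = if a = b then 1 else 0) ∧
      (∀ a, ‖e a‖ ≤ C) ∧
      (x ∉ W.D → ∃ P : Fin 3 → (Fin 3 → ℂ),
        (fderiv ℂ (W.zCoord p) (chartAt (Fin 3 → ℂ) p x) (P 0) = 0 ∧
          fderiv ℂ (W.zCoord p) (chartAt (Fin 3 → ℂ) p x) (P 1) = 0 ∧
          fderiv ℂ (W.zCoord p) (chartAt (Fin 3 → ℂ) p x) (P 2) = W.z x) ∧
        (‖P 0 - e 0‖ ≤ C * ‖W.z x‖ ∧ ‖P 1 - e 1‖ ≤ C * ‖W.z x‖ ∧ ‖P 2‖ ≤ C * ‖W.z x‖) ∧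
        ∀ a b, ‖W.h x (coordVec p x (P a)) (coordVec p x (P b)) - if a = b then 1 else 0‖ ≤
          C * ‖W.z x‖ ^ min 1 W.rate) := by
  have hpc := mem_chart_source (Fin 3 → ℂ) p
  have hpU := W.D_subset hp
  have hpp : W.proj p = p := W.proj_D p hp
  have hpc' : W.proj p ∈ (chartAt (Fin 3 → ℂ) p).source := by rwa [hpp]
  have hcz := W.contDiffAt_zCoord hpc hpU
  have hcp := W.contDiffAt_projCoord hpc hpU hpc'
  have hcl : ContDiffAt ℝ 1 (fderiv ℂ (W.zCoord p)) (chartAt (Fin 3 → ℂ) p p) :=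
    (hcz.fderiv_right (m := 1) (by norm_num)).restrict_scalars ℝ
  have hcA : ContDiffAt ℝ 1 (fderiv ℝ (W.projCoord p)) (chartAt (Fin 3 → ℂ) p p) :=
    (hcp.of_le (m := 2) ENat.LEInfty.out).fderiv_right (m := 1) (by norm_num)
  -- a direction transverse to the divisor
  obtain ⟨n₀, hn₀⟩ : ∃ n₀, fderiv ℂ (W.zCoord p) (chartAt (Fin 3 → ℂ) p p) n₀ ≠ 0 := by
    by_contra! hcon
    refine W.dz_ne p hpU (ContinuousLinearMap.ext fun c => ?_)
    have h1 := W.dzAt_coordVec hpc hpU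
      (fderiv ℂ (transition p p) (chartAt (Fin 3 → ℂ) p p) c)
    have h2 := fderiv_transition_transition hpc hpc c
    rw [hcon] at h1
    exact (congrArg (W.dzAt p) h2).symm.trans h1
  set φ := chartAt (Fin 3 → ℂ) p with hφ
  have hcont : ContinuousAt φ p := φ.continuousAt hpc
  obtain ⟨L1, hL1⟩ := W.eventually_norm_sub_le hp hcl
  obtain ⟨L2, hL2⟩ := W.eventually_norm_sub_le hp hcA
  have hgram : MatContDiffAt ∞ (gram 3 W.κ p) (φ p) :=
    matContDiffAt_gram_tangent isOpen_univ W.hermitian_κ hpc (mem_univ _)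
  have hpd : ∀ {q : X}, q ∈ φ.source → (gramPt 3 W.κ p q).PosDef := fun {q} hq =>
    posDef_gramPt_tangent W.hermitian_κ hq (mem_univ _)
  obtain ⟨k1, hk1⟩ := hgram.eventually_norm_le
  obtain ⟨k2, hk2⟩ := (hgram.inv (by
    rw [gram_chart W.κ hpc]
    exact (Matrix.isUnit_iff_isUnit_det _).1 (hpd hpc).isUnit)).eventually_norm_le
  obtain ⟨A₀, ρ₀, hρ₀, has⟩ := W.asymptotic_coordVec
  have hln0 : 0 < ‖fderiv ℂ (W.zCoord p) (φ p) n₀‖ := norm_pos_iff.2 hn₀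
  -- a single constant for all bounds of the geometry near `p`
  obtain ⟨L, hL1', bL1, bL2, bk1, bk2, bln, bA, bn⟩ := exists_common_bound |L1| |L2| (9 * |k1|) k2
    (2 / ‖fderiv ℂ (W.zCoord p) (φ p) n₀‖) (‖fderiv ℝ (W.projCoord p) (φ p)‖ + 1) ‖n₀‖
  have hL0 : 0 < L := one_pos.trans_le hL1'
  have hLL : L ≤ L * L := le_mul_of_one_le_left hL0.le hL1'
  obtain ⟨C, hC, hCL, hC2, hC1⟩ := exists_frame_constant hL1' (abs_nonneg A₀)
  have hz0 : ∀ᶠ x in nhds p, ‖W.z x‖ < ρ₀ := by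
    refine (W.continuousAt_z hpU).norm.eventually_lt_const ?_
    beta_reduce; rw [(W.z_eq_zero_iff hpU).2 hp, norm_zero]; exact hρ₀
  have hl1 : ∀ᶠ x in nhds p, ‖fderiv ℂ (W.zCoord p) (φ p) n₀‖ / 2 < ‖fderiv ℂ (W.zCoord p) (φ x) n₀‖ := by
    have : ContinuousAt (fun u => ‖fderiv ℂ (W.zCoord p) u n₀‖) (φ p) :=
      (hcl.continuousAt.clm_apply continuousAt_const).norm
    exact (ContinuousAt.comp (f := φ) this hcont).eventually_const_lt (by
      exact half_lt_self hln0)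
  have hA1 : ∀ᶠ x in nhds p, ‖fderiv ℝ (W.projCoord p) (φ x)‖ < ‖fderiv ℝ (W.projCoord p) (φ p)‖ + 1 :=
    (ContinuousAt.comp (f := φ) hcA.continuousAt.norm hcont).eventually_lt_const (by
      exact lt_add_one _)
  refine ⟨C, hCL, ?_⟩
  filter_upwards [hL1, hL2, (W.tendsto_chart_proj hp).eventually hk1,
    (W.tendsto_chart_proj hp).eventually hk2, hz0, hl1, hA1,
    φ.open_source.mem_nhds hpc, W.isOpen_U.mem_nhds hpU,
    (W.continuousAt_proj hpU).eventually (φ.open_source.mem_nhds hpc')]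
    with x hx1 hx2 hx3 hx4 hx5 hx6 hx7 hxs hxU hxp
  have hxp : W.proj x ∈ φ.source := hxp
  have hqD := W.proj_mem hxU
  set q := W.proj x with hq
  rw [gram_chart W.κ hxp] at hx3
  set K := gramPt 3 W.κ p q with hK
  have hKpd : K.PosDef := hpd hxp
  set l := fderiv ℂ (W.zCoord p) (φ x) with hl
  set lq := fderiv ℂ (W.zCoord p) (φ q) with hlq
  set A := fderiv ℝ (W.projCoord p) (φ x) with hA
  set Aq := fderiv ℝ (W.projCoord p) (φ q) with hAq
  have hz1 : ‖W.z x‖ ≤ 1 := (W.norm_z_lt_one hxU).le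
  have hzn := norm_nonneg (W.z x)
  have hKb : ∀ v w, ‖star v ⬝ᵥ (K *ᵥ w)‖ ≤ L * ‖v‖ * ‖w‖ := by
    intro v w
    refine (norm_dotProduct_mulVec_le (k := |k1|) (fun i j => (hx3 i j).trans (le_abs_self _)) v w).trans ?_
    have : ((3 : ℕ) : ℝ) * ((3 : ℕ) : ℝ) * |k1| ≤ L := by norm_num; exact bk1
    gcongr
  obtain ⟨e, he1, he2⟩ := exists_orthonormal_ker hKpd (lq : (Fin 3 → ℂ) →ₗ[ℂ] ℂ)
  have he3 : ∀ a, ‖e a‖ ≤ L := by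
    intro a
    refine (pi_norm_le_iff_of_nonneg hL0.le).2 fun i => ?_
    have h1 := norm_apply_sq_le_form hKpd (e a) i
    rw [he2, if_pos rfl, Complex.one_re, mul_one] at h1
    have h2 : ‖K⁻¹ i i‖ ≤ L := by
      have h3 : (gram 3 W.κ p (φ q))⁻¹ = K⁻¹ := by rw [gram_chart W.κ hxp]
      rw [← h3]
      exact (hx4 i i).trans bk2
    exact abs_le_of_sq_le_sq' (h1.trans (h2.trans (hLL.trans (sq L).ge))) hL0.le |>.2
  refine ⟨hxs, hxU, hxp, e, he1, he2, fun a => (he3 a).trans hC1, fun hxD => ?_⟩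
  have hζ : W.z x ≠ 0 := fun h => hxD ((W.z_eq_zero_iff hxU).1 h)
  have hlip : ∀ {L' : ℝ}, |L'| ≤ L → L' * ‖W.z x‖ ≤ L * (L * ‖W.z x‖) := fun {L'} h => by
    rw [← mul_assoc]
    exact mul_le_mul_of_nonneg_right (((le_abs_self _).trans h).trans hLL) hzn
  obtain ⟨P, hP1, hP2, hP3⟩ := exists_almost_unitary_frame (l := l) (lq := lq) (A := A) (Aq := Aq)
    (K := K) (n₀ := n₀) (e := e) hL1' hζ hz1 (hx1.trans (hlip bL1))
    (hx2.trans (hlip bL2)) (hx7.le.trans bA)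
    (by
      have h1 : 1 = 2 / ‖fderiv ℂ (W.zCoord p) (φ p) n₀‖ *
        (‖fderiv ℂ (W.zCoord p) (φ p) n₀‖ / 2) := by field_simp
      rw [h1]
      exact mul_le_mul bln hx6.le (by positivity) hL0.le)
    bn (fun c hc => W.fderiv_projCoord_of_ker hxp hqD hc) he1 he3 hKb he2
  refine ⟨P, hP1, ⟨hP2.1.trans (by gcongr), hP2.2.1.trans (by gcongr), hP2.2.2.trans (by gcongr)⟩,
    fun a b => ?_⟩
  have hm : 0 < min 1 W.rate := lt_min one_pos W.rate_pos
  have hz0' : 0 < ‖W.z x‖ := norm_pos_iff.2 hζ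
  have hzm1 : ‖W.z x‖ ≤ ‖W.z x‖ ^ min 1 W.rate := by
    have := Real.rpow_le_rpow_of_exponent_ge hz0' hz1 (min_le_left 1 W.rate)
    rwa [Real.rpow_one] at this
  have hzm2 : ‖W.z x‖ ^ W.rate ≤ ‖W.z x‖ ^ min 1 W.rate :=
    Real.rpow_le_rpow_of_exponent_ge hz0' hz1 (min_le_right 1 W.rate)
  -- the imaginary part of `h` against the model
  have key : ∀ c : ℂ, c = 1 ∨ c = Complex.I →
      |(c * (W.h x (coordVec p x (P a)) (coordVec p x (P b)) - if a = b then 1 else 0)).im| ≤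
        C / 2 * ‖W.z x‖ ^ min 1 W.rate := by
    intro c hc
    have h1 := has p x hxs hxU hxp hxD hx5 (P a) (c • P b)
    obtain ⟨h2, -⟩ := hP3 a b c hc
    have h3 := (hP3 a a 1 (Or.inl rfl)).2
    have h4 := (hP3 b b c hc).2
    rw [one_smul] at h3
    have h5 : √(W.modelForm p x (P a) (P a)).re * √(W.modelForm p x (c • P b) (c • P b)).re ≤
        17 * L ^ 13 := by
      calc _ ≤ √(17 * L ^ 13) * √(17 * L ^ 13) := by
            gcongr
            · exact h3
            · exact h4
        _ = _ := Real.mul_self_sqrt (by positivity)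
    have h6 : |(W.modelForm p x (P a) (c • P b) - c * if a = b then 1 else 0).im| ≤
        24 * L ^ 13 * ‖W.z x‖ := (Complex.abs_im_le_norm _).trans h2
    have h7 : A₀ * ‖W.z x‖ ^ W.rate * (√(W.modelForm p x (P a) (P a)).re *
        √(W.modelForm p x (c • P b) (c • P b)).re) ≤
        |A₀| * ‖W.z x‖ ^ min 1 W.rate * (17 * L ^ 13) := by
      gcongr
      exact le_abs_self _
    have h8 : 24 * L ^ 13 * ‖W.z x‖ ≤ 24 * L ^ 13 * ‖W.z x‖ ^ min 1 W.rate := by gcongr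
    have h9 : c * (W.h x (coordVec p x (P a)) (coordVec p x (P b)) - if a = b then 1 else 0) =
        W.h x (coordVec p x (P a)) (coordVec p x (c • P b)) - c * if a = b then 1 else 0 := by
      rw [form_coordVec W.h hxs, form_coordVec W.h hxs, Matrix.mulVec_smul, dotProduct_smul,
        smul_eq_mul, mul_sub]
    have h10 := abs_add_le ((W.h x (coordVec p x (P a)) (coordVec p x (c • P b))).im -
      (W.modelForm p x (P a) (c • P b)).im)
      (W.modelForm p x (P a) (c • P b) - c * if a = b then 1 else 0).im
    rw [h9, Complex.sub_im]
    rw [Complex.sub_im, sub_add_sub_cancel] at h10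
    rw [Complex.sub_im] at h6
    have h11 := h1.trans h7
    calc _ ≤ _ := h10
      _ ≤ |A₀| * ‖W.z x‖ ^ min 1 W.rate * (17 * L ^ 13) +
          24 * L ^ 13 * ‖W.z x‖ ^ min 1 W.rate := add_le_add h11 (h6.trans h8)
      _ = _ := by rw [hC]; ring
  -- the imaginary parts of `h` and of `i h` determine `h`
  have k1 := key 1 (Or.inl rfl)
  have k2 := key Complex.I (Or.inr rfl)
  rw [one_mul] at k1
  rw [Complex.I_mul_im] at k2
  refine (Complex.norm_le_abs_re_add_abs_im _).trans ((add_le_add k2 k1).trans (le_of_eq ?_))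
  ring

end ACylKahler

/-! ### The radial derivative in the asymptotically cylindrical metric -/

/-- The inverse of a matrix close to the identity. -/
theorem isUnit_det_and_norm_inv_sub_one_le {M : Matrix (Fin 3) (Fin 3) ℂ} {t : ℝ}
    (hM : ∀ a b, ‖M a b - if a = b then 1 else 0‖ ≤ t) (ht : t ≤ 1 / 6) :
    IsUnit M.det ∧ ∀ a b, ‖M⁻¹ a b - if a = b then 1 else 0‖ ≤ 6 * t := by
  have ht0 : 0 ≤ t := (norm_nonneg _).trans (hM 0 0)
  have h1 : ∀ v : Fin 3 → ℂ, ‖M *ᵥ v - v‖ ≤ 3 * t * ‖v‖ := by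
    intro v
    refine (pi_norm_le_iff_of_nonneg (by positivity)).2 fun a => ?_
    have h2 : (M *ᵥ v - v) a = ∑ b, (M a b - if a = b then 1 else 0) * v b := by
      simp [Matrix.mulVec, dotProduct, sub_mul, Finset.sum_sub_distrib]
    rw [h2]
    calc _ ≤ ∑ b : Fin 3, t * ‖v‖ := by
          refine (norm_sum_le _ _).trans (Finset.sum_le_sum fun b _ => ?_)
          rw [norm_mul]
          exact mul_le_mul (hM a b) (norm_le_pi_norm v b) (norm_nonneg _) ht0
      _ = _ := by simp; ring
  have hdet : IsUnit M.det := by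
    rw [← Matrix.isUnit_iff_isUnit_det, ← Matrix.mulVec_injective_iff_isUnit]
    intro v w hvw
    have h2 := h1 (v - w)
    rw [Matrix.mulVec_sub, hvw, sub_self, zero_sub, norm_neg] at h2
    have h3 := norm_nonneg (v - w)
    have : ‖v - w‖ ≤ 0 := by nlinarith
    exact sub_eq_zero.1 (norm_le_zero_iff.1 this)
  refine ⟨hdet, fun a b => ?_⟩
  set v : Fin 3 → ℂ := M⁻¹ *ᵥ Pi.single b 1 with hv
  have h2 := h1 v
  have h3 : M *ᵥ v = Pi.single b 1 := by
    rw [hv, Matrix.mulVec_mulVec, Matrix.mul_nonsing_inv _ hdet, Matrix.one_mulVec]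
  rw [h3, norm_sub_rev] at h2
  have h4 : ‖(Pi.single b 1 : Fin 3 → ℂ)‖ ≤ 1 := by
    refine (pi_norm_le_iff_of_nonneg zero_le_one).2 fun i => ?_
    by_cases h : i = b
    · subst h; simp
    · simp [h]
  have h5 := norm_le_norm_add_norm_sub' v (Pi.single b 1)
  have h6 : ‖v‖ ≤ 2 := by
    have := norm_nonneg v
    nlinarith
  have h7 : (v - (Pi.single b 1 : Fin 3 → ℂ)) a = M⁻¹ a b - if a = b then 1 else 0 := by
    simp [hv, Pi.single_apply]
  rw [← h7]
  refine (norm_le_pi_norm _ a).trans (h2.trans ?_)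
  nlinarith

namespace ACylKahler

variable {X : Type*} [TopologicalSpace X] [T2Space X] [CompactSpace X]
  [ChartedSpace (Fin 3 → ℂ) X] [IsManifold 𝓘(ℂ, Fin 3 → ℂ) ω X] (W : ACylKahler X)

theorem tendsto_norm_z_rpow {p : X} (hp : p ∈ W.D) {C m : ℝ} (hm : 0 < m) {c : ℝ} (hc : 0 < c) :
    ∀ᶠ x in nhds p, C * ‖W.z x‖ ^ m ≤ c := by
  have h1 : ContinuousAt (fun x => C * ‖W.z x‖ ^ m) p :=
    continuousAt_const.mul ((W.continuousAt_z (W.D_subset hp)).norm.rpow_const (Or.inr hm.le))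
  refine (h1.eventually_lt_const (show C * ‖W.z p‖ ^ m < c from ?_)).mono fun _ h => h.le
  rw [(W.z_eq_zero_iff (W.D_subset hp)).2 hp, norm_zero, Real.zero_rpow hm.ne', mul_zero]
  exact hc

theorem rate_min_pos : 0 < min 1 W.rate := lt_min one_pos W.rate_pos

/-- Far out on the end the function `log |z|` has gradient of length at most `√2`: on the
exact cylinder the bound holds with `1` in place of `2`, and the Kähler metric is asymptotic to it. -/
theorem exists_norm_dz_div_z_sq_le : ∃ ρ : ℝ, 0 < ρ ∧ ρ < 1 ∧ ∀ x ∉ W.D, W.radius x ≤ ρ →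
    ∀ v : Fin 3 → ℂ, ‖W.dzAt x v / W.z x‖ ^ 2 ≤ 2 * (W.h x v v).re := by
  have key : ∀ p ∈ W.D, ∀ᶠ x in nhds p, x ∉ W.D →
      ∀ v : Fin 3 → ℂ, ‖W.dzAt x v / W.z x‖ ^ 2 ≤ 2 * (W.h x v v).re := by
    intro p hp
    obtain ⟨C, -, hC⟩ := W.exists_adapted_frame hp
    filter_upwards [hC, W.tendsto_norm_z_rpow hp (C := C) W.rate_min_pos (c := 1 / 6) (by norm_num)]
      with x ⟨hxs, hxU, hxp, e, _, _, _, he⟩ hx hxD v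
    obtain ⟨P, hP1, -, hP3⟩ := he hxD
    have hz : W.z x ≠ 0 := fun h => hxD ((W.z_eq_zero_iff hxU).1 h)
    set K := gramPt 3 W.h p x with hK
    have hKpd : K.PosDef := posDef_gramPt_tangent W.kahler.1 hxs hxD
    set Q : Matrix (Fin 3) (Fin 3) ℂ := Matrix.of fun i a => P a i with hQ
    have hM : ∀ a b, (Qᴴ * K * Q) a b = W.h x (coordVec p x (P a)) (coordVec p x (P b)) := by
      intro a b
      rw [form_coordVec W.h hxs, Matrix.mul_assoc]
      rfl
    obtain ⟨hM1, hM2⟩ := isUnit_det_and_norm_inv_sub_one_le (M := Qᴴ * K * Q)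
      (fun a b => by rw [hM]; exact hP3 a b) hx
    have hQdet : IsUnit Q.det := by
      rw [Matrix.det_mul] at hM1
      exact isUnit_of_mul_isUnit_right hM1
    have hMpd : (Qᴴ * K * Q).PosDef :=
      hKpd.conjTranspose_mul_mul_same (Matrix.mulVec_injective_iff_isUnit.2
        ((Matrix.isUnit_iff_isUnit_det _).2 hQdet))
    -- the components of `v` in the adapted frame
    obtain ⟨w, hw⟩ : ∃ w, coordVec p x w = v :=
      ⟨fderiv ℂ (transition x p) (chartAt (Fin 3 → ℂ) x x) v,
        fderiv_transition_transition (mem_chart_source _ x) hxs v⟩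
    set c := Q⁻¹ *ᵥ w with hc
    have hQc : Q *ᵥ c = w := by
      rw [hc, Matrix.mulVec_mulVec, Matrix.mul_nonsing_inv _ hQdet, Matrix.one_mulVec]
    have hdz : W.dzAt x v / W.z x = c 2 := by
      rw [← hw, W.dzAt_coordVec hxs hxU, ← hQc]
      have h1 : Q *ᵥ c = ∑ a, c a • P a := by
        ext i
        simp [Matrix.mulVec, dotProduct, hQ, Finset.sum_apply, mul_comm]
      rw [h1, map_sum, Fin.sum_univ_three]
      simp only [map_smul, hP1.1, hP1.2.1, hP1.2.2, smul_eq_mul, mul_zero, zero_add]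
      field_simp
    have hvv : W.h x v v = star c ⬝ᵥ ((Qᴴ * K * Q) *ᵥ c) := by
      rw [← hw, form_coordVec W.h hxs, dotProduct_conjTranspose_mul_mul, hQc]
    have h22 : ‖(Qᴴ * K * Q)⁻¹ 2 2‖ ≤ 2 := by
      have h1 := hM2 2 2
      rw [if_pos rfl] at h1
      have h2 := norm_le_norm_add_norm_sub' ((Qᴴ * K * Q)⁻¹ 2 2) 1
      rw [norm_one] at h2
      linarith
    rw [hdz, hvv]
    exact (norm_apply_sq_le_form hMpd c 2).trans
      (mul_le_mul_of_nonneg_right h22 (form_re_nonneg hMpd c))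
  obtain ⟨ρ, h0, h1, h2⟩ := W.exists_radius_le_subset
    (N := interior {x | x ∉ W.D → ∀ v : Fin 3 → ℂ, ‖W.dzAt x v / W.z x‖ ^ 2 ≤ 2 * (W.h x v v).re})
    isOpen_interior (fun p hp => mem_interior_iff_mem_nhds.2 (key p hp))
  exact ⟨ρ, h0, h1, fun x hx hr => interior_subset (h2 x hr) hx⟩

end ACylKahler

/-! ### The energy density in arbitrary frames -/

section Energy

variable {r : ℕ}

/-- The squared norm of the endomorphism `F` with respect to the form `G`. -/
def matEnergy (F G : Matrix (Fin r) (Fin r) ℂ) : ℝ := (Matrix.trace (F * (G⁻¹ * Fᴴ * G))).re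

/-- The energy does not depend on the frame. -/
theorem matEnergy_conj {F G g : Matrix (Fin r) (Fin r) ℂ} (hg : IsUnit g.det) :
    matEnergy (g⁻¹ * F * g) (gᴴ * G * g) = matEnergy F G := by
  have hg' : IsUnit (gᴴ).det := by rw [Matrix.det_conjTranspose]; exact hg.star
  have h1 : (g⁻¹ * F * g) * ((gᴴ * G * g)⁻¹ * (g⁻¹ * F * g)ᴴ * (gᴴ * G * g)) =
      g⁻¹ * (F * (G⁻¹ * Fᴴ * G) * g) := by
    simp only [Matrix.mul_inv_rev, Matrix.conjTranspose_mul, Matrix.conjTranspose_nonsing_inv,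
      Matrix.mul_assoc, Matrix.mul_nonsing_inv_cancel_left _ _ hg,
      Matrix.nonsing_inv_mul_cancel_left _ _ hg']
  rw [matEnergy, h1, Matrix.trace_mul_comm, Matrix.mul_assoc, Matrix.mul_nonsing_inv _ hg,
    Matrix.mul_one, matEnergy]

theorem norm_mul_apply_le {A B : Matrix (Fin r) (Fin r) ℂ} {a b : ℝ} (hA : ∀ i j, ‖A i j‖ ≤ a)
    (hB : ∀ i j, ‖B i j‖ ≤ b) (i j : Fin r) : ‖(A * B) i j‖ ≤ r * (a * b) := by
  rw [Matrix.mul_apply]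
  calc _ ≤ ∑ _k : Fin r, a * b := by
        refine (norm_sum_le _ _).trans (Finset.sum_le_sum fun k _ => ?_)
        rw [norm_mul]
        exact mul_le_mul (hA i k) (hB k j) (norm_nonneg _) ((norm_nonneg _).trans (hA i k))
    _ = _ := by simp

theorem matEnergy_le {F G : Matrix (Fin r) (Fin r) ℂ} {f k : ℝ} (hF : ∀ i j, ‖F i j‖ ≤ f)
    (hG : ∀ i j, ‖G i j‖ ≤ k) (hG' : ∀ i j, ‖G⁻¹ i j‖ ≤ k) : matEnergy F G ≤ r ^ 4 * k ^ 2 * f ^ 2 := by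
  have hF' : ∀ i j, ‖Fᴴ i j‖ ≤ f := fun i j => by
    rw [Matrix.conjTranspose_apply, norm_star]; exact hF j i
  have h1 := norm_mul_apply_le hF (norm_mul_apply_le (norm_mul_apply_le hG' hF') hG)
  refine (Complex.re_le_norm _).trans ?_
  rw [Matrix.trace]
  calc _ ≤ ∑ _i : Fin r, r * (f * (r * (r * (k * f) * k))) :=
        (norm_sum_le _ _).trans (Finset.sum_le_sum fun i _ => h1 i i)
    _ = _ := by simp; ring

end Energy

/-! ### Decay of the mean curvature of the reference metric -/

section CurvTensor

variable {n r : ℕ}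

/-- The array of all components of the curvature. -/
def curvTensor (G : (Fin n → ℂ) → Matrix (Fin r) (Fin r) ℂ) (u : Fin n → ℂ) :
    Fin n → Fin n → Fin r → Fin r → ℂ :=
  fun j k a b => curvDir G (Pi.single j 1) (Pi.single k 1) u a b

variable {G : (Fin n → ℂ) → Matrix (Fin r) (Fin r) ℂ} {u v : Fin n → ℂ}

theorem contDiffAt_curvTensor {k : WithTop ℕ∞} (hG : MatContDiffAt (k + 1 + 1) G u)
    (h0 : IsUnit (G u).det) : ContDiffAt ℝ k (curvTensor G) u :=
  contDiffAt_pi.2 fun _ => contDiffAt_pi.2 fun _ => contDiffAt_pi.2 fun i => contDiffAt_pi.2 fun j =>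
    hG.curvDir h0 _ _ i j

theorem norm_curvTensor_apply_le (T : Fin n → Fin n → Fin r → Fin r → ℂ) (j k : Fin n)
    (a b : Fin r) : ‖T j k a b‖ ≤ ‖T‖ :=
  (norm_le_pi_norm _ b).trans ((norm_le_pi_norm _ a).trans ((norm_le_pi_norm _ k).trans
    (norm_le_pi_norm _ j)))

theorem curvDir_apply_eq_sum (hG : MatContDiffAt 2 G u) (h0 : IsUnit (G u).det) (ξ η : Fin n → ℂ)
    (a b : Fin r) : curvDir G ξ η u a b = ∑ j, ∑ k, (ξ j * conj (η k)) * curvTensor G u j k a b := by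
  rw [curvDir_eq_sum hG h0]
  simp [Matrix.sum_apply, curvTensor]

theorem norm_curvDir_apply_le (hG : MatContDiffAt 2 G u) (h0 : IsUnit (G u).det) (ξ η : Fin n → ℂ)
    (a b : Fin r) : ‖curvDir G ξ η u a b‖ ≤ n * n * (‖ξ‖ * ‖η‖ * ‖curvTensor G u‖) := by
  rw [curvDir_apply_eq_sum hG h0]
  calc _ ≤ ∑ _j : Fin n, ∑ _k : Fin n, ‖ξ‖ * ‖η‖ * ‖curvTensor G u‖ := by
        refine (norm_sum_le _ _).trans (Finset.sum_le_sum fun j _ => (norm_sum_le _ _).trans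
          (Finset.sum_le_sum fun k _ => ?_))
        rw [norm_mul, norm_mul, RCLike.norm_conj]
        gcongr
        · exact norm_le_pi_norm ξ j
        · exact norm_le_pi_norm η k
        · exact norm_curvTensor_apply_le _ j k a b
    _ = _ := by simp; ring

/-- The curvature on the diagonal is Lipschitz in the point and in the vector. -/
theorem norm_curvDir_sub_apply_le (hG : MatContDiffAt 2 G u) (h0 : IsUnit (G u).det)
    (hG' : MatContDiffAt 2 G v) (h0' : IsUnit (G v).det) (ξ η : Fin n → ℂ) (a b : Fin r) :
    ‖curvDir G ξ ξ u a b - curvDir G η η v a b‖ ≤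
      n * n * (‖ξ - η‖ * (‖ξ‖ + ‖η‖) * ‖curvTensor G u‖ +
        ‖η‖ * ‖η‖ * ‖curvTensor G u - curvTensor G v‖) := by
  rw [curvDir_apply_eq_sum hG h0, curvDir_apply_eq_sum hG' h0', ← Finset.sum_sub_distrib]
  simp only [← Finset.sum_sub_distrib]
  calc _ ≤ ∑ _j : Fin n, ∑ _k : Fin n, (‖ξ - η‖ * (‖ξ‖ + ‖η‖) * ‖curvTensor G u‖ +
        ‖η‖ * ‖η‖ * ‖curvTensor G u - curvTensor G v‖) := by
        refine (norm_sum_le _ _).trans (Finset.sum_le_sum fun j _ => (norm_sum_le _ _).trans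
          (Finset.sum_le_sum fun k _ => ?_))
        have e : (ξ j * conj (ξ k)) * curvTensor G u j k a b -
            (η j * conj (η k)) * curvTensor G v j k a b =
            ((ξ - η) j * conj (ξ k) + η j * conj ((ξ - η) k)) * curvTensor G u j k a b +
            η j * conj (η k) * (curvTensor G u - curvTensor G v) j k a b := by
          simp only [Pi.sub_apply, map_sub]
          ring
        have a1 := norm_le_pi_norm ξ k
        have a2 := norm_le_pi_norm η j
        have a3 := norm_le_pi_norm η k
        have a4 := norm_le_pi_norm (ξ - η) j
        have a5 := norm_le_pi_norm (ξ - η) k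
        have a6 := norm_curvTensor_apply_le (curvTensor G u) j k a b
        have a7 := norm_curvTensor_apply_le (curvTensor G u - curvTensor G v) j k a b
        rw [e]
        calc _ ≤ (‖(ξ - η) j‖ * ‖ξ k‖ + ‖η j‖ * ‖(ξ - η) k‖) * ‖curvTensor G u j k a b‖ +
              ‖η j‖ * ‖η k‖ * ‖(curvTensor G u - curvTensor G v) j k a b‖ := by
              refine (norm_add_le _ _).trans (add_le_add ?_ ?_)
              · rw [norm_mul]
                refine mul_le_mul_of_nonneg_right ((norm_add_le _ _).trans ?_) (norm_nonneg _)
                rw [norm_mul, norm_mul, RCLike.norm_conj, RCLike.norm_conj]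
              · rw [norm_mul, norm_mul, RCLike.norm_conj]
          _ ≤ (‖ξ - η‖ * ‖ξ‖ + ‖η‖ * ‖ξ - η‖) * ‖curvTensor G u‖ +
              ‖η‖ * ‖η‖ * ‖curvTensor G u - curvTensor G v‖ := by gcongr
          _ = _ := by ring
    _ = _ := by simp; ring

end CurvTensor

section ChartEnergy

variable {X : Type*} [TopologicalSpace X] [ChartedSpace (Fin 3 → ℂ) X]
  [IsManifold 𝓘(ℂ, Fin 3 → ℂ) ω X]
variable {r : ℕ} {E : X → Type*} [∀ x, AddCommGroup (E x)] [∀ x, Module ℂ (E x)]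
  [∀ x, TopologicalSpace (E x)] [TopologicalSpace (Bundle.TotalSpace (Fin r → ℂ) E)]
  [FiberBundle (Fin r → ℂ) E] [VectorBundle ℂ (Fin r → ℂ) E]
  [ContMDiffVectorBundle ω (Fin r → ℂ) E 𝓘(ℂ, Fin 3 → ℂ)]

/-- The energy density computed in the chart and frame around `p`, from a basis `P` of the tangent
space with Gram matrix `M`. -/
theorem energyDensity_chart {h : TangentForm X} {H : ∀ x, E x →ₗ⋆[ℂ] E x →ₗ[ℂ] ℂ} {S : Set X}
    (hS : IsOpen S) (hH : IsHermitianMetricOn r H S) {p x : X} (hx : x ∈ S)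
    (hc : x ∈ (chartAt (Fin 3 → ℂ) p).source)
    (hb : x ∈ (trivializationAt (Fin r → ℂ) E p).baseSet)
    (P : Fin 3 → (Fin 3 → ℂ)) (M : Matrix (Fin 3) (Fin 3) ℂ) (hM : IsUnit M.det)
    (hPM : ∀ a b, h x (coordVec p x (P a)) (coordVec p x (P b)) = M a b) :
    energyDensity r h H x = matEnergy ((-2 * Complex.I) • ∑ a, ∑ b, M⁻¹ a b •
      curvDir (gram r H p) (P a) (P b) (chartAt (Fin 3 → ℂ) p x)) (gramPt r H p x) := by
  have hxb := FiberBundle.mem_baseSet_trivializationAt' (F := Fin r → ℂ) (E := E) x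
  have h1 := Fhat_eq_sum_basis hS hH hx (Matrix.of fun i a => coordVec p x (P a) i) M hM hPM
  have h2 : Fhat r h H x = (frameChange r E p x x)⁻¹ * ((-2 * Complex.I) • ∑ a, ∑ b, M⁻¹ a b •
      curvDir (gram r H p) (P a) (P b) (chartAt (Fin 3 → ℂ) p x)) * frameChange r E p x x := by
    rw [h1, Matrix.mul_smul, Matrix.smul_mul, Finset.mul_sum, Finset.sum_mul]
    congr 1
    refine Finset.sum_congr rfl fun a _ => ?_
    rw [Finset.mul_sum, Finset.sum_mul]
    refine Finset.sum_congr rfl fun b _ => ?_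
    rw [Matrix.mul_smul, Matrix.smul_mul, ← curvDir_frameChange hS hH hx hc hb]
    rfl
  rw [← matEnergy_conj (isUnit_frameChange (E := E) p x x), ← gramPt_frameChange H hb hxb, ← h2,
    ← gramAt_eq]
  rfl

end ChartEnergy

namespace ACylKahler

variable {X : Type*} [TopologicalSpace X] [T2Space X] [CompactSpace X]
  [ChartedSpace (Fin 3 → ℂ) X] [IsManifold 𝓘(ℂ, Fin 3 → ℂ) ω X] (W : ACylKahler X)
variable {r : ℕ} {E : X → Type*} [∀ x, AddCommGroup (E x)] [∀ x, Module ℂ (E x)]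
  [∀ x, TopologicalSpace (E x)] [TopologicalSpace (Bundle.TotalSpace (Fin r → ℂ) E)]
  [FiberBundle (Fin r → ℂ) E] [VectorBundle ℂ (Fin r → ℂ) E]
  [ContMDiffVectorBundle ω (Fin r → ℂ) E 𝓘(ℂ, Fin 3 → ℂ)]
  {H : ∀ x, E x →ₗ⋆[ℂ] E x →ₗ[ℂ] ℂ}

/-- The restriction of the metric to the divisor is Hermitian Yang-Mills, expressed in the chart
around `p`. -/
theorem IsReferenceMetric.hym_chart (hH : W.IsReferenceMetric r H) {p q : X} (hq : q ∈ W.D)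
    (hc : q ∈ (chartAt (Fin 3 → ℂ) p).source)
    (hb : q ∈ (trivializationAt (Fin r → ℂ) E p).baseSet) {e : Fin 2 → (Fin 3 → ℂ)}
    (he : ∀ a, fderiv ℂ (W.zCoord p) (chartAt (Fin 3 → ℂ) p q) (e a) = 0)
    (he' : ∀ a b, star (e a) ⬝ᵥ (gramPt 3 W.κ p q *ᵥ e b) = if a = b then 1 else 0) :
    ∑ a, curvDir (gram r H p) (e a) (e a) (chartAt (Fin 3 → ℂ) p q) = 0 := by
  have h1 := hH.hym q hq (fun a => coordVec p q (e a))
    (fun a => (W.dzAt_coordVec hc (W.D_subset hq) (e a)).trans (he a))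
    (fun a b => (form_coordVec W.κ hc (e a) (e b)).trans (he' a b))
  simp only [sum_chernCurvature isOpen_univ hH.metric (mem_univ q)] at h1
  have h2 := (smul_eq_zero.1 h1).resolve_left (by simp)
  have hg := isUnit_frameChange (E := E) (r := r) p q q
  have h3 : ∀ a, curvDir (gram r H p) (e a) (e a) (chartAt (Fin 3 → ℂ) p q) =
      frameChange r E p q q * curvDir (gram r H q) (coordVec p q (e a)) (coordVec p q (e a))
        (chartAt (Fin 3 → ℂ) q q) * (frameChange r E p q q)⁻¹ := by
    intro a
    have h4 := curvDir_frameChange isOpen_univ hH.metric (mem_univ q) hc hb (e a) (e a)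
    change curvDir (gram r H q) (coordVec p q (e a)) (coordVec p q (e a))
        (chartAt (Fin 3 → ℂ) q q) = _ at h4
    rw [h4, Matrix.mul_assoc, Matrix.mul_assoc, Matrix.mul_nonsing_inv _ hg, Matrix.mul_one,
      Matrix.mul_nonsing_inv_cancel_left _ _ hg]
  simp only [h3]
  rw [← Finset.sum_mul, ← Finset.mul_sum, h2, Matrix.mul_zero, Matrix.zero_mul]

/-- The mean curvature is bounded near points off the divisor. -/
theorem eventually_energyDensity_le_of_notMem (hH : IsHermitianMetricOn r H univ) {p : X}
    (hp : p ∉ W.D) : ∃ B : ℝ, ∀ᶠ x in nhds p, energyDensity r W.h H x ≤ B := by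
  have hpc := mem_chart_source (Fin 3 → ℂ) p
  have hpb := FiberBundle.mem_baseSet_trivializationAt' (F := Fin r → ℂ) (E := E) p
  have hG := matContDiffAt_gram isOpen_univ hH (mem_frameDomain hpc hpb (mem_univ _))
  have hdet : ∀ {y}, y ∈ (trivializationAt (Fin r → ℂ) E p).baseSet →
      IsUnit (gramPt r H p y).det := fun hy =>
    (Matrix.isUnit_iff_isUnit_det _).1 (posDef_gramPt hH hy (mem_univ _)).isUnit
  have h0 : IsUnit (gram r H p (chartAt (Fin 3 → ℂ) p p)).det := by
    rw [gram_chart H hpc]; exact hdet hpb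
  have hK := matContDiffAt_gram_tangent W.isOpen_carrier W.kahler.1 hpc hp
  have hdetK : ∀ {y}, y ∈ (chartAt (Fin 3 → ℂ) p).source → y ∉ W.D →
      IsUnit (gramPt 3 W.h p y).det := fun hy hyD =>
    (Matrix.isUnit_iff_isUnit_det _).1 (posDef_gramPt_tangent W.kahler.1 hy hyD).isUnit
  have hK0 : IsUnit (gram 3 W.h p (chartAt (Fin 3 → ℂ) p p)).det := by
    rw [gram_chart W.h hpc]; exact hdetK hpc hp
  obtain ⟨k1, hk1⟩ := hG.eventually_norm_le
  obtain ⟨k2, hk2⟩ := (hG.inv h0).eventually_norm_le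
  -- the mean curvature in the chart around `p`
  have hF : MatContDiffAt 0 (fun u => (-2 * Complex.I) • ∑ a, ∑ b, (gram 3 W.h p u)⁻¹ a b •
      curvDir (gram r H p) (Pi.single a 1) (Pi.single b 1) u) (chartAt (Fin 3 → ℂ) p p) := by
    intro i j
    simp only [Matrix.smul_apply, Matrix.sum_apply, smul_eq_mul]
    refine contDiffAt_const.mul (ContDiffAt.sum fun a _ => ContDiffAt.sum fun b _ => ?_)
    exact ((hK.inv hK0).of_le (by simp) a b).mul
      (MatContDiffAt.curvDir (k := 0) (hG.of_le (by
        rw [zero_add, one_add_one_eq_two]; exact ENat.LEInfty.out)) h0 _ _ i j)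
  obtain ⟨k3, hk3⟩ := hF.eventually_norm_le
  have hcont := (chartAt (Fin 3 → ℂ) p).continuousAt hpc
  refine ⟨r ^ 4 * (max k1 k2) ^ 2 * k3 ^ 2, ?_⟩
  filter_upwards [hcont.eventually hk1, hcont.eventually hk2, hcont.eventually hk3,
    (chartAt (Fin 3 → ℂ) p).open_source.mem_nhds hpc, W.isOpen_carrier.mem_nhds hp,
    (trivializationAt (Fin r → ℂ) E p).open_baseSet.mem_nhds hpb] with x h1 h2 h3 hc hxD hb
  simp only [gram_chart W.h hc] at h3
  rw [gram_chart H hc] at h1 h2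
  rw [energyDensity_chart W.isOpen_carrier (hH.mono (subset_univ _)) hxD hc hb
    (fun a => Pi.single a 1) (gramPt 3 W.h p x) (hdetK hc hxD) (fun a b => by
      rw [form_coordVec W.h hc, ← Pi.single_star]
      simp)]
  exact matEnergy_le h3 (fun i j => (h1 i j).trans (le_max_left _ _))
    (fun i j => (h2 i j).trans (le_max_right _ _))

end ACylKahler

namespace ACylKahler

variable {X : Type*} [TopologicalSpace X] [T2Space X] [CompactSpace X]
  [ChartedSpace (Fin 3 → ℂ) X] [IsManifold 𝓘(ℂ, Fin 3 → ℂ) ω X] (W : ACylKahler X)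
variable {r : ℕ} {E : X → Type*} [∀ x, AddCommGroup (E x)] [∀ x, Module ℂ (E x)]
  [∀ x, TopologicalSpace (E x)] [TopologicalSpace (Bundle.TotalSpace (Fin r → ℂ) E)]
  [FiberBundle (Fin r → ℂ) E] [VectorBundle ℂ (Fin r → ℂ) E]
  [ContMDiffVectorBundle ω (Fin r → ℂ) E 𝓘(ℂ, Fin 3 → ℂ)]
  {H : ∀ x, E x →ₗ⋆[ℂ] E x →ₗ[ℂ] ℂ}

/-- Near points of the divisor the mean curvature is `O(|z| ^ min 1 rate)`: in adapted frames it is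
the mean curvature of the restriction to the divisor, which vanishes, up to errors of this size. -/
theorem eventually_energyDensity_le_of_mem (hH : W.IsReferenceMetric r H) {p : X} (hp : p ∈ W.D) :
    ∃ B : ℝ, ∀ᶠ x in nhds p, x ∉ W.D →
      energyDensity r W.h H x ≤ B * (‖W.z x‖ ^ min 1 W.rate) ^ 2 := by
  have hpc := mem_chart_source (Fin 3 → ℂ) p
  have hpb := FiberBundle.mem_baseSet_trivializationAt' (F := Fin r → ℂ) (E := E) p
  have hpp : W.proj p = p := W.proj_D p hp
  have hG : ∀ {y}, y ∈ (chartAt (Fin 3 → ℂ) p).source →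
      y ∈ (trivializationAt (Fin r → ℂ) E p).baseSet →
      MatContDiffAt ∞ (gram r H p) (chartAt (Fin 3 → ℂ) p y) := fun hy hy' =>
    matContDiffAt_gram isOpen_univ hH.metric (mem_frameDomain hy hy' (mem_univ _))
  have hdet : ∀ {y}, y ∈ (chartAt (Fin 3 → ℂ) p).source →
      y ∈ (trivializationAt (Fin r → ℂ) E p).baseSet →
      IsUnit (gram r H p (chartAt (Fin 3 → ℂ) p y)).det := fun hy hy' => by
    rw [gram_chart H hy]
    exact (Matrix.isUnit_iff_isUnit_det _).1 (posDef_gramPt hH.metric hy' (mem_univ _)).isUnit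
  obtain ⟨k1, hk1⟩ := (hG hpc hpb).eventually_norm_le
  obtain ⟨k2, hk2⟩ := ((hG hpc hpb).inv (hdet hpc hpb)).eventually_norm_le
  have hT := contDiffAt_curvTensor (k := 1) ((hG hpc hpb).of_le (by
    rw [one_add_one_eq_two, two_add_one_eq_three]; exact ENat.LEInfty.out)) (hdet hpc hpb)
  obtain ⟨L, hL⟩ := W.eventually_norm_sub_le hp hT
  obtain ⟨C, hC1, hC⟩ := W.exists_adapted_frame hp
  have hcont := (chartAt (Fin 3 → ℂ) p).continuousAt hpc
  obtain ⟨τ, hτ⟩ : ∃ τ : ℝ, τ = ‖curvTensor (gram r H p) (chartAt (Fin 3 → ℂ) p p)‖ + 1 := ⟨_, rfl⟩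
  have hτ0 : 0 ≤ τ := by rw [hτ]; positivity
  have hTb : ∀ᶠ u in nhds (chartAt (Fin 3 → ℂ) p p), ‖curvTensor (gram r H p) u‖ < τ :=
    hT.continuousAt.norm.eventually_lt_const (by rw [hτ]; exact lt_add_one _)
  have hbase := (trivializationAt (Fin r → ℂ) E p).open_baseSet
  obtain ⟨K, hK⟩ : ∃ K : ℝ, K = 2 * (9 * (6 * C * (9 * (2 * C * (2 * C) * τ))) +
    2 * (9 * (C * (2 * C + C) * τ + C * C * |L|)) + 9 * (C * (2 * C) * τ)) := ⟨_, rfl⟩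
  refine ⟨r ^ 4 * (max k1 k2) ^ 2 * K ^ 2, ?_⟩
  filter_upwards [hC, W.tendsto_norm_z_rpow hp (C := C) W.rate_min_pos (c := 1 / 6) (by norm_num),
    hcont.eventually hk1, hcont.eventually hk2, hL, hcont.eventually hTb, hbase.mem_nhds hpb,
    (W.continuousAt_proj (W.D_subset hp)).eventually (hbase.mem_nhds (by rwa [hpp]))]
    with x ⟨hxs, hxU, hxp, e, he1, he2, he3, he4⟩ hx hx1 hx2 hxL hxT hxb hqb hxD
  have hqb : W.proj x ∈ (trivializationAt (Fin r → ℂ) E p).baseSet := hqb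
  obtain ⟨P, -, ⟨hP0, hP1, hP2⟩, hP⟩ := he4 hxD
  have hqD := W.proj_mem hxU
  have hz : W.z x ≠ 0 := fun h => hxD ((W.z_eq_zero_iff hxU).1 h)
  have hz1 : ‖W.z x‖ ≤ 1 := (W.norm_z_lt_one hxU).le
  have hz0 : 0 ≤ ‖W.z x‖ := norm_nonneg _
  obtain ⟨s, hs⟩ : ∃ s : ℝ, s = ‖W.z x‖ ^ min 1 W.rate := ⟨_, rfl⟩
  have hs0 : 0 ≤ s := by rw [hs]; positivity
  have hzs : ‖W.z x‖ ≤ s := by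
    have := Real.rpow_le_rpow_of_exponent_ge (norm_pos_iff.2 hz) hz1 (min_le_left 1 W.rate)
    rwa [Real.rpow_one, ← hs] at this
  set M : Matrix (Fin 3) (Fin 3) ℂ :=
    Matrix.of fun a b => W.h x (coordVec p x (P a)) (coordVec p x (P b)) with hM
  obtain ⟨hM1, hM2⟩ := isUnit_det_and_norm_inv_sub_one_le (M := M) hP hx
  rw [energyDensity_chart W.isOpen_carrier (hH.metric.mono (subset_univ _)) hxD hxs hxb P M hM1 (fun a b => rfl), ← hs]
  rw [gram_chart H hxs] at hx1 hx2
  have hC0 : 0 ≤ C := by linarith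
  have hCz : C * ‖W.z x‖ ≤ C := mul_le_of_le_one_right hC0 hz1
  have hPb : ∀ a, ‖P a‖ ≤ 2 * C := by
    have h0 := norm_le_norm_add_norm_sub' (P 0) (e 0)
    have h1 := norm_le_norm_add_norm_sub' (P 1) (e 1)
    have h2 := he3 0
    have h3 := he3 1
    intro a
    fin_cases a
    · change ‖P 0‖ ≤ _; linarith
    · change ‖P 1‖ ≤ _; linarith
    · change ‖P 2‖ ≤ _; linarith
  set G := gram r H p with hGdef
  set u := chartAt (Fin 3 → ℂ) p x with hu
  set v := chartAt (Fin 3 → ℂ) p (W.proj x) with hv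
  have g1 : MatContDiffAt 2 G u := (hG hxs hxb).of_le ENat.LEInfty.out
  have g2 : MatContDiffAt 2 G v := (hG hxp hqb).of_le ENat.LEInfty.out
  have d1 := hdet hxs hxb
  have d2 := hdet hxp hqb
  have hym := hH.hym_chart (p := p) W hqD hxp hqb he1 he2
  rw [Fin.sum_univ_two] at hym
  refine (matEnergy_le (f := K * s) (fun i j => ?_) (fun i j => (hx1 i j).trans (le_max_left _ _))
    (fun i j => (hx2 i j).trans (le_max_right _ _))).trans (le_of_eq (by ring))
  have hym' : curvDir G (e 0) (e 0) v i j + curvDir G (e 1) (e 1) v i j = 0 :=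
    congrFun (congrFun hym i) j
  -- split off the mean curvature along the divisor, which vanishes
  have split : ∑ a, ∑ b, M⁻¹ a b * curvDir G (P a) (P b) u i j =
      ∑ a, ∑ b, (M⁻¹ a b - if a = b then 1 else 0) * curvDir G (P a) (P b) u i j +
      ((curvDir G (P 0) (P 0) u i j - curvDir G (e 0) (e 0) v i j) +
        (curvDir G (P 1) (P 1) u i j - curvDir G (e 1) (e 1) v i j)) +
      curvDir G (P 2) (P 2) u i j := by
    have h1 : ∑ a, ∑ b, (M⁻¹ a b - if a = b then 1 else 0) * curvDir G (P a) (P b) u i j =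
        ∑ a, ∑ b, M⁻¹ a b * curvDir G (P a) (P b) u i j - ∑ a, curvDir G (P a) (P a) u i j := by
      simp [sub_mul, Finset.sum_sub_distrib]
    rw [h1, Fin.sum_univ_three (f := fun a => curvDir G (P a) (P a) u i j)]
    linear_combination hym'
  have hxT' : ‖curvTensor G u‖ ≤ τ := hxT.le
  have hxL' : ‖curvTensor G u - curvTensor G v‖ ≤ |L| * s :=
    hxL.trans (mul_le_mul (le_abs_self L) hzs hz0 (abs_nonneg L))
  -- the error from the frame being only almost unitary
  have b1 : ‖∑ a, ∑ b, (M⁻¹ a b - if a = b then 1 else 0) * curvDir G (P a) (P b) u i j‖ ≤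
      9 * (6 * C * (9 * (2 * C * (2 * C) * τ))) * s := by
    calc _ ≤ ∑ _a : Fin 3, ∑ _b : Fin 3, (6 * (C * s)) * (9 * (2 * C * (2 * C) * τ)) := by
          refine (norm_sum_le _ _).trans (Finset.sum_le_sum fun a _ => (norm_sum_le _ _).trans
            (Finset.sum_le_sum fun b _ => ?_))
          rw [norm_mul]
          have h1 := hM2 a b
          rw [← hs] at h1
          have h2 := norm_curvDir_apply_le g1 d1 (P a) (P b) i j
          have h3 : ((3 : ℕ) : ℝ) * (3 : ℕ) * (‖P a‖ * ‖P b‖ * ‖curvTensor G u‖) ≤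
              9 * (2 * C * (2 * C) * τ) := by
            have := hPb a
            have := hPb b
            norm_num
            gcongr
          exact mul_le_mul h1 (h2.trans h3) (norm_nonneg _) (by positivity)
      _ = _ := by simp; ring
  -- the error from moving from `proj x` to `x`
  have b2 : ∀ a : Fin 3, ∀ c : Fin 2, ‖P a - e c‖ ≤ C * ‖W.z x‖ →
      ‖curvDir G (P a) (P a) u i j - curvDir G (e c) (e c) v i j‖ ≤
        9 * (C * (2 * C + C) * τ + C * C * |L|) * s := by
    intro a c hac
    have h1 := norm_curvDir_sub_apply_le g1 d1 g2 d2 (P a) (e c) i j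
    have h2 : ‖P a - e c‖ ≤ C * s := hac.trans (mul_le_mul_of_nonneg_left hzs hC0)
    have h3 := hPb a
    have h4 := he3 c
    calc _ ≤ _ := h1
      _ ≤ ((3 : ℕ) : ℝ) * (3 : ℕ) * (C * s * (2 * C + C) * τ + C * C * (|L| * s)) := by gcongr
      _ = _ := by norm_num; ring
  -- the radial vector is small in `X`
  have b3 : ‖curvDir G (P 2) (P 2) u i j‖ ≤ 9 * (C * (2 * C) * τ) * s := by
    have h1 := norm_curvDir_apply_le g1 d1 (P 2) (P 2) i j
    have h2 : ‖P 2‖ ≤ C * s := hP2.trans (mul_le_mul_of_nonneg_left hzs hC0)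
    have h3 := hPb 2
    calc _ ≤ _ := h1
      _ ≤ ((3 : ℕ) : ℝ) * (3 : ℕ) * (C * s * (2 * C) * τ) := by gcongr
      _ = _ := by norm_num; ring
  have e1 : ((-2 * Complex.I) • ∑ a, ∑ b, M⁻¹ a b • curvDir G (P a) (P b) u) i j =
      (-2 * Complex.I) * ∑ a, ∑ b, M⁻¹ a b * curvDir G (P a) (P b) u i j := by
    simp [Matrix.smul_apply, Matrix.sum_apply]
  have e2 : ‖(-2 * Complex.I : ℂ)‖ = 2 := by simp
  rw [e1, norm_mul, e2, split]
  have n1 := norm_add_le (∑ a, ∑ b, (M⁻¹ a b - if a = b then 1 else 0) * curvDir G (P a) (P b) u i j +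
      ((curvDir G (P 0) (P 0) u i j - curvDir G (e 0) (e 0) v i j) +
        (curvDir G (P 1) (P 1) u i j - curvDir G (e 1) (e 1) v i j))) (curvDir G (P 2) (P 2) u i j)
  have n2 := norm_add_le (∑ a, ∑ b, (M⁻¹ a b - if a = b then 1 else 0) *
      curvDir G (P a) (P b) u i j)
      ((curvDir G (P 0) (P 0) u i j - curvDir G (e 0) (e 0) v i j) +
        (curvDir G (P 1) (P 1) u i j - curvDir G (e 1) (e 1) v i j))
  have n3 := norm_add_le (curvDir G (P 0) (P 0) u i j - curvDir G (e 0) (e 0) v i j)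
    (curvDir G (P 1) (P 1) u i j - curvDir G (e 1) (e 1) v i j)
  have b20 := b2 0 0 hP0
  have b21 := b2 1 1 hP1
  calc _ ≤ 2 * (9 * (6 * C * (9 * (2 * C * (2 * C) * τ))) * s +
        (9 * (C * (2 * C + C) * τ + C * C * |L|) * s +
          9 * (C * (2 * C + C) * τ + C * C * |L|) * s) + 9 * (C * (2 * C) * τ) * s) := by
        refine mul_le_mul_of_nonneg_left ?_ (by norm_num)
        exact n1.trans (add_le_add (n2.trans (add_le_add b1 (n3.trans (add_le_add b20 b21)))) b3)
    _ = K * s := by rw [hK]; ring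

/-- The energy density of a reference metric decays like `ε ^ min 1 (2 * rate)`. -/
theorem exists_energyDensity_le (hH : W.IsReferenceMetric r H) : ∃ B : ℝ, ∀ x ∈ W.carrier,
    energyDensity r W.h H x ≤ B * W.ε x ^ min 1 (2 * W.rate) := by
  have hm0 : 0 < min 1 (2 * W.rate) := lt_min one_pos (mul_pos two_pos W.rate_pos)
  have key : ∀ p : X, ∃ B : ℝ, 0 ≤ B ∧ ∀ᶠ x in nhds p, x ∉ W.D →
      energyDensity r W.h H x ≤ B * W.radius x ^ min 1 (2 * W.rate) := by
    intro p
    by_cases hp : p ∈ W.D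
    · obtain ⟨B, hB⟩ := W.eventually_energyDensity_le_of_mem hH hp
      refine ⟨|B|, abs_nonneg B, ?_⟩
      filter_upwards [hB, W.isOpen_U.mem_nhds (W.D_subset hp)] with x hx hxU hxD
      have hz : 0 < ‖W.z x‖ := by rw [← W.radius_of_mem hxU]; exact W.radius_pos hxD
      have hz1 := (W.norm_z_lt_one hxU).le
      rw [W.radius_of_mem hxU]
      refine (hx hxD).trans (mul_le_mul (le_abs_self B) ?_ (by positivity) (abs_nonneg B))
      rw [← Real.rpow_natCast, ← Real.rpow_mul hz.le]
      refine Real.rpow_le_rpow_of_exponent_ge hz hz1 ?_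
      -- `min 1 (2 * rate) ≤ 2 * min 1 rate`
      rcases le_total 1 W.rate with h | h
      · rw [min_eq_left h, min_eq_left (by linarith)]; norm_num
      · rw [min_eq_right h]
        refine (min_le_right _ _).trans (le_of_eq ?_)
        push_cast
        ring
    · obtain ⟨B, hB⟩ := W.eventually_energyDensity_le_of_notMem hH.metric hp
      have hr := W.radius_pos hp
      have hr2 : 0 < (W.radius p / 2) ^ min 1 (2 * W.rate) := Real.rpow_pos_of_pos (by linarith) _
      refine ⟨|B| / (W.radius p / 2) ^ min 1 (2 * W.rate), by positivity, ?_⟩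
      filter_upwards [hB, W.continuous_radius.continuousAt.eventually_const_lt
        (show W.radius p / 2 < W.radius p by linarith)] with x hx hxr _
      have h1 : (W.radius p / 2) ^ min 1 (2 * W.rate) ≤ W.radius x ^ min 1 (2 * W.rate) :=
        Real.rpow_le_rpow (by linarith) hxr.le hm0.le
      calc _ ≤ |B| := hx.trans (le_abs_self B)
        _ = |B| / (W.radius p / 2) ^ min 1 (2 * W.rate) * (W.radius p / 2) ^ min 1 (2 * W.rate) := by
          field_simp
        _ ≤ _ := by gcongr
  choose B hB0 hB using key
  obtain ⟨t, ht⟩ := CompactSpace.elim_nhds_subcover (fun p => {x | x ∉ W.D →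
      energyDensity r W.h H x ≤ B p * W.radius x ^ min 1 (2 * W.rate)}) (fun p => hB p)
  refine ⟨∑ p ∈ t, B p, fun x hx => ?_⟩
  have hx' : x ∈ (⊤ : Set X) := trivial
  rw [← ht, mem_iUnion₂] at hx'
  obtain ⟨p, hpt, hpx⟩ := hx'
  rw [W.ε_eq_radius hx]
  have h1 := hpx hx
  have h2 := Finset.single_le_sum (f := B) (fun p _ => hB0 p) hpt
  have h3 := W.radius_nonneg x
  exact h1.trans (by gcongr)

end ACylKahler

/-! ### Barrier functions -/

namespace ACylKahler

variable {X : Type*} [TopologicalSpace X] [T2Space X] [CompactSpace X]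
  [ChartedSpace (Fin 3 → ℂ) X] [IsManifold 𝓘(ℂ, Fin 3 → ℂ) ω X] (W : ACylKahler X)

/-- The columns of `P` are a unitary basis of the tangent space at `x`. -/
def IsUnitaryFrame (x : X) (P : Matrix (Fin 3) (Fin 3) ℂ) : Prop :=
  ∀ a b, W.h x (fun j => P j a) (fun j => P j b) = (1 : Matrix (Fin 3) (Fin 3) ℂ) a b

/-- Off the divisor the Kähler metric has unitary frames. -/
theorem exists_isUnitaryFrame {x : X} (hx : x ∉ W.D) : ∃ P, W.IsUnitaryFrame x P := by
  obtain ⟨B, hB, hK⟩ := exists_eq_conjTranspose_mul_self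
    (posDef_gramPt_tangent W.kahler.1 (mem_chart_source _ x) hx)
  refine ⟨B⁻¹, fun a b => ?_⟩
  rw [gramPt_self_tangent, hK, star_dotProduct_factor]
  have h1 : ∀ b, B *ᵥ (fun j => B⁻¹ j b) = (Pi.single b 1 : Fin 3 → ℂ) := by
    intro b
    have : (fun j => B⁻¹ j b) = B⁻¹ *ᵥ Pi.single b 1 := by
      ext j; simp
    rw [this, Matrix.mulVec_mulVec, Matrix.mul_nonsing_inv _ hB, Matrix.one_mulVec]
  rw [h1, h1, ← Pi.single_star]
  simp [Matrix.one_apply, Pi.single_apply, eq_comm]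

/-- The Laplacian at `x` of a function of the coordinates around `x`, computed in the frame `P`. It is
the Laplacian of the Kähler metric if `P` is unitary, since the metric is Kähler. -/
def lap (x : X) (P : Matrix (Fin 3) (Fin 3) ℂ) (f : (Fin 3 → ℂ) → ℝ) : ℝ :=
  ∑ a, levi (fun j => P j a) f (chartAt (Fin 3 → ℂ) x x)

theorem coordVec_self (x : X) (c : Fin 3 → ℂ) : coordVec x x c = c := by
  rw [coordVec, (transition_self (mem_chart_source _ x)).fderiv_eq, fderiv_id]
  rfl

theorem dzAt_eq_fderiv {x : X} (hx : x ∈ W.U) (c : Fin 3 → ℂ) :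
    W.dzAt x c = fderiv ℂ (W.zCoord x) (chartAt (Fin 3 → ℂ) x x) c := by
  rw [← W.dzAt_coordVec (mem_chart_source _ x) hx, coordVec_self]

/-- The squared length of a covector is the sum of the squares of its values on a unitary frame. -/
theorem sum_norm_sq_le_of_unitary {x : X} {P : Matrix (Fin 3) (Fin 3) ℂ}
    (hP : W.IsUnitaryFrame x P) (l : (Fin 3 → ℂ) →ₗ[ℂ] ℂ) {k : ℝ}
    (hl : ∀ v : Fin 3 → ℂ, ‖l v‖ ^ 2 ≤ k * (W.h x v v).re) :
    ∑ a, ‖l (fun j => P j a)‖ ^ 2 ≤ k := by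
  set θ : Fin 3 → ℂ := fun a => l (fun j => P j a) with hθ
  set s : ℝ := ∑ a, ‖θ a‖ ^ 2 with hs
  have hs0 : 0 ≤ s := Finset.sum_nonneg fun _ _ => by positivity
  set v : Fin 3 → ℂ := ∑ a, conj (θ a) • (fun j => P j a) with hv
  have h1 : l v = (s : ℂ) := by
    rw [hv, map_sum, hs]
    push_cast
    refine Finset.sum_congr rfl fun a _ => ?_
    rw [map_smul, smul_eq_mul, Complex.conj_mul']
  have h2 : W.h x v v = (s : ℂ) := by
    have h3 : W.h x v v = ∑ a, ∑ b, θ a * (conj (θ b) * W.h x (fun j => P j a) (fun j => P j b)) := by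
      have e : W.h x v v = star v ⬝ᵥ (gramPt 3 W.h x x *ᵥ v) := gramPt_self_tangent W.h x v v
      rw [e, hv]
      simp only [gramPt_self_tangent, star_sum, sum_dotProduct, Matrix.mulVec_sum, dotProduct_sum,
        star_smul, smul_dotProduct, Matrix.mulVec_smul, dotProduct_smul, smul_eq_mul,
        RCLike.star_def, Complex.conj_conj, Finset.mul_sum]
      rw [Finset.sum_comm]
      refine Finset.sum_congr rfl fun a _ => Finset.sum_congr rfl fun b _ => ?_
      ring
    rw [h3, hs]
    push_cast
    refine Finset.sum_congr rfl fun a _ => ?_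
    simp only [hP a, Matrix.one_apply, mul_ite, mul_one, mul_zero, Finset.sum_ite_eq,
      Finset.mem_univ, if_true]
    exact Complex.mul_conj' _
  have h3 := hl v
  rw [h1, h2, Complex.ofReal_re, Complex.norm_real, Real.norm_of_nonneg hs0] at h3
  by_contra! hcon
  have hk : s * s ≤ k * s := by rw [← sq]; exact h3
  rcases hs0.eq_or_lt with h0 | h0
  · have := hl (fun j => P j 0)
    have h4 : (W.h x (fun j => P j 0) (fun j => P j 0)).re = 1 := by rw [hP]; simp
    rw [h4] at this
    have : 0 ≤ k := by nlinarith [sq_nonneg ‖l (fun j => P j 0)‖]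
    linarith
  · exact absurd (le_of_mul_le_mul_right hk h0) (not_le.2 hcon)

/-- The decaying barrier `min 1 ((ε / ρ) ^ a)`. -/
def decay (ρ a : ℝ) (x : X) : ℝ := min 1 ((W.radius x / ρ) ^ a)

/-- The barrier `(max 0 (log ρ - log ε)) ^ 2`, which tends to infinity along the end. -/
def growth (ρ : ℝ) (x : X) : ℝ := (max 0 (Real.log ρ - Real.log (W.radius x))) ^ 2

theorem radius_chart_symm {x : X} (hx : x ∈ W.U) :
    ∀ᶠ u in nhds (chartAt (Fin 3 → ℂ) x x),
      W.radius ((chartAt (Fin 3 → ℂ) x).symm u) = ‖W.zCoord x u‖ := by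
  have h := (chartAt (Fin 3 → ℂ) x).continuousAt_symm
    ((chartAt (Fin 3 → ℂ) x).map_source (mem_chart_source _ x))
  filter_upwards [h.eventually (W.isOpen_U.mem_nhds (by
    rwa [(chartAt (Fin 3 → ℂ) x).left_inv (mem_chart_source _ x)]))] with u hu
  exact W.radius_of_mem hu

/-- Functions of `log |z|` have Laplacian controlled by their second derivative. -/
theorem lap_comp_log_norm_le {x : X} (hxU : x ∈ W.U) (hxD : x ∉ W.D)
    {P : Matrix (Fin 3) (Fin 3) ℂ} (hP : W.IsUnitaryFrame x P)
    (hdz : ∀ v : Fin 3 → ℂ, ‖W.dzAt x v / W.z x‖ ^ 2 ≤ 2 * (W.h x v v).re)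
    {φ φ' : ℝ → ℝ} {φ'' : ℝ} (hφ : ∀ y, HasDerivAt φ (φ' y) y)
    (hφ' : HasDerivAt φ' φ'' (Real.log (W.radius x))) (h0 : 0 ≤ φ'') :
    lap x P (fun u => φ (Real.log ‖W.zCoord x u‖)) ≤ 2 * φ'' := by
  have hxc := mem_chart_source (Fin 3 → ℂ) x
  have hz : W.zCoord x (chartAt (Fin 3 → ℂ) x x) = W.z x := W.zCoord_chart hxc
  have hz0 : W.z x ≠ 0 := fun h => hxD ((W.z_eq_zero_iff hxU).1 h)
  have h1 : ∀ a, levi (fun j => P j a) (fun u => φ (Real.log ‖W.zCoord x u‖))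
      (chartAt (Fin 3 → ℂ) x x) = φ'' * ‖W.dzAt x (fun j => P j a) / W.z x‖ ^ 2 := by
    intro a
    rw [levi_comp_log_norm (W.contDiffAt_zCoord hxc hxU) (by rwa [hz])
      (Filter.Eventually.of_forall hφ) (by rw [hz, ← W.radius_of_mem hxU]; exact hφ'), hz,
      W.dzAt_eq_fderiv hxU]
  simp only [lap, h1]
  rw [← Finset.mul_sum, mul_comm]
  refine mul_le_mul_of_nonneg_right ?_ h0
  have h2 := W.sum_norm_sq_le_of_unitary hP
    ((W.z x)⁻¹ • (fderiv ℂ (W.zCoord x) (chartAt (Fin 3 → ℂ) x x) : (Fin 3 → ℂ) →ₗ[ℂ] ℂ)) (k := 2)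
    (fun v => by
      have := hdz v
      rw [W.dzAt_eq_fderiv hxU, div_eq_inv_mul] at this
      exact this)
  refine le_of_eq_of_le (Finset.sum_congr rfl fun a _ => ?_) h2
  rw [W.dzAt_eq_fderiv hxU, div_eq_inv_mul]
  rfl

theorem contDiffAt_comp_log_norm {x : X} (hxU : x ∈ W.U) (hxD : x ∉ W.D) {φ : ℝ → ℝ}
    (hφ : ContDiff ℝ 2 φ) :
    ContDiffAt ℝ 2 (fun u => φ (Real.log ‖W.zCoord x u‖)) (chartAt (Fin 3 → ℂ) x x) := by
  have hxc := mem_chart_source (Fin 3 → ℂ) x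
  have hz0 : W.zCoord x (chartAt (Fin 3 → ℂ) x x) ≠ 0 := by
    rw [W.zCoord_chart hxc]
    exact fun h => hxD ((W.z_eq_zero_iff hxU).1 h)
  exact hφ.contDiffAt.comp _ (contDiffAt_log_norm (W.contDiffAt_zCoord hxc hxU) hz0)

/-- The decaying barrier is touched from above by smooth functions `f` with `Δ f ≤ f / 2`. -/
theorem exists_touching_decay {ρ a : ℝ} (hρ : 0 < ρ) (hρ1 : ρ < 1) (ha : 0 ≤ a) (ha2 : a ≤ 1 / 2)
    {x : X} (hxD : x ∉ W.D) {P : Matrix (Fin 3) (Fin 3) ℂ} (hP : W.IsUnitaryFrame x P)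
    (hdz : W.radius x ≤ ρ → ∀ v : Fin 3 → ℂ, ‖W.dzAt x v / W.z x‖ ^ 2 ≤ 2 * (W.h x v v).re) :
    ∃ f : (Fin 3 → ℂ) → ℝ, ContDiffAt ℝ 2 f (chartAt (Fin 3 → ℂ) x x) ∧
      (∀ᶠ u in nhds (chartAt (Fin 3 → ℂ) x x),
        W.decay ρ a ((chartAt (Fin 3 → ℂ) x).symm u) ≤ f u) ∧
      f (chartAt (Fin 3 → ℂ) x x) = W.decay ρ a x ∧ lap x P f ≤ W.decay ρ a x / 2 := by
  rcases lt_or_ge (W.radius x) ρ with h | h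
  · have hxU := W.mem_U_of_radius_lt_one (h.trans hρ1)
    have hr := W.radius_pos hxD
    have hdec : W.decay ρ a x = (W.radius x / ρ) ^ a :=
      min_eq_right (Real.rpow_le_one (by positivity) ((div_le_one hρ).2 h.le) ha)
    have hexp : ∀ {y : ℝ}, 0 < y → Real.exp (a * (Real.log y - Real.log ρ)) = (y / ρ) ^ a := by
      intro y hy
      rw [← Real.log_div hy.ne' hρ.ne', Real.rpow_def_of_pos (by positivity), mul_comm]
    have hd : ∀ y, HasDerivAt (fun y => Real.exp (a * (y - Real.log ρ)))
        (a * Real.exp (a * (y - Real.log ρ))) y := by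
      intro y
      have := (((hasDerivAt_id y).sub_const (Real.log ρ)).const_mul a).exp
      simpa [mul_comm] using this
    refine ⟨fun u => Real.exp (a * (Real.log ‖W.zCoord x u‖ - Real.log ρ)), ?_, ?_, ?_, ?_⟩
    · exact W.contDiffAt_comp_log_norm hxU hxD (φ := fun y => Real.exp (a * (y - Real.log ρ)))
        (Real.contDiff_exp.comp (contDiff_const.mul (contDiff_id.sub contDiff_const)))
    · have hz0 : W.zCoord x (chartAt (Fin 3 → ℂ) x x) ≠ 0 := by
        rw [W.zCoord_chart (mem_chart_source _ x)]
        exact fun h => hxD ((W.z_eq_zero_iff hxU).1 h)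
      filter_upwards [W.radius_chart_symm hxU, (W.contDiffAt_zCoord (mem_chart_source _ x)
        hxU).continuousAt.eventually_ne hz0] with u hu hu0
      rw [hexp (norm_pos_iff.2 hu0), ← hu]
      exact min_le_right _ _
    · beta_reduce
      rw [W.zCoord_chart (mem_chart_source _ x), ← W.radius_of_mem hxU, hexp hr, hdec]
    · refine (W.lap_comp_log_norm_le hxU hxD hP (hdz h.le) hd ((hd _).const_mul a)
        (by positivity)).trans ?_
      rw [hexp hr, ← hdec]
      have h0 : 0 ≤ W.decay ρ a x := by rw [hdec]; positivity
      -- `2 a² ≤ 1 / 2` because `a ≤ 1 / 2`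
      nlinarith [mul_nonneg (mul_nonneg (by linarith : (0 : ℝ) ≤ 1 / 2 - a)
        (by linarith : (0 : ℝ) ≤ 1 / 2 + a)) h0]
  · have hdec : W.decay ρ a x = 1 := min_eq_left (Real.one_le_rpow ((one_le_div hρ).2 h) ha)
    refine ⟨fun _ => 1, contDiffAt_const, Filter.Eventually.of_forall fun u => min_le_left _ _,
      hdec.symm, ?_⟩
    simp [lap, levi_const, hdec]

/-- The growing barrier is touched from above by smooth functions `f` with `Δ f ≤ 4`. -/
theorem exists_touching_growth {ρ : ℝ} (hρ : 0 < ρ) (hρ1 : ρ < 1)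
    {x : X} (hxD : x ∉ W.D) {P : Matrix (Fin 3) (Fin 3) ℂ} (hP : W.IsUnitaryFrame x P)
    (hdz : W.radius x ≤ ρ → ∀ v : Fin 3 → ℂ, ‖W.dzAt x v / W.z x‖ ^ 2 ≤ 2 * (W.h x v v).re) :
    ∃ f : (Fin 3 → ℂ) → ℝ, ContDiffAt ℝ 2 f (chartAt (Fin 3 → ℂ) x x) ∧
      (∀ᶠ u in nhds (chartAt (Fin 3 → ℂ) x x),
        W.growth ρ ((chartAt (Fin 3 → ℂ) x).symm u) ≤ f u) ∧
      f (chartAt (Fin 3 → ℂ) x x) = W.growth ρ x ∧ lap x P f ≤ 4 := by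
  rcases le_or_gt (W.radius x) ρ with h | h
  · have hxU := W.mem_U_of_radius_lt_one (h.trans_lt hρ1)
    have hr := W.radius_pos hxD
    have hd : ∀ y, HasDerivAt (fun y => (Real.log ρ - y) ^ 2) (-2 * (Real.log ρ - y)) y := by
      intro y
      have := ((hasDerivAt_id y).const_sub (Real.log ρ)).fun_pow 2
      simpa using this
    have hd' : ∀ y, HasDerivAt (fun y => -2 * (Real.log ρ - y)) 2 y := by
      intro y
      have := ((hasDerivAt_id y).const_sub (Real.log ρ)).const_mul (-2)
      simpa using this
    refine ⟨fun u => (Real.log ρ - Real.log ‖W.zCoord x u‖) ^ 2, ?_, ?_, ?_, ?_⟩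
    · exact W.contDiffAt_comp_log_norm hxU hxD (φ := fun y => (Real.log ρ - y) ^ 2)
        ((contDiff_const.sub contDiff_id).pow 2)
    · filter_upwards [W.radius_chart_symm hxU] with u hu
      rw [growth, hu]
      rcases le_total 0 (Real.log ρ - Real.log ‖W.zCoord x u‖) with h1 | h1
      · rw [max_eq_right h1]
      · rw [max_eq_left h1, zero_pow two_ne_zero]; exact sq_nonneg _
    · beta_reduce
      rw [W.zCoord_chart (mem_chart_source _ x), ← W.radius_of_mem hxU, growth, max_eq_right]
      exact sub_nonneg.2 (Real.log_le_log hr h)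
    · exact (W.lap_comp_log_norm_le hxU hxD hP (hdz h) hd (hd' _) (by norm_num)).trans
        (by norm_num)
  · have h1 : ∀ {y}, ρ < W.radius y → W.growth ρ y = 0 := fun {y} hy => by
      rw [growth, max_eq_left (sub_nonpos.2 (Real.log_le_log hρ hy.le))]; norm_num
    refine ⟨fun _ => 0, contDiffAt_const, ?_, (h1 h).symm, by simp [lap, levi_const]⟩
    have hc := (chartAt (Fin 3 → ℂ) x).continuousAt_symm
      ((chartAt (Fin 3 → ℂ) x).map_source (mem_chart_source _ x))
    have hc' : ContinuousAt (fun u => W.radius ((chartAt (Fin 3 → ℂ) x).symm u))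
        (chartAt (Fin 3 → ℂ) x x) := W.continuous_radius.continuousAt.comp hc
    filter_upwards [hc'.eventually_const_lt (show ρ < W.radius _ by
      rwa [(chartAt (Fin 3 → ℂ) x).left_inv (mem_chart_source _ x)])] with u hu
    exact (h1 hu).le

theorem decay_nonneg {ρ : ℝ} (hρ : 0 < ρ) (a : ℝ) (x : X) : 0 ≤ W.decay ρ a x :=
  le_min zero_le_one (Real.rpow_nonneg (div_nonneg (W.radius_nonneg x) hρ.le) _)

theorem growth_nonneg (ρ : ℝ) (x : X) : 0 ≤ W.growth ρ x := sq_nonneg _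

theorem continuous_decay (ρ : ℝ) {a : ℝ} (ha : 0 ≤ a) : Continuous (W.decay ρ a) :=
  continuous_const.min ((W.continuous_radius.div_const ρ).rpow_const fun _ => Or.inr ha)

theorem continuousAt_growth (ρ : ℝ) {x : X} (hx : x ∉ W.D) : ContinuousAt (W.growth ρ) x :=
  (continuousAt_const.max (continuousAt_const.sub
    (W.continuous_radius.continuousAt.log (W.radius_pos hx).ne'))).pow 2

theorem lap_sub {x : X} {P : Matrix (Fin 3) (Fin 3) ℂ} {f g : (Fin 3 → ℂ) → ℝ}
    (hf : ContDiffAt ℝ 2 f (chartAt (Fin 3 → ℂ) x x))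
    (hg : ContDiffAt ℝ 2 g (chartAt (Fin 3 → ℂ) x x)) :
    lap x P (fun u => f u - g u) = lap x P f - lap x P g := by
  simp only [lap, levi_sub hf hg, Finset.sum_sub_distrib]

theorem lap_add {x : X} {P : Matrix (Fin 3) (Fin 3) ℂ} {f g : (Fin 3 → ℂ) → ℝ}
    (hf : ContDiffAt ℝ 2 f (chartAt (Fin 3 → ℂ) x x))
    (hg : ContDiffAt ℝ 2 g (chartAt (Fin 3 → ℂ) x x)) :
    lap x P (fun u => f u + g u) = lap x P f + lap x P g := by
  simp only [lap, levi_add hf hg, Finset.sum_add_distrib]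

theorem lap_const_mul {x : X} {P : Matrix (Fin 3) (Fin 3) ℂ} {f : (Fin 3 → ℂ) → ℝ}
    (hf : ContDiffAt ℝ 2 f (chartAt (Fin 3 → ℂ) x x)) (c : ℝ) :
    lap x P (fun u => c * f u) = c * lap x P f := by
  simp only [lap, levi_const_mul hf, Finset.mul_sum]

end ACylKahler

/-! ### The maximum principle for the largest eigenvalue -/

section PerturbedFlow

variable {X : Type*} [TopologicalSpace X] [ChartedSpace (Fin 3 → ℂ) X]
  [IsManifold 𝓘(ℂ, Fin 3 → ℂ) ω X]
variable (r : ℕ) {E : X → Type*} [∀ x, AddCommGroup (E x)] [∀ x, Module ℂ (E x)]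
  [∀ x, TopologicalSpace (E x)] [TopologicalSpace (Bundle.TotalSpace (Fin r → ℂ) E)]
  [FiberBundle (Fin r → ℂ) E] [VectorBundle ℂ (Fin r → ℂ) E]

/-- A family of metrics which solves the evolution equation up to a defect `Q`:
`∂H/∂t = H (-2 i F̂_H) + Q`. Both solutions and time-independent metrics are of this form. -/
structure IsPerturbedFlow (h : TangentForm X) (S : Set X) (a : ℝ)
    (H : ℝ → ∀ x, E x →ₗ⋆[ℂ] E x →ₗ[ℂ] ℂ) (Q : ℝ → X → Matrix (Fin r) (Fin r) ℂ) : Prop where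
  metric : ∀ t ∈ Icc 0 a, IsHermitianMetricOn r (H t) S
  cont : ∀ x₀ i j, ContinuousOn (fun p : ℝ × (Fin 3 → ℂ) => gram r (H p.1) x₀ p.2 i j)
    (Icc 0 a ×ˢ frameDomain r E x₀ S)
  evolution : ∀ t ∈ Icc 0 a, ∀ x ∈ S, ∀ i j,
    HasDerivWithinAt (fun τ => gramAt r (H τ) x i j)
      ((gramAt r (H t) x * ((-2 * Complex.I) • Fhat r h (H t) x) + Q t x) i j) (Icc 0 a) t

variable {r}

/-- Differentiating a family of Hermitian forms on a fixed vector. -/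
theorem hasDerivWithinAt_form {M : ℝ → Matrix (Fin r) (Fin r) ℂ} {M' : Matrix (Fin r) (Fin r) ℂ}
    {s : Set ℝ} {t : ℝ} (h : ∀ i j, HasDerivWithinAt (fun τ => M τ i j) (M' i j) s t)
    (v : Fin r → ℂ) :
    HasDerivWithinAt (fun τ => (star v ⬝ᵥ (M τ *ᵥ v)).re) (star v ⬝ᵥ (M' *ᵥ v)).re s t := by
  have h1 : HasDerivWithinAt (fun τ => star v ⬝ᵥ (M τ *ᵥ v)) (star v ⬝ᵥ (M' *ᵥ v)) s t := by
    simp only [dotProduct, Matrix.mulVec]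
    exact HasDerivWithinAt.fun_sum fun i _ => (HasDerivWithinAt.fun_sum fun j _ =>
      (h i j).mul_const (v j)).const_mul _
  exact (Complex.reCLM.hasFDerivAt (x := star v ⬝ᵥ (M t *ᵥ v))).comp_hasDerivWithinAt t h1

/-- A function on an interval has nonnegative left derivative at a maximum. -/
theorem deriv_nonneg_of_isMax {g : ℝ → ℝ} {g' a t : ℝ} (ht : t ∈ Icc 0 a) (ht0 : 0 < t)
    (hg : HasDerivWithinAt g g' (Icc 0 a) t) (hmax : ∀ τ ∈ Icc 0 a, g τ ≤ g t) : 0 ≤ g' := by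
  have h1 : IsLocalMaxOn g (Icc 0 a) t := by
    filter_upwards [self_mem_nhdsWithin] with τ hτ using hmax τ hτ
  have h2 : -t ∈ posTangentConeAt (Icc (0 : ℝ) a) t := by
    refine mem_posTangentConeAt_of_segment_subset ?_
    rw [add_neg_cancel]
    exact (convex_Icc 0 a).segment_subset ht ⟨le_rfl, ht.1.trans ht.2⟩
  have h3 := h1.hasFDerivWithinAt_nonpos hg.hasFDerivWithinAt h2
  have h4 : -t * g' ≤ 0 := by simpa using h3
  nlinarith

end PerturbedFlow

namespace ACylKahler

variable {X : Type*} [TopologicalSpace X] [T2Space X] [CompactSpace X]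
  [ChartedSpace (Fin 3 → ℂ) X] [IsManifold 𝓘(ℂ, Fin 3 → ℂ) ω X] (W : ACylKahler X)
variable {r : ℕ} {E : X → Type*} [∀ x, AddCommGroup (E x)] [∀ x, Module ℂ (E x)]
  [∀ x, TopologicalSpace (E x)] [TopologicalSpace (Bundle.TotalSpace (Fin r → ℂ) E)]
  [FiberBundle (Fin r → ℂ) E] [VectorBundle ℂ (Fin r → ℂ) E]

/-- The mean curvature in a unitary frame. -/
theorem sum_form_curvDir {H : ∀ x, E x →ₗ⋆[ℂ] E x →ₗ[ℂ] ℂ}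
    (hH : IsHermitianMetricOn r H W.carrier) {x : X} (hx : x ∉ W.D)
    {P : Matrix (Fin 3) (Fin 3) ℂ} (hP : W.IsUnitaryFrame x P) (v : Fin r → ℂ) :
    ∑ a, -4 * (star v ⬝ᵥ ((gramAt r H x * curvDir (gram r H x) (fun j => P j a) (fun j => P j a)
        (chartAt (Fin 3 → ℂ) x x)) *ᵥ v)).re =
      (star v ⬝ᵥ ((gramAt r H x * ((-2 * Complex.I) • Fhat r W.h H x)) *ᵥ v)).re := by
  have h1 := Fhat_eq_sum_basis W.isOpen_carrier hH hx P 1 (by simp) hP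
  have h2 : (-2 * Complex.I) • Fhat r W.h H x = (-4 : ℂ) • ∑ a, curvDir (gram r H x)
      (fun j => P j a) (fun j => P j a) (chartAt (Fin 3 → ℂ) x x) := by
    rw [h1, smul_smul]
    have e : -2 * Complex.I * (-2 * Complex.I) = -4 := by
      linear_combination 4 * Complex.I_mul_I
    rw [e, inv_one]
    congr 1
    refine Finset.sum_congr rfl fun a _ => ?_
    simp [Matrix.one_apply, ite_smul]
  rw [h2, Matrix.mul_smul, Finset.mul_sum, Matrix.smul_mulVec, Matrix.sum_mulVec, dotProduct_smul,
    dotProduct_sum, smul_eq_mul, Finset.mul_sum, Complex.re_sum]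
  refine Finset.sum_congr rfl fun a _ => ?_
  simp

/-- At a maximum of the difference of `log (H/G)` and a smooth function `f`, the difference of
the mean curvatures is at most `Δ f`: this is the Bochner inequality for the section that is parallel
for `G` at this point. -/
theorem meanCurvature_sub_le_lap {H G : ∀ x, E x →ₗ⋆[ℂ] E x →ₗ[ℂ] ℂ}
    (hH : IsHermitianMetricOn r H W.carrier) (hG : IsHermitianMetricOn r G W.carrier) {x : X}
    (hx : x ∉ W.D) {P : Matrix (Fin 3) (Fin 3) ℂ} (hP : W.IsUnitaryFrame x P)
    {f : (Fin 3 → ℂ) → ℝ} (hf : ContDiffAt ℝ 2 f (chartAt (Fin 3 → ℂ) x x)) {v : Fin r → ℂ}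
    (hv : v ≠ 0)
    (hle : ∀ᶠ u in nhds (chartAt (Fin 3 → ℂ) x x), ∀ c : Fin r → ℂ,
      (star c ⬝ᵥ (gram r H x u *ᵥ c)).re ≤ Real.exp (f u) * (star c ⬝ᵥ (gram r G x u *ᵥ c)).re)
    (heq : (star v ⬝ᵥ (gramAt r H x *ᵥ v)).re =
      Real.exp (f (chartAt (Fin 3 → ℂ) x x)) * (star v ⬝ᵥ (gramAt r G x *ᵥ v)).re) :
    (star v ⬝ᵥ ((gramAt r H x * ((-2 * Complex.I) • Fhat r W.h H x)) *ᵥ v)).re /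
        (star v ⬝ᵥ (gramAt r H x *ᵥ v)).re -
      (star v ⬝ᵥ ((gramAt r G x * ((-2 * Complex.I) • Fhat r W.h G x)) *ᵥ v)).re /
        (star v ⬝ᵥ (gramAt r G x *ᵥ v)).re ≤ lap x P f := by
  have hu : chartAt (Fin 3 → ℂ) x x ∈ frameDomain r E x W.carrier :=
    mem_frameDomain (mem_chart_source _ x) (FiberBundle.mem_baseSet_trivializationAt' x) hx
  set u₀ := chartAt (Fin 3 → ℂ) x x with hu₀
  have hdom := (isOpen_frameDomain (r := r) (E := E) x W.isOpen_carrier).mem_nhds hu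
  have cH : MatContDiffAt 2 (gram r H x) u₀ :=
    (matContDiffAt_gram W.isOpen_carrier hH hu).of_le ENat.LEInfty.out
  have cG : MatContDiffAt 2 (gram r G x) u₀ :=
    (matContDiffAt_gram W.isOpen_carrier hG hu).of_le ENat.LEInfty.out
  have pH : (gram r H x u₀).PosDef := posDef_gram hH hu
  have pG : (gram r G x u₀).PosDef := posDef_gram hG hu
  obtain ⟨S, hS, hS0, hpar⟩ := exists_parallel_section (gram r G x) u₀ v
  have hSne : S u₀ ≠ 0 := by rw [hS0]; exact hv
  have lH := contDiffAt_log_normSqSection cH pH hS hSne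
  have lG := contDiffAt_log_normSqSection cG pG hS hSne
  have e0 : normSqSection (gram r H x) S u₀ = (star v ⬝ᵥ (gramAt r H x *ᵥ v)).re := by
    rw [normSqSection, hS0]; rfl
  have e1 : normSqSection (gram r G x) S u₀ = (star v ⬝ᵥ (gramAt r G x *ᵥ v)).re := by
    rw [normSqSection, hS0]; rfl
  -- the section has values in the cone where the inequality holds, with equality at the point
  have hmax : IsLocalMax (fun u => (Real.log (normSqSection (gram r H x) S u) -
      Real.log (normSqSection (gram r G x) S u)) - f u) u₀ := by
    have h0 : Real.log (normSqSection (gram r H x) S u₀) -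
      Real.log (normSqSection (gram r G x) S u₀) - f u₀ = 0 := by
      have hpos : 0 < (star v ⬝ᵥ (gramAt r G x *ᵥ v)).re := form_re_pos pG hv
      rw [e0, e1, heq, Real.log_mul (Real.exp_pos _).ne' hpos.ne', Real.log_exp]
      ring
    filter_upwards [hle, hdom, hS.continuousAt.eventually_ne hSne] with u h1 h2 h3
    rw [h0]
    have pHu : 0 < normSqSection (gram r H x) S u := form_re_pos (posDef_gram hH h2) h3
    have pGu : 0 < normSqSection (gram r G x) S u := form_re_pos (posDef_gram hG h2) h3
    have h4 : normSqSection (gram r H x) S u ≤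
        Real.exp (f u) * normSqSection (gram r G x) S u := h1 (S u)
    have h5 := Real.log_le_log pHu h4
    rw [Real.log_mul (Real.exp_pos _).ne' pGu.ne', Real.log_exp] at h5
    linarith
  have h1 : lap x P (fun u => (Real.log (normSqSection (gram r H x) S u) -
      Real.log (normSqSection (gram r G x) S u)) - f u) ≤ 0 :=
    Finset.sum_nonpos fun a _ => levi_nonpos_of_isLocalMax ((lH.sub lG).sub hf) hmax _
  rw [lap_sub (lH.sub lG) hf, lap_sub lH lG] at h1
  have hHerm : ∀ {K : ∀ x, E x →ₗ⋆[ℂ] E x →ₗ[ℂ] ℂ}, IsHermitianMetricOn r K W.carrier →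
      ∀ᶠ u in nhds u₀, (gram r K x u).IsHermitian := fun hK => by
    filter_upwards [hdom] with u h using (posDef_gram hK h).isHermitian
  -- for `H` the section is only holomorphic, for `G` it is parallel
  have h2 : (star v ⬝ᵥ ((gramAt r H x * ((-2 * Complex.I) • Fhat r W.h H x)) *ᵥ v)).re /
      (star v ⬝ᵥ (gramAt r H x *ᵥ v)).re ≤
      lap x P fun u => Real.log (normSqSection (gram r H x) S u) := by
    rw [← W.sum_form_curvDir hH hx hP, Finset.sum_div, lap]
    refine Finset.sum_le_sum fun a _ => ?_
    have := levi_log_normSqSection_ge cH (hHerm hH) pH hS hSne (fun j => P j a)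
    rw [e0, hS0] at this
    exact this
  have h3 : lap x P (fun u => Real.log (normSqSection (gram r G x) S u)) =
      (star v ⬝ᵥ ((gramAt r G x * ((-2 * Complex.I) • Fhat r W.h G x)) *ᵥ v)).re /
      (star v ⬝ᵥ (gramAt r G x *ᵥ v)).re := by
    rw [← W.sum_form_curvDir hG hx hP, Finset.sum_div, lap]
    refine Finset.sum_congr rfl fun a _ => ?_
    have := levi_log_normSqSection_eq cG (hHerm hG) pG hS hSne (fun j => P j a) (hpar _)
    rw [e1, hS0] at this
    exact this
  linarith

/-- The barrier for `log (H/G)`. The term with `δ` forces the maximum to be attained; as the Laplacian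
of `growth` is at most `4`, the coefficient `5` makes it a strict supersolution. -/
def barrier (ρ e : ℝ) (A : ℝ → ℝ) (δ : ℝ) (t : ℝ) (x : X) : ℝ :=
  A t * W.decay ρ e x + δ * (1 + 5 * t + W.growth ρ x)

/-- `H ≤ exp σ * exp (barrier) * G` cannot be sharp at a positive time. -/
theorem not_touching {a : ℝ} {H G : ℝ → ∀ x, E x →ₗ⋆[ℂ] E x →ₗ[ℂ] ℂ}
    {Q R : ℝ → X → Matrix (Fin r) (Fin r) ℂ} (hH : IsPerturbedFlow r W.h W.carrier a H Q)
    (hG : IsPerturbedFlow r W.h W.carrier a G R)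
    {ρ e : ℝ} (hρ : 0 < ρ) (hρ1 : ρ < 1) (he : 0 ≤ e) (he2 : e ≤ 1 / 2)
    (hdz : ∀ x ∉ W.D, W.radius x ≤ ρ →
      ∀ v : Fin 3 → ℂ, ‖W.dzAt x v / W.z x‖ ^ 2 ≤ 2 * (W.h x v v).re)
    {A A' : ℝ → ℝ} {c δ σ : ℝ} (hδ : 0 < δ) (hA : ∀ t ∈ Icc 0 a, HasDerivAt A (A' t) t)
    (hA0 : ∀ t ∈ Icc 0 a, 0 ≤ A t) (hA' : ∀ t ∈ Icc 0 a, c ≤ A' t - A t / 2)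
    (hQ : ∀ t ∈ Icc 0 a, ∀ x ∉ W.D, ∀ v : Fin r → ℂ, v ≠ 0 →
      (star v ⬝ᵥ (Q t x *ᵥ v)).re / (star v ⬝ᵥ (gramAt r (H t) x *ᵥ v)).re -
        (star v ⬝ᵥ (R t x *ᵥ v)).re / (star v ⬝ᵥ (gramAt r (G t) x *ᵥ v)).re ≤ c * W.decay ρ e x)
    (hle : ∀ t ∈ Icc 0 a, ∀ y ∉ W.D, ∀ w : E y,
      (H t y w w).re ≤ Real.exp (σ + W.barrier ρ e A δ t y) * (G t y w w).re)
    {t : ℝ} (ht : t ∈ Icc 0 a) (ht0 : 0 < t) {x : X} (hx : x ∉ W.D) {w : E x} (hw : w ≠ 0) :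
    (H t x w w).re ≠ Real.exp (σ + W.barrier ρ e A δ t x) * (G t x w w).re := by
  intro heq
  have hxb := FiberBundle.mem_baseSet_trivializationAt' (F := Fin r → ℂ) (E := E) x
  obtain ⟨v, rfl⟩ := exists_eq_frameVec hxb w
  have hv : v ≠ 0 := by
    rintro rfl
    exact hw (frameVec_zero x x)
  have hform : ∀ (K : ∀ x, E x →ₗ⋆[ℂ] E x →ₗ[ℂ] ℂ),
      K x (frameVec r x x v) (frameVec r x x v) = star v ⬝ᵥ (gramAt r K x *ᵥ v) := fun K => by
    rw [form_frameVec, gramAt_eq]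
  have pos : ∀ {K : ∀ x, E x →ₗ⋆[ℂ] E x →ₗ[ℂ] ℂ}, IsHermitianMetricOn r K W.carrier →
      0 < (star v ⬝ᵥ (gramAt r K x *ᵥ v)).re := fun {K} hK => by
    rw [gramAt_eq]; exact form_re_pos (posDef_gramPt hK hxb hx) hv
  obtain ⟨P, hP⟩ := W.exists_isUnitaryFrame hx
  obtain ⟨f1, cf1, lf1, ef1, bf1⟩ := W.exists_touching_decay hρ hρ1 he he2 hx hP (hdz x hx)
  obtain ⟨f2, cf2, lf2, ef2, bf2⟩ := W.exists_touching_growth hρ hρ1 hx hP (hdz x hx)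
  have hAt := hA0 t ht
  -- the spatial part
  have space := W.meanCurvature_sub_le_lap (hH.metric t ht) (hG.metric t ht) hx hP
    (f := fun u => (A t * f1 u + δ * f2 u) + (σ + δ * (1 + 5 * t)))
    (((contDiffAt_const.mul cf1).add (contDiffAt_const.mul cf2)).add contDiffAt_const) hv
    (by
      have hu : chartAt (Fin 3 → ℂ) x x ∈ frameDomain r E x W.carrier :=
        mem_frameDomain (mem_chart_source _ x) hxb hx
      filter_upwards [lf1, lf2, (isOpen_frameDomain (r := r) (E := E) x W.isOpen_carrier).mem_nhds
        hu] with u h1 h2 h3 d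
      have h4 := hle t ht ((chartAt (Fin 3 → ℂ) x).symm u) h3.2.2 (frameVec r x _ d)
      rw [form_frameVec, form_frameVec] at h4
      refine h4.trans (mul_le_mul_of_nonneg_right (Real.exp_le_exp.2 ?_)
        (form_re_nonneg (posDef_gram (hG.metric t ht) h3) d))
      have := mul_le_mul_of_nonneg_left h1 hAt
      have := mul_le_mul_of_nonneg_left h2 hδ.le
      rw [barrier]
      linarith)
    (by
      rw [hform, hform] at heq
      rw [heq, ef1, ef2, barrier]
      congr 2
      ring)
  rw [lap_add ((contDiffAt_const.mul cf1).add (contDiffAt_const.mul cf2)) contDiffAt_const,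
    lap_add (contDiffAt_const.mul cf1) (contDiffAt_const.mul cf2), lap_const_mul cf1,
    lap_const_mul cf2] at space
  have hlc : lap x P (fun _ => σ + δ * (1 + 5 * t)) = 0 := by simp [lap, levi_const]
  rw [hlc] at space
  -- the time derivative
  have dH := (hasDerivWithinAt_form (hH.evolution t ht x hx) v).log (pos (hH.metric t ht)).ne'
  have dG := (hasDerivWithinAt_form (hG.evolution t ht x hx) v).log (pos (hG.metric t ht)).ne'
  have dB : HasDerivWithinAt (fun τ => A τ * W.decay ρ e x + δ * (5 * τ))
      (A' t * W.decay ρ e x + δ * 5) (Icc 0 a) t := by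
    have := (((hA t ht).mul_const (W.decay ρ e x)).fun_add
      (((hasDerivAt_id t).const_mul 5).const_mul δ)).hasDerivWithinAt (s := Icc 0 a)
    simpa using this
  have time := deriv_nonneg_of_isMax ht ht0 ((dH.sub dG).sub dB) (by
    intro τ hτ
    have hb : ∀ τ, W.barrier ρ e A δ τ x =
        (A τ * W.decay ρ e x + δ * (5 * τ)) + (δ + δ * W.growth ρ x) := fun τ => by
      rw [barrier]; ring
    have h1 := hle τ hτ x hx (frameVec r x x v)
    rw [hform, hform] at h1 heq
    have h2 := Real.log_le_log (pos (hH.metric τ hτ)) h1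
    have h3 := congrArg Real.log heq
    rw [Real.log_mul (Real.exp_pos _).ne' (pos (hG.metric τ hτ)).ne', Real.log_exp, hb] at h2
    rw [Real.log_mul (Real.exp_pos _).ne' (pos (hG.metric t ht)).ne', Real.log_exp, hb] at h3
    simp only [Pi.sub_apply]
    linarith)
  rw [Matrix.add_mulVec, Matrix.add_mulVec, dotProduct_add, dotProduct_add, Complex.add_re,
    Complex.add_re, add_div, add_div] at time
  have hQ' := hQ t ht x hx v hv
  -- the barrier grows at rate at least `c Ψ + 5 δ` minus its Laplacian, which is at most `A Ψ / 2 + 4 δ`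
  have b1 := mul_le_mul_of_nonneg_left bf1 hAt
  have b2 := mul_le_mul_of_nonneg_left bf2 hδ.le
  have b3 := mul_le_mul_of_nonneg_right (hA' t ht) (W.decay_nonneg hρ e x)
  have b4 : (A' t - A t / 2) * W.decay ρ e x =
    A' t * W.decay ρ e x - A t * (W.decay ρ e x / 2) := by ring
  linarith

end ACylKahler

section Tube

/-- The tube lemma for an arbitrary filter. -/
theorem IsCompact.eventually_forall_of_prod {α β : Type*} [TopologicalSpace β] {K : Set β}
    (hK : IsCompact K) {F : Filter α} {p : α → β → Prop}
    (h : ∀ y ∈ K, ∀ᶠ q in F ×ˢ nhds y, p q.1 q.2) : ∀ᶠ x in F, ∀ y ∈ K, p x y := by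
  refine hK.induction_on (p := fun s => ∀ᶠ x in F, ∀ y ∈ s, p x y) (by simp)
    (fun s t hst ht => ht.mono fun x hx y hy => hx y (hst hy))
    (fun s t hs ht => ?_) (fun y hy => ?_)
  · filter_upwards [hs, ht] with x h1 h2 y hy
    exact hy.elim (h1 y) (h2 y)
  · obtain ⟨pa, ha, pb, hb, hp⟩ := Filter.eventually_prod_iff.1 (h y hy)
    exact ⟨{y | pb y}, mem_nhdsWithin_of_mem_nhds hb, ha.mono fun x hx y hy => hp hx hy⟩

theorem tendsto_form {α : Type*} {r : ℕ} {l : Filter α} {M : α → Matrix (Fin r) (Fin r) ℂ}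
    {c : α → (Fin r → ℂ)} {M₀ : Matrix (Fin r) (Fin r) ℂ} {c₀ : Fin r → ℂ}
    (hM : ∀ i j, Filter.Tendsto (fun q => M q i j) l (nhds (M₀ i j)))
    (hc : Filter.Tendsto c l (nhds c₀)) :
    Filter.Tendsto (fun q => (star (c q) ⬝ᵥ (M q *ᵥ c q)).re) l
      (nhds (star c₀ ⬝ᵥ (M₀ *ᵥ c₀)).re) := by
  have hc' := tendsto_pi_nhds.1 hc
  refine (Complex.continuous_re.tendsto _).comp ?_
  simp only [dotProduct, Matrix.mulVec, Pi.star_apply]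
  exact tendsto_finsetSum _ fun i _ => ((continuous_star.tendsto _).comp (hc' i)).mul
    (tendsto_finsetSum _ fun j _ => (hM i j).mul (hc' j))

theorem form_smul {r : ℕ} (M : Matrix (Fin r) (Fin r) ℂ) (a : ℝ) (c : Fin r → ℂ) :
    (star (a • c) ⬝ᵥ (M *ᵥ (a • c))).re = a ^ 2 * (star c ⬝ᵥ (M *ᵥ c)).re := by
  have h : (a • c : Fin r → ℂ) = (a : ℂ) • c := by ext; simp
  rw [h, star_smul, smul_dotProduct, Matrix.mulVec_smul, dotProduct_smul]
  simp
  ring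

end Tube

namespace ACylKahler

variable {X : Type*} [TopologicalSpace X] [T2Space X] [CompactSpace X]
  [ChartedSpace (Fin 3 → ℂ) X] [IsManifold 𝓘(ℂ, Fin 3 → ℂ) ω X] (W : ACylKahler X)
variable {r : ℕ} {E : X → Type*} [∀ x, AddCommGroup (E x)] [∀ x, Module ℂ (E x)]
  [∀ x, TopologicalSpace (E x)] [TopologicalSpace (Bundle.TotalSpace (Fin r → ℂ) E)]
  [FiberBundle (Fin r → ℂ) E] [VectorBundle ℂ (Fin r → ℂ) E]

theorem tendsto_gramPt {a : ℝ} {H : ℝ → ∀ x, E x →ₗ⋆[ℂ] E x →ₗ[ℂ] ℂ}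
    {Q : ℝ → X → Matrix (Fin r) (Fin r) ℂ} (hH : IsPerturbedFlow r W.h W.carrier a H Q)
    {t : ℝ} (ht : t ∈ Icc 0 a) {x : X} (hx : x ∉ W.D) (i j : Fin r) :
    Filter.Tendsto (fun z : ℝ × X => gramPt r (H z.1) x z.2 i j)
      (nhdsWithin (t, x) (Icc 0 a ×ˢ W.carrier)) (nhds (gramPt r (H t) x x i j)) := by
  have hxc := mem_chart_source (Fin 3 → ℂ) x
  have hxb := FiberBundle.mem_baseSet_trivializationAt' (F := Fin r → ℂ) (E := E) x
  have hu : chartAt (Fin 3 → ℂ) x x ∈ frameDomain r E x W.carrier := mem_frameDomain hxc hxb hx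
  have h1 := hH.cont x i j (t, chartAt (Fin 3 → ℂ) x x) ⟨ht, hu⟩
  rw [ContinuousWithinAt, gram_chart _ hxc] at h1
  have h2 : Filter.Tendsto (fun z : ℝ × X => (z.1, chartAt (Fin 3 → ℂ) x z.2))
      (nhdsWithin (t, x) (Icc 0 a ×ˢ W.carrier))
      (nhdsWithin (t, chartAt (Fin 3 → ℂ) x x) (Icc 0 a ×ˢ frameDomain r E x W.carrier)) := by
    refine tendsto_nhdsWithin_iff.2 ⟨?_, ?_⟩
    · refine Filter.Tendsto.mono_left ?_ nhdsWithin_le_nhds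
      exact (continuousAt_fst.prodMk (((chartAt (Fin 3 → ℂ) x).continuousAt hxc).comp
        (f := Prod.snd) continuousAt_snd))
    · filter_upwards [self_mem_nhdsWithin, mem_nhdsWithin_of_mem_nhds
        (continuousAt_snd.preimage_mem_nhds (x := (t, x))
          ((chartAt (Fin 3 → ℂ) x).open_source.mem_nhds hxc)), mem_nhdsWithin_of_mem_nhds
        (continuousAt_snd.preimage_mem_nhds (x := (t, x))
          ((trivializationAt (Fin r → ℂ) E x).open_baseSet.mem_nhds hxb))] with z h1 h2 h3
      exact ⟨h1.1, mem_frameDomain h2 h3 h1.2⟩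
  refine (h1.comp h2).congr' ?_
  filter_upwards [mem_nhdsWithin_of_mem_nhds
    (continuousAt_snd.preimage_mem_nhds (x := (t, x))
      ((chartAt (Fin 3 → ℂ) x).open_source.mem_nhds hxc))] with z hz
  simp only [Function.comp]
  rw [gram_chart _ hz]

/-- A strict inequality between families of metrics at a point improves to a slightly better
inequality at all nearby points, by compactness of the unit sphere. -/
theorem exists_lt_eventually_le {a : ℝ} {H G : ℝ → ∀ x, E x →ₗ⋆[ℂ] E x →ₗ[ℂ] ℂ}
    {Q R : ℝ → X → Matrix (Fin r) (Fin r) ℂ} (hH : IsPerturbedFlow r W.h W.carrier a H Q)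
    (hG : IsPerturbedFlow r W.h W.carrier a G R) {b : ℝ × X → ℝ} {σ t : ℝ} (ht : t ∈ Icc 0 a)
    {x : X} (hx : x ∉ W.D) (hb : ContinuousAt b (t, x))
    (hlt : ∀ w : E x, w ≠ 0 → (H t x w w).re < Real.exp (σ + b (t, x)) * (G t x w w).re) :
    ∃ σ' < σ, ∀ᶠ z in nhdsWithin (t, x) (Icc 0 a ×ˢ W.carrier), ∀ w : E z.2,
      (H z.1 z.2 w w).re ≤ Real.exp (σ' + b z) * (G z.1 z.2 w w).re := by
  have hxb := FiberBundle.mem_baseSet_trivializationAt' (F := Fin r → ℂ) (E := E) x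
  have key := (isCompact_sphere (0 : Fin r → ℂ) 1).eventually_forall_of_prod
    (F := nhds σ ×ˢ nhdsWithin (t, x) (Icc 0 a ×ˢ W.carrier))
    (p := fun q c => (star c ⬝ᵥ (gramPt r (H q.2.1) x q.2.2 *ᵥ c)).re <
      Real.exp (q.1 + b q.2) * (star c ⬝ᵥ (gramPt r (G q.2.1) x q.2.2 *ᵥ c)).re) (by
    intro c hc
    have hc0 : c ≠ 0 := by
      rintro rfl
      simp at hc
    have hw := hlt (frameVec r x x c) (frameVec_ne_zero hxb hc0)
    rw [form_frameVec, form_frameVec] at hw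
    have p1 : Filter.Tendsto
        (fun q : (ℝ × (ℝ × X)) × (Fin r → ℂ) => q.1.2)
        ((nhds σ ×ˢ nhdsWithin (t, x) (Icc 0 a ×ˢ W.carrier)) ×ˢ nhds c)
        (nhdsWithin (t, x) (Icc 0 a ×ˢ W.carrier)) :=
      Filter.tendsto_snd.comp Filter.tendsto_fst
    have p2 : Filter.Tendsto
        (fun q : (ℝ × (ℝ × X)) × (Fin r → ℂ) => q.1.1)
        ((nhds σ ×ˢ nhdsWithin (t, x) (Icc 0 a ×ˢ W.carrier)) ×ˢ nhds c) (nhds σ) :=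
      Filter.tendsto_fst.comp Filter.tendsto_fst
    have tH := tendsto_form (fun i j => (W.tendsto_gramPt hH ht hx i j).comp p1)
      Filter.tendsto_snd
    have tG := tendsto_form (fun i j => (W.tendsto_gramPt hG ht hx i j).comp p1)
      Filter.tendsto_snd
    have tb := (Real.continuous_exp.tendsto _).comp
      (p2.add ((hb.mono_left nhdsWithin_le_nhds).comp p1))
    exact tH.eventually_lt (tb.mul tG) hw)
  obtain ⟨pa, ha, pb, hpb, hp⟩ := Filter.eventually_prod_iff.1 key
  obtain ⟨σ', h1, h2⟩ := ((ha.filter_mono nhdsWithin_le_nhds).and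
    (self_mem_nhdsWithin (s := Iio σ))).exists
  refine ⟨σ', h2, ?_⟩
  filter_upwards [hpb, mem_nhdsWithin_of_mem_nhds (continuousAt_snd.preimage_mem_nhds (x := (t, x))
    ((trivializationAt (Fin r → ℂ) E x).open_baseSet.mem_nhds hxb))] with z hz hzb w
  obtain ⟨c, rfl⟩ := exists_eq_frameVec hzb w
  rw [form_frameVec, form_frameVec]
  rcases eq_or_ne c 0 with rfl | hc
  · simp
  · have hn : 0 < ‖c‖ := norm_pos_iff.2 hc
    have hcc : c = ‖c‖ • (‖c‖⁻¹ • c) := by rw [smul_smul, mul_inv_cancel₀ hn.ne', one_smul]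
    have h3 := hp h1 hz (‖c‖⁻¹ • c) (by
      rw [mem_sphere_zero_iff_norm, norm_smul, norm_inv, norm_norm, inv_mul_cancel₀ hn.ne'])
    have sH := form_smul (gramPt r (H z.1) x z.2) ‖c‖ (‖c‖⁻¹ • c)
    have sG := form_smul (gramPt r (G z.1) x z.2) ‖c‖ (‖c‖⁻¹ • c)
    rw [← hcc] at sH sG
    rw [sH, sG, mul_left_comm]
    exact mul_le_mul_of_nonneg_left h3.le (sq_nonneg ‖c‖)

/-- **Comparison principle**: an inequality `H ≤ exp (A Ψ) G` between two solutions of the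
evolution equation, up to defects of size `c Ψ`, persists if `A' ≥ A / 2 + c`. -/
theorem comparison {a : ℝ} {H G : ℝ → ∀ x, E x →ₗ⋆[ℂ] E x →ₗ[ℂ] ℂ}
    {Q R : ℝ → X → Matrix (Fin r) (Fin r) ℂ} (hH : IsPerturbedFlow r W.h W.carrier a H Q)
    (hG : IsPerturbedFlow r W.h W.carrier a G R)
    {ρ e : ℝ} (hρ : 0 < ρ) (hρ1 : ρ < 1) (he : 0 ≤ e) (he2 : e ≤ 1 / 2)
    (hdz : ∀ x ∉ W.D, W.radius x ≤ ρ →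
      ∀ v : Fin 3 → ℂ, ‖W.dzAt x v / W.z x‖ ^ 2 ≤ 2 * (W.h x v v).re)
    {A A' : ℝ → ℝ} {c : ℝ} (hA : ∀ t ∈ Icc 0 a, HasDerivAt A (A' t) t)
    (hA0 : ∀ t ∈ Icc 0 a, 0 ≤ A t) (hA' : ∀ t ∈ Icc 0 a, c ≤ A' t - A t / 2)
    (hQ : ∀ t ∈ Icc 0 a, ∀ x ∉ W.D, ∀ v : Fin r → ℂ, v ≠ 0 →
      (star v ⬝ᵥ (Q t x *ᵥ v)).re / (star v ⬝ᵥ (gramAt r (H t) x *ᵥ v)).re -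
        (star v ⬝ᵥ (R t x *ᵥ v)).re / (star v ⬝ᵥ (gramAt r (G t) x *ᵥ v)).re ≤ c * W.decay ρ e x)
    {K : ℝ} (hK : ∀ t ∈ Icc 0 a, ∀ x ∉ W.D, ∀ w : E x, (H t x w w).re ≤ K * (G t x w w).re)
    (hinit : ∀ x ∉ W.D, ∀ w : E x,
      (H 0 x w w).re ≤ Real.exp (A 0 * W.decay ρ e x) * (G 0 x w w).re)
    {t : ℝ} (ht : t ∈ Icc 0 a) {x : X} (hx : x ∉ W.D) (w : E x) :
    (H t x w w).re ≤ Real.exp (A t * W.decay ρ e x) * (G t x w w).re := by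
  have hGpos : ∀ t ∈ Icc 0 a, ∀ x ∉ W.D, ∀ w : E x, 0 ≤ (G t x w w).re := by
    intro t ht x hx w
    rcases eq_or_ne w 0 with rfl | hw
    · simp
    · exact ((hG.metric t ht).pos x hx w hw).le
  -- it suffices to prove the inequality with the barrier, for every `δ > 0`
  suffices main : ∀ δ > 0, (H t x w w).re ≤
      Real.exp (W.barrier ρ e A δ t x) * (G t x w w).re by
    have hlim : Filter.Tendsto (fun δ => Real.exp (W.barrier ρ e A δ t x) * (G t x w w).re)
        (nhdsWithin 0 (Ioi 0)) (nhds (Real.exp (A t * W.decay ρ e x) * (G t x w w).re)) := by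
      have hc : Continuous fun δ => Real.exp (W.barrier ρ e A δ t x) * (G t x w w).re := by
        unfold barrier
        fun_prop
      have := hc.tendsto 0
      rw [show W.barrier ρ e A 0 t x = A t * W.decay ρ e x by rw [barrier]; ring] at this
      exact this.mono_left nhdsWithin_le_nhds
    exact ge_of_tendsto hlim (by filter_upwards [self_mem_nhdsWithin] with δ hδ using main δ hδ)
  intro δ hδ
  -- the optimal `σ ≥ 0` for which the inequality holds with the factor `exp σ`
  set good : Set ℝ := {s | 0 ≤ s ∧ ∀ t ∈ Icc 0 a, ∀ x ∉ W.D, ∀ w : E x,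
    (H t x w w).re ≤ Real.exp (s + W.barrier ρ e A δ t x) * (G t x w w).re} with hgood
  have hbnn : ∀ t ∈ Icc 0 a, ∀ x, δ * W.growth ρ x ≤ W.barrier ρ e A δ t x := by
    intro t ht x
    have h1 := mul_nonneg (hA0 t ht) (W.decay_nonneg hρ e x)
    have h2 := mul_nonneg hδ.le ht.1
    rw [barrier]
    linarith
  have hb0 : ∀ t ∈ Icc 0 a, ∀ x, 0 ≤ W.barrier ρ e A δ t x := fun t ht x =>
    (mul_nonneg hδ.le (W.growth_nonneg ρ x)).trans (hbnn t ht x)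
  set K' := max K 1 with hK'
  have hK'1 : 1 ≤ K' := le_max_right _ _
  have hlogK : 0 ≤ Real.log K' := Real.log_nonneg hK'1
  have hK'b : ∀ t ∈ Icc 0 a, ∀ x ∉ W.D, ∀ w : E x, ∀ s, Real.log K' ≤ s →
      (H t x w w).re ≤ Real.exp s * (G t x w w).re := by
    intro t ht x hx w s hs
    refine (hK t ht x hx w).trans (mul_le_mul_of_nonneg_right ?_ (hGpos t ht x hx w))
    calc K ≤ K' := le_max_left _ _
      _ = Real.exp (Real.log K') := (Real.exp_log (by linarith)).symm
      _ ≤ _ := Real.exp_le_exp.2 hs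
  have hne : good.Nonempty := ⟨Real.log K', hlogK, fun t ht x hx w =>
    hK'b t ht x hx w _ (le_add_of_nonneg_right (hb0 t ht x))⟩
  have hbdd : BddBelow good := ⟨0, fun s hs => hs.1⟩
  have hclosed : IsClosed good := by
    have : good = Ici 0 ∩ ⋂ t ∈ Icc 0 a, ⋂ x ∈ W.carrier, ⋂ w : E x,
        {s | (H t x w w).re ≤ Real.exp (s + W.barrier ρ e A δ t x) * (G t x w w).re} := by
      ext s
      simp only [hgood, mem_ofPred_eq, mem_inter_iff, mem_Ici, mem_iInter]
      rfl
    rw [this]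
    refine isClosed_Ici.inter (isClosed_biInter fun t _ => isClosed_biInter fun x _ =>
      isClosed_iInter fun w => isClosed_le continuous_const (by fun_prop))
  obtain ⟨hσ0, hσ⟩ := hclosed.csInf_mem hne hbdd
  set σ := sInf good with hσdef
  rcases hσ0.eq_or_lt with h0 | h0
  · have := hσ t ht x hx w
    rwa [← h0, zero_add] at this
  exfalso
  have hstrict : ∀ t ∈ Icc 0 a, ∀ x ∉ W.D, ∀ w : E x, w ≠ 0 →
      (H t x w w).re < Real.exp (σ + W.barrier ρ e A δ t x) * (G t x w w).re := by
    intro t ht x hx w hw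
    rcases ht.1.eq_or_lt with rfl | ht0
    · refine (hinit x hx w).trans_lt (mul_lt_mul_of_pos_right (Real.exp_lt_exp.2 ?_)
        ((hG.metric 0 ht).pos x hx w hw))
      have := mul_nonneg hδ.le (W.growth_nonneg ρ x)
      rw [barrier]
      linarith
    · exact lt_of_le_of_ne (hσ t ht x hx w)
        (W.not_touching hH hG hρ hρ1 he he2 hdz hδ hA hA0 hA' hQ hσ ht ht0 hx hw)
  -- outside of a compact set the barrier dominates the a priori bound
  set r₀ := ρ * Real.exp (-√(Real.log K' / δ)) with hr₀
  have hr₀pos : 0 < r₀ := by positivity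
  set Z : Set X := {x | r₀ ≤ W.radius x} with hZ
  have hZc : IsCompact Z := (isClosed_le continuous_const W.continuous_radius).isCompact
  have hZD : ∀ x ∈ Z, x ∉ W.D := by
    intro x hx hD
    have h1 : r₀ ≤ W.radius x := hx
    rw [W.radius_of_mem (W.D_subset hD), (W.z_eq_zero_iff (W.D_subset hD)).2 hD, norm_zero] at h1
    linarith
  have hout : ∀ t ∈ Icc 0 a, ∀ x ∉ W.D, x ∉ Z → Real.log K' ≤ W.barrier ρ e A δ t x := by
    intro t ht x hx hxZ
    have hr := W.radius_pos hx
    have h1 : W.radius x < r₀ := not_le.1 hxZ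
    have h2 : √(Real.log K' / δ) ≤ Real.log ρ - Real.log (W.radius x) := by
      have := Real.log_le_log hr h1.le
      rw [hr₀, Real.log_mul hρ.ne' (Real.exp_pos _).ne', Real.log_exp] at this
      linarith
    have h3 : Real.log K' / δ ≤ W.growth ρ x := by
      rw [growth, ← Real.sq_sqrt (div_nonneg hlogK hδ.le)]
      exact pow_le_pow_left₀ (Real.sqrt_nonneg _) (h2.trans (le_max_right _ _)) 2
    have h4 := (div_le_iff₀' hδ).1 h3
    exact h4.trans (hbnn t ht x)
  obtain ⟨σ', hσ', hin⟩ : ∃ σ' < σ, ∀ z ∈ Icc 0 a ×ˢ Z, ∀ w : E z.2, (H z.1 z.2 w w).re ≤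
      Real.exp (σ' + W.barrier ρ e A δ z.1 z.2) * (G z.1 z.2 w w).re := by
    have hmono : ∀ {s s' : ℝ}, s ≤ s' → ∀ z : ℝ × X, z ∈ Icc 0 a ×ˢ Z → ∀ w : E z.2,
        (H z.1 z.2 w w).re ≤ Real.exp (s + W.barrier ρ e A δ z.1 z.2) * (G z.1 z.2 w w).re →
        (H z.1 z.2 w w).re ≤ Real.exp (s' + W.barrier ρ e A δ z.1 z.2) * (G z.1 z.2 w w).re := by
      intro s s' hs z hz w h
      refine h.trans (mul_le_mul_of_nonneg_right (Real.exp_le_exp.2 (by linarith))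
        (hGpos z.1 hz.1 z.2 (hZD _ hz.2) w))
    have hcomp : IsCompact (Icc 0 a ×ˢ Z) := isCompact_Icc.prod hZc
    have := hcomp.induction_on (p := fun s => ∃ σ' < σ, ∀ z ∈ Icc 0 a ×ˢ Z, z ∈ s → ∀ w : E z.2,
      (H z.1 z.2 w w).re ≤ Real.exp (σ' + W.barrier ρ e A δ z.1 z.2) * (G z.1 z.2 w w).re)
      ⟨σ - 1, by linarith, fun z _ hz => absurd hz (notMem_empty z)⟩
      (fun s t hst ⟨σ', h1, h2⟩ => ⟨σ', h1, fun z hz hzs => h2 z hz (hst hzs)⟩)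
      (fun s t ⟨σ₁, h1, h2⟩ ⟨σ₂, h3, h4⟩ => ⟨max σ₁ σ₂, max_lt h1 h3, fun z hz hzs w =>
        hzs.elim (fun h => hmono (le_max_left _ _) z hz w (h2 z hz h w))
          (fun h => hmono (le_max_right _ _) z hz w (h4 z hz h w))⟩)
      (fun z hz => by
        have hzD := hZD _ hz.2
        have hb : ContinuousAt (fun z : ℝ × X => W.barrier ρ e A δ z.1 z.2) (z.1, z.2) := by
          have c1 : ContinuousAt (fun z : ℝ × X => A z.1) (z.1, z.2) :=
            ContinuousAt.comp (f := Prod.fst) (hA _ hz.1).continuousAt continuousAt_fst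
          have c2 : ContinuousAt (fun z : ℝ × X => W.decay ρ e z.2) (z.1, z.2) :=
            ContinuousAt.comp (f := Prod.snd) (W.continuous_decay ρ he).continuousAt continuousAt_snd
          have c3 : ContinuousAt (fun z : ℝ × X => W.growth ρ z.2) (z.1, z.2) :=
            ContinuousAt.comp (f := Prod.snd) (W.continuousAt_growth ρ hzD) continuousAt_snd
          exact (c1.mul c2).add (continuousAt_const.mul
            ((continuousAt_const.add (continuousAt_const.mul continuousAt_fst)).add c3))
        obtain ⟨σ', h1, h2⟩ := W.exists_lt_eventually_le hH hG hz.1 hzD hb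
          (fun w hw => hstrict z.1 hz.1 z.2 hzD w hw)
        exact ⟨_, nhdsWithin_mono _ (prod_mono subset_rfl (fun x hx => hZD x hx)) h2, σ', h1,
          fun z' _ hz' => hz'⟩)
    obtain ⟨σ', h1, h2⟩ := this
    exact ⟨σ', h1, fun z hz => h2 z hz hz⟩
  have hmem : max 0 σ' ∈ good := by
    refine ⟨le_max_left _ _, fun t ht x hx w => ?_⟩
    by_cases hxZ : x ∈ Z
    · refine (hin (t, x) ⟨ht, hxZ⟩ w).trans (mul_le_mul_of_nonneg_right (Real.exp_le_exp.2 ?_)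
        (hGpos t ht x hx w))
      have := le_max_right 0 σ'
      simp only
      linarith
    · exact hK'b t ht x hx w _ ((hout t ht x hx hxZ).trans
        (le_add_of_nonneg_left (le_max_left _ _)))
  exact absurd (csInf_le hbdd hmem) (not_le.2 (max_lt h0 hσ'))

end ACylKahler

/-! ### The energy density and the quadratic form of the mean curvature -/

section EnergyForm

variable {r : ℕ} {G F : Matrix (Fin r) (Fin r) ℂ}

theorem matEnergy_one (F : Matrix (Fin r) (Fin r) ℂ) :
    matEnergy F 1 = ∑ i, ∑ j, ‖F i j‖ ^ 2 := by
  rw [matEnergy, inv_one, Matrix.one_mul, Matrix.mul_one, Matrix.trace, Complex.re_sum]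
  refine Finset.sum_congr rfl fun i _ => ?_
  rw [Matrix.diag_apply, Matrix.mul_apply, Complex.re_sum]
  refine Finset.sum_congr rfl fun j _ => ?_
  rw [Matrix.conjTranspose_apply, RCLike.star_def, Complex.mul_conj']
  norm_cast

/-- In a frame which is unitary for `G`, the energy is the Hilbert-Schmidt norm. -/
theorem exists_unitary_model (hG : G.PosDef) (F : Matrix (Fin r) (Fin r) ℂ) :
    ∃ B F' : Matrix (Fin r) (Fin r) ℂ, IsUnit B.det ∧ G = Bᴴ * B ∧ G * F = Bᴴ * F' * B ∧
      matEnergy F G = ∑ i, ∑ j, ‖F' i j‖ ^ 2 := by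
  obtain ⟨B, hB, rfl⟩ := exists_eq_conjTranspose_mul_self hG
  refine ⟨B, B * F * B⁻¹, hB, rfl, ?_, ?_⟩
  · simp only [Matrix.mul_assoc, Matrix.nonsing_inv_mul _ hB, Matrix.mul_one]
  · have h := matEnergy_conj (F := B * F * B⁻¹) (G := 1) hB
    rw [matEnergy_one] at h
    rw [← h]
    congr 1
    · simp only [Matrix.mul_assoc, Matrix.nonsing_inv_mul _ hB, Matrix.mul_one,
        Matrix.nonsing_inv_mul_cancel_left _ _ hB]
    · rw [Matrix.mul_one]

theorem matEnergy_nonneg (hG : G.PosDef) (F : Matrix (Fin r) (Fin r) ℂ) : 0 ≤ matEnergy F G := by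
  obtain ⟨B, F', -, -, -, h⟩ := exists_unitary_model hG F
  rw [h]
  exact Finset.sum_nonneg fun i _ => Finset.sum_nonneg fun j _ => by positivity

theorem norm_form_le_sqrt_sum (F : Matrix (Fin r) (Fin r) ℂ) (x : Fin r → ℂ) :
    ‖star x ⬝ᵥ (F *ᵥ x)‖ ≤ √(∑ i, ∑ j, ‖F i j‖ ^ 2) * ∑ i, ‖x i‖ ^ 2 := by
  have hx : 0 ≤ ∑ i, ‖x i‖ ^ 2 := Finset.sum_nonneg fun _ _ => by positivity
  refine abs_le_of_sq_le_sq' ?_ (by positivity) |>.2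
  have h1 : ∑ i, ‖(F *ᵥ x) i‖ ^ 2 ≤ (∑ i, ∑ j, ‖F i j‖ ^ 2) * ∑ i, ‖x i‖ ^ 2 := by
    rw [Finset.sum_mul]
    refine Finset.sum_le_sum fun i _ => ?_
    calc ‖(F *ᵥ x) i‖ ^ 2 ≤ (∑ j, ‖F i j‖ * ‖x j‖) ^ 2 := by
          gcongr
          rw [Matrix.mulVec, dotProduct]
          refine (norm_sum_le _ _).trans (Finset.sum_le_sum fun j _ => ?_)
          rw [norm_mul]
      _ ≤ _ := Finset.sum_mul_sq_le_sq_mul_sq _ _ _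
  rw [mul_pow, Real.sq_sqrt (Finset.sum_nonneg fun i _ => Finset.sum_nonneg fun j _ => by positivity)]
  calc _ ≤ (∑ i, ‖x i‖ ^ 2) * ∑ i, ‖(F *ᵥ x) i‖ ^ 2 := norm_star_dotProduct_sq_le _ _
    _ ≤ (∑ i, ‖x i‖ ^ 2) * ((∑ i, ∑ j, ‖F i j‖ ^ 2) * ∑ i, ‖x i‖ ^ 2) := by gcongr
    _ = _ := by ring

/-- The operator norm is at most the Hilbert-Schmidt norm. -/
theorem norm_form_le_sqrt_matEnergy (hG : G.PosDef) (F : Matrix (Fin r) (Fin r) ℂ)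
    (v : Fin r → ℂ) :
    ‖star v ⬝ᵥ ((G * F) *ᵥ v)‖ ≤ √(matEnergy F G) * (star v ⬝ᵥ (G *ᵥ v)).re := by
  obtain ⟨B, F', hB, hGB, hF, hE⟩ := exists_unitary_model hG F
  have h1 : star v ⬝ᵥ (G *ᵥ v) = ((∑ i, ‖(B *ᵥ v) i‖ ^ 2 : ℝ) : ℂ) := by
    rw [hGB, star_dotProduct_factor, star_dotProduct_self_eq]
  rw [h1, Complex.ofReal_re, hF, dotProduct_conjTranspose_mul_mul, hE]
  exact norm_form_le_sqrt_sum _ _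

/-- The entries of a Hermitian matrix are controlled by its quadratic form. -/
theorem norm_apply_le_of_form_le {T : Matrix (Fin r) (Fin r) ℂ} (hT : T.IsHermitian) {k : ℝ}
    (h : ∀ x : Fin r → ℂ, |(star x ⬝ᵥ (T *ᵥ x)).re| ≤ k * ∑ i, ‖x i‖ ^ 2) (i j : Fin r) :
    ‖T i j‖ ≤ 2 * k := by
  have key : ∀ c : ℂ, ‖c‖ = 1 → |(c * T i j).re| ≤ k := by
    intro c hc
    set x : Fin r → ℂ := Pi.single i 1 with hx
    set y : Fin r → ℂ := Pi.single j c with hy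
    have hxy : star x ⬝ᵥ (T *ᵥ y) = c * T i j := by
      rw [hx, hy, ← Pi.single_star]; simp [mul_comm]
    have hyx : star y ⬝ᵥ (T *ᵥ x) = conj (c * T i j) := by
      have h2 : conj (T i j) = T j i := by
        have := congrFun (congrFun hT j) i
        rwa [Matrix.conjTranspose_apply] at this
      rw [hx, hy, ← Pi.single_star, map_mul, h2]; simp
    -- polarization
    have e1 : star (x + y) ⬝ᵥ (T *ᵥ (x + y)) - star (x - y) ⬝ᵥ (T *ᵥ (x - y)) =
        2 * (c * T i j + conj (c * T i j)) := by
      simp only [star_add, star_sub, Matrix.mulVec_add, Matrix.mulVec_sub, add_dotProduct,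
        sub_dotProduct, dotProduct_add, dotProduct_sub, hxy, hyx]
      ring
    have e2 : (∑ l, ‖(x + y) l‖ ^ 2) + ∑ l, ‖(x - y) l‖ ^ 2 = 4 := by
      have h1 : ∀ l, ‖(x + y) l‖ ^ 2 + ‖(x - y) l‖ ^ 2 = 2 * (‖x l‖ ^ 2 + ‖y l‖ ^ 2) := by
        intro l
        have := parallelogram_law_with_norm ℝ (x l) (y l)
        simp only [Pi.add_apply, Pi.sub_apply]
        nlinarith
      rw [← Finset.sum_add_distrib]
      simp only [h1]
      rw [← Finset.mul_sum, Finset.sum_add_distrib]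
      have hs : ∀ (m : Fin r) (c : ℂ), ‖c‖ = 1 →
          ∑ l, ‖(Pi.single m c : Fin r → ℂ) l‖ ^ 2 = 1 := by
        intro m c hc
        rw [Finset.sum_eq_single m]
        · simp [hc]
        · intro l _ hl; simp [hl]
        · simp
      rw [hx, hy, hs i 1 norm_one, hs j c hc]
      norm_num
    have e3 := congrArg Complex.re e1
    rw [Complex.sub_re, Complex.add_conj] at e3
    have e4 : (2 * ((2 * (c * T i j).re : ℝ) : ℂ)).re = 4 * (c * T i j).re := by
      simp; ring
    rw [e4] at e3
    have h1 := abs_le.1 (h (x + y))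
    have h2 := abs_le.1 (h (x - y))
    have e5 : k * (∑ l, ‖(x + y) l‖ ^ 2) + k * ∑ l, ‖(x - y) l‖ ^ 2 = 4 * k := by
      rw [← mul_add, e2]; ring
    rw [abs_le]
    constructor <;> linarith
  have h1 := key 1 (by simp)
  have h2 := key Complex.I (by simp)
  rw [one_mul] at h1
  rw [Complex.I_mul_re, abs_neg] at h2
  refine (Complex.norm_le_abs_re_add_abs_im _).trans ?_
  linarith

/-- The energy is controlled by the quadratic form of `-2 i F`, when this is Hermitian. -/
theorem matEnergy_le_of_form_le (hG : G.PosDef)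
    (hF : (G * ((-2 * Complex.I) • F)).IsHermitian) {k : ℝ}
    (h : ∀ v : Fin r → ℂ, |(star v ⬝ᵥ ((G * ((-2 * Complex.I) • F)) *ᵥ v)).re| ≤
      k * (star v ⬝ᵥ (G *ᵥ v)).re) : matEnergy F G ≤ r ^ 2 * k ^ 2 := by
  obtain ⟨B, F', hB, hGB, hGF, hE⟩ := exists_unitary_model hG F
  set T : Matrix (Fin r) (Fin r) ℂ := (-2 * Complex.I) • F' with hT
  have hGT : G * ((-2 * Complex.I) • F) = Bᴴ * T * B := by
    rw [Matrix.mul_smul, hGF, hT, Matrix.mul_smul, Matrix.smul_mul]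
  rw [hGT] at hF
  have hB' : IsUnit (Bᴴ).det := by rw [Matrix.det_conjTranspose]; exact hB.star
  have hTH : T.IsHermitian := by
    have h1 : T = (B⁻¹)ᴴ * (Bᴴ * T * B) * B⁻¹ := by
      rw [Matrix.conjTranspose_nonsing_inv]
      simp only [Matrix.mul_assoc, Matrix.mul_nonsing_inv _ hB, Matrix.mul_one,
        Matrix.nonsing_inv_mul_cancel_left _ _ hB']
    rw [h1]
    exact Matrix.isHermitian_conjTranspose_mul_mul _ hF
  have h2 := norm_apply_le_of_form_le hTH (k := k) (fun x => by
    have h3 := h (B⁻¹ *ᵥ x)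
    rw [hGT, dotProduct_conjTranspose_mul_mul, hGB, star_dotProduct_factor, Matrix.mulVec_mulVec,
      Matrix.mul_nonsing_inv _ hB, Matrix.one_mulVec, star_dotProduct_self_eq,
      Complex.ofReal_re] at h3
    exact h3)
  have h3 : ∀ i j, ‖F' i j‖ ≤ k := by
    intro i j
    have h4 := h2 i j
    have h5 : ‖T i j‖ = 2 * ‖F' i j‖ := by simp [hT]
    linarith
  rw [hE]
  calc _ ≤ ∑ _i : Fin r, ∑ _j : Fin r, k ^ 2 := by
        refine Finset.sum_le_sum fun i _ => Finset.sum_le_sum fun j _ => ?_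
        have := h3 i j
        gcongr
    _ = _ := by simp; ring

end EnergyForm

/-! ### Comparison of a solution with its initial value and with its time translates -/

section FlowBasics

variable {X : Type*} [TopologicalSpace X] [ChartedSpace (Fin 3 → ℂ) X]
  [IsManifold 𝓘(ℂ, Fin 3 → ℂ) ω X]
variable {r : ℕ} {E : X → Type*} [∀ x, AddCommGroup (E x)] [∀ x, Module ℂ (E x)]
  [∀ x, TopologicalSpace (E x)] [TopologicalSpace (Bundle.TotalSpace (Fin r → ℂ) E)]
  [FiberBundle (Fin r → ℂ) E] [VectorBundle ℂ (Fin r → ℂ) E]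
  {h : TangentForm X} {S : Set X} {H₀ : ∀ x, E x →ₗ⋆[ℂ] E x →ₗ[ℂ] ℂ}

theorem IsHermitianMetricOn.form_nonneg (hH : IsHermitianMetricOn r H₀ S) {x : X} (hx : x ∈ S)
    (w : E x) : 0 ≤ (H₀ x w w).re := by
  rcases eq_or_ne w 0 with rfl | hw
  · simp
  · exact (hH.pos x hx w hw).le

theorem posDef_gramAt (hH : IsHermitianMetricOn r H₀ S) {x : X} (hx : x ∈ S) :
    (gramAt r H₀ x).PosDef := by
  rw [gramAt_eq]
  exact posDef_gramPt hH (FiberBundle.mem_baseSet_trivializationAt' x) hx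

theorem form_frameVec_self (H : ∀ x, E x →ₗ⋆[ℂ] E x →ₗ[ℂ] ℂ) (x : X) (v : Fin r → ℂ) :
    H x (frameVec r x x v) (frameVec r x x v) = star v ⬝ᵥ (gramAt r H x *ᵥ v) := by
  rw [form_frameVec, gramAt_eq]

/-- A time-independent metric solves the evolution equation up to its own mean curvature. -/
theorem isPerturbedFlow_const (hH : IsHermitianMetricOn r H₀ S) (a : ℝ) :
    IsPerturbedFlow r h S a (fun _ => H₀)
      (fun _ x => -(gramAt r H₀ x * ((-2 * Complex.I) • Fhat r h H₀ x))) where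
  metric _ _ := hH
  cont x₀ i j := (hH.smooth x₀ i j).continuousOn.comp continuousOn_snd fun _ hp => hp.2
  evolution t _ x _ i j := by
    rw [add_neg_cancel]
    exact hasDerivWithinAt_const _ _ _

/-- Time translates of solutions are solutions. -/
theorem IsFlow.isPerturbedFlow_shift {T : ℝ} {H : ℝ → ∀ x, E x →ₗ⋆[ℂ] E x →ₗ[ℂ] ℂ}
    (hH : IsFlow r h S H₀ T H) {τ : ℝ} (hτ : 0 ≤ τ) :
    IsPerturbedFlow r h S (T - τ) (fun t => H (t + τ)) (fun _ _ => 0) := by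
  have hmem : ∀ t ∈ Icc 0 (T - τ), t + τ ∈ Icc 0 T := fun t ht =>
    ⟨add_nonneg ht.1 hτ, by linarith [ht.2]⟩
  refine ⟨fun t ht => hH.metric _ (hmem t ht), fun x₀ i j => ?_, fun t ht x hx i j => ?_⟩
  · exact (hH.smooth x₀ i j).continuousOn.comp
      (f := fun p : ℝ × (Fin 3 → ℂ) => (p.1 + τ, p.2)) (by fun_prop)
      fun p hp => ⟨hmem _ hp.1, hp.2⟩
  · rw [add_zero]
    have h1 := hH.evolution (t + τ) (hmem t ht) x hx i j
    have h2 : HasDerivWithinAt (fun t : ℝ => t + τ) 1 (Icc 0 (T - τ)) t :=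
      ((hasDerivAt_id t).add_const τ).hasDerivWithinAt
    have h3 := h1.scomp t h2 hmem
    rw [one_smul] at h3
    exact h3

/-- The constant of the uniform equivalence may be taken nonnegative. -/
theorem IsFlow.exists_bound {T : ℝ} {H : ℝ → ∀ x, E x →ₗ⋆[ℂ] E x →ₗ[ℂ] ℂ}
    (hH : IsFlow r h S H₀ T H) (hH₀ : IsHermitianMetricOn r H₀ S) :
    ∃ K : ℝ, 0 ≤ K ∧ ∀ t ∈ Icc 0 T, ∀ x ∈ S, ∀ v : E x,
      (H t x v v).re ≤ K * (H₀ x v v).re ∧ (H₀ x v v).re ≤ K * (H t x v v).re := by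
  obtain ⟨K, hK⟩ := hH.bounded
  refine ⟨|K|, abs_nonneg K, fun t ht x hx v => ?_⟩
  obtain ⟨h1, h2⟩ := hK t ht x hx v
  exact ⟨h1.trans (mul_le_mul_of_nonneg_right (le_abs_self K) (hH₀.form_nonneg hx v)),
    h2.trans (mul_le_mul_of_nonneg_right (le_abs_self K) ((hH.metric t ht).form_nonneg hx v))⟩

/-- The velocity of a family of Hermitian forms is Hermitian. -/
theorem IsFlow.isHermitian_velocity {T : ℝ} (hT : 0 < T)
    {H : ℝ → ∀ x, E x →ₗ⋆[ℂ] E x →ₗ[ℂ] ℂ} (hH : IsFlow r h S H₀ T H) {t : ℝ} (ht : t ∈ Icc 0 T)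
    {x : X} (hx : x ∈ S) :
    (gramAt r (H t) x * ((-2 * Complex.I) • Fhat r h (H t) x)).IsHermitian := by
  ext i j
  have h1 := (hH.evolution t ht x hx j i).star
  have h2 : HasDerivWithinAt (fun τ => gramAt r (H τ) x i j)
      (star ((gramAt r (H t) x * ((-2 * Complex.I) • Fhat r h (H t) x)) j i)) (Icc 0 T) t := by
    refine h1.congr_of_mem (fun τ hτ => ?_) ht
    exact (congrFun (congrFun (posDef_gramAt (hH.metric τ hτ) hx).isHermitian i) j).symm
  exact (uniqueDiffOn_Icc hT t ht).eq_deriv _ h2 (hH.evolution t ht x hx i j)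

/-- The energy density is a local quantity. -/
theorem energyDensity_congr {G H : ∀ x, E x →ₗ⋆[ℂ] E x →ₗ[ℂ] ℂ} (hS : IsOpen S)
    (hGH : ∀ x ∈ S, G x = H x) {x : X} (hx : x ∈ S) :
    energyDensity r h G x = energyDensity r h H x := by
  have h1 : gram r G x =ᶠ[nhds (chartAt (Fin 3 → ℂ) x x)] gram r H x := by
    filter_upwards [(isOpen_frameDomain (r := r) (E := E) x hS).mem_nhds
      (mem_frameDomain (mem_chart_source _ x)
        (FiberBundle.mem_baseSet_trivializationAt' (F := Fin r → ℂ) (E := E) x) hx)] with u hu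
    ext i j
    rw [gram, gram, hGH _ hu.2.2]
  have h2 : Fhat r h G x = Fhat r h H x := by
    simp only [Fhat, chernCurvature_eq, curvDir_congr h1]
  rw [energyDensity, energyDensity, h2, gramAt, gramAt, h1.self_of_nhds]

end FlowBasics

namespace ACylKahler

variable {X : Type*} [TopologicalSpace X] [T2Space X] [CompactSpace X]
  [ChartedSpace (Fin 3 → ℂ) X] [IsManifold 𝓘(ℂ, Fin 3 → ℂ) ω X] {W : ACylKahler X}
variable {r : ℕ} {E : X → Type*} [∀ x, AddCommGroup (E x)] [∀ x, Module ℂ (E x)]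
  [∀ x, TopologicalSpace (E x)] [TopologicalSpace (Bundle.TotalSpace (Fin r → ℂ) E)]
  [FiberBundle (Fin r → ℂ) E] [VectorBundle ℂ (Fin r → ℂ) E]
  {H₀ : ∀ x, E x →ₗ⋆[ℂ] E x →ₗ[ℂ] ℂ} {T : ℝ} {H : ℝ → ∀ x, E x →ₗ⋆[ℂ] E x →ₗ[ℂ] ℂ}

/-- Comparison of a solution with the time-independent metric `H₀`: the defect of the latter is its
mean curvature, so that `log (H_t / H₀)` is bounded by `m t exp (t / 2) Ψ`. -/
theorem flow_initial_bound (hH : IsFlow r W.h W.carrier H₀ T H)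
    (hH₀ : IsHermitianMetricOn r H₀ W.carrier)
    {ρ e : ℝ} (hρ : 0 < ρ) (hρ1 : ρ < 1) (he : 0 ≤ e) (he2 : e ≤ 1 / 2)
    (hdz : ∀ x ∉ W.D, W.radius x ≤ ρ →
      ∀ v : Fin 3 → ℂ, ‖W.dzAt x v / W.z x‖ ^ 2 ≤ 2 * (W.h x v v).re)
    {m : ℝ} (hm : 0 ≤ m) (hF : ∀ x ∉ W.D, ∀ v : Fin r → ℂ,
      |(star v ⬝ᵥ ((gramAt r H₀ x * ((-2 * Complex.I) • Fhat r W.h H₀ x)) *ᵥ v)).re| ≤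
        m * W.decay ρ e x * (star v ⬝ᵥ (gramAt r H₀ x *ᵥ v)).re)
    {t : ℝ} (ht : t ∈ Icc 0 T) {x : X} (hx : x ∉ W.D) (w : E x) :
    (H t x w w).re ≤ Real.exp (m * t * Real.exp (t / 2) * W.decay ρ e x) * (H₀ x w w).re ∧
    (H₀ x w w).re ≤ Real.exp (m * t * Real.exp (t / 2) * W.decay ρ e x) * (H t x w w).re := by
  obtain ⟨K, -, hK⟩ := hH.exists_bound hH₀
  have p1 : IsPerturbedFlow r W.h W.carrier T H (fun _ _ => 0) := by
    simpa using hH.isPerturbedFlow_shift le_rfl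
  have p2 := isPerturbedFlow_const (h := W.h) hH₀ T
  -- `A(t) = m t exp (t / 2)` satisfies `A(0) = 0` and `A' - A / 2 = m exp (t / 2) ≥ m`
  have hA : ∀ t ∈ Icc 0 T, HasDerivAt (fun t => m * t * Real.exp (t / 2))
      (m * Real.exp (t / 2) + m * t * (Real.exp (t / 2) * (1 / 2))) t := by
    intro t _
    have h1 : HasDerivAt (fun t : ℝ => m * t) m t := by
      simpa using (hasDerivAt_id t).const_mul m
    exact h1.fun_mul (((hasDerivAt_id t).div_const 2).exp)
  have hA0 : ∀ t ∈ Icc 0 T, 0 ≤ m * t * Real.exp (t / 2) := fun t ht =>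
    mul_nonneg (mul_nonneg hm ht.1) (Real.exp_pos _).le
  have hA' : ∀ t ∈ Icc 0 T, m ≤ m * Real.exp (t / 2) + m * t * (Real.exp (t / 2) * (1 / 2)) -
      m * t * Real.exp (t / 2) / 2 := by
    intro t ht
    have h1 : 1 ≤ Real.exp (t / 2) := Real.one_le_exp (by linarith [ht.1])
    have := mul_le_mul_of_nonneg_left h1 hm
    linarith
  have hdef : ∀ x ∉ W.D, ∀ v : Fin r → ℂ, v ≠ 0 →
      |(star v ⬝ᵥ ((-(gramAt r H₀ x * ((-2 * Complex.I) • Fhat r W.h H₀ x))) *ᵥ v)).re /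
        (star v ⬝ᵥ (gramAt r H₀ x *ᵥ v)).re| ≤ m * W.decay ρ e x := by
    intro x hx v hv
    have hpos := form_re_pos (posDef_gramAt hH₀ hx) hv
    rw [abs_div, abs_of_pos hpos, div_le_iff₀ hpos, Matrix.neg_mulVec, dotProduct_neg,
      Complex.neg_re, abs_neg]
    exact hF x hx v
  constructor
  · refine W.comparison (A := fun t => m * t * Real.exp (t / 2)) p1 p2 hρ hρ1 he he2 hdz hA hA0 hA'
      (fun t _ x hx v hv => ?_) (fun t ht x hx w => (hK t ht x hx w).1) (fun x hx w => ?_) ht hx w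
    · rw [Matrix.zero_mulVec, dotProduct_zero, Complex.zero_re, zero_div, zero_sub]
      exact (neg_le_abs _).trans (hdef x hx v hv)
    · simp [hH.initial x hx]
  · refine W.comparison (A := fun t => m * t * Real.exp (t / 2)) p2 p1 hρ hρ1 he he2 hdz hA hA0 hA'
      (fun t _ x hx v hv => ?_) (fun t ht x hx w => (hK t ht x hx w).2) (fun x hx w => ?_) ht hx w
    · rw [Matrix.zero_mulVec, dotProduct_zero, Complex.zero_re, zero_div, sub_zero]
      exact (le_abs_self _).trans (hdef x hx v hv)
    · simp [hH.initial x hx]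

/-- Comparison of a solution with its translate by `τ`: the bound of `log (H_τ / H₀)` by
`m τ exp (τ / 2) Ψ` propagates, up to a factor `exp (t / 2)`. -/
theorem flow_shift_bound (hH : IsFlow r W.h W.carrier H₀ T H)
    (hH₀ : IsHermitianMetricOn r H₀ W.carrier)
    {ρ e : ℝ} (hρ : 0 < ρ) (hρ1 : ρ < 1) (he : 0 ≤ e) (he2 : e ≤ 1 / 2)
    (hdz : ∀ x ∉ W.D, W.radius x ≤ ρ →
      ∀ v : Fin 3 → ℂ, ‖W.dzAt x v / W.z x‖ ^ 2 ≤ 2 * (W.h x v v).re)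
    {m : ℝ} (hm : 0 ≤ m) (hF : ∀ x ∉ W.D, ∀ v : Fin r → ℂ,
      |(star v ⬝ᵥ ((gramAt r H₀ x * ((-2 * Complex.I) • Fhat r W.h H₀ x)) *ᵥ v)).re| ≤
        m * W.decay ρ e x * (star v ⬝ᵥ (gramAt r H₀ x *ᵥ v)).re)
    {s t : ℝ} (hs : 0 ≤ s) (hst : s ≤ t) (ht : t ≤ T) {x : X} (hx : x ∉ W.D) (w : E x) :
    (H t x w w).re ≤
      Real.exp (m * Real.exp (t / 2) * W.decay ρ e x * (t - s)) * (H s x w w).re ∧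
    (H s x w w).re ≤
      Real.exp (m * Real.exp (t / 2) * W.decay ρ e x * (t - s)) * (H t x w w).re := by
  obtain ⟨K, hK0, hK⟩ := hH.exists_bound hH₀
  obtain ⟨τ, hτ⟩ : ∃ τ, τ = t - s := ⟨_, rfl⟩
  have hτ0 : 0 ≤ τ := by linarith
  have p1 : IsPerturbedFlow r W.h W.carrier (T - τ) (fun t => H (t + τ)) (fun _ _ => 0) :=
    hH.isPerturbedFlow_shift hτ0
  have p2 : IsPerturbedFlow r W.h W.carrier (T - τ) H (fun _ _ => 0) := by
    have h1 : IsPerturbedFlow r W.h W.carrier T H (fun _ _ => 0) := by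
      simpa using hH.isPerturbedFlow_shift le_rfl
    have hsub : Icc 0 (T - τ) ⊆ Icc 0 T := Icc_subset_Icc le_rfl (by linarith)
    exact ⟨fun t ht => h1.metric t (hsub ht),
      fun x₀ i j => (h1.cont x₀ i j).mono (prod_mono hsub subset_rfl),
      fun t ht x hx i j => (h1.evolution t (hsub ht) x hx i j).mono hsub⟩
  -- `A(t) = L exp (t / 2)` satisfies `A' = A / 2`, and `A(0) = L` is the bound at time `τ`
  obtain ⟨L, hL⟩ : ∃ L, L = m * τ * Real.exp (τ / 2) := ⟨_, rfl⟩
  have hL0 : 0 ≤ L := by rw [hL]; positivity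
  have hA : ∀ t ∈ Icc 0 (T - τ), HasDerivAt (fun t => L * Real.exp (t / 2))
      (L * (Real.exp (t / 2) * (1 / 2))) t := fun t _ =>
    (((hasDerivAt_id t).div_const 2).exp).const_mul L
  have hA0 : ∀ t ∈ Icc 0 (T - τ), 0 ≤ L * Real.exp (t / 2) := fun t _ =>
    mul_nonneg hL0 (Real.exp_pos _).le
  have hA' : ∀ t ∈ Icc 0 (T - τ),
      0 ≤ L * (Real.exp (t / 2) * (1 / 2)) - L * Real.exp (t / 2) / 2 := fun t _ => by
    linarith
  have hτT : τ ∈ Icc 0 T := ⟨hτ0, by linarith⟩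
  have hKK : ∀ s ∈ Icc 0 T, ∀ t ∈ Icc 0 T, ∀ x ∉ W.D, ∀ w : E x,
      (H s x w w).re ≤ K * K * (H t x w w).re := by
    intro s hs t ht x hx w
    have := mul_le_mul_of_nonneg_left (hK t ht x hx w).2 hK0
    linarith [(hK s hs x hx w).1]
  have hmem : ∀ t ∈ Icc 0 (T - τ), t + τ ∈ Icc 0 T ∧ t ∈ Icc 0 T := fun t ht =>
    ⟨⟨add_nonneg ht.1 hτ0, by linarith [ht.2]⟩, ht.1, by linarith [ht.2]⟩
  have hs' : s ∈ Icc 0 (T - τ) := ⟨hs, by linarith⟩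
  have hz : ∀ t ∈ Icc 0 (T - τ), ∀ x ∉ W.D, ∀ v : Fin r → ℂ, ∀ a b : ℝ,
      (star v ⬝ᵥ ((0 : Matrix (Fin r) (Fin r) ℂ) *ᵥ v)).re / a -
        (star v ⬝ᵥ ((0 : Matrix (Fin r) (Fin r) ℂ) *ᵥ v)).re / b ≤ 0 * W.decay ρ e x := by
    intro t _ x _ v a b
    simp
  have hexp : L * Real.exp (s / 2) * W.decay ρ e x =
      m * Real.exp (t / 2) * W.decay ρ e x * (t - s) := by
    have : Real.exp (t / 2) = Real.exp (τ / 2) * Real.exp (s / 2) := by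
      rw [← Real.exp_add]; congr 1; rw [hτ]; ring
    rw [hL, this, hτ]; ring
  have hts : s + τ = t := by linarith
  constructor
  · have := W.comparison (A := fun t => L * Real.exp (t / 2)) p1 p2 hρ hρ1 he he2 hdz hA hA0 hA'
      (fun t ht x hx v _ => hz t ht x hx v _ _)
      (fun t ht x hx w => hKK _ (hmem t ht).1 _ (hmem t ht).2 x hx w) (fun x hx w => by
        have := (flow_initial_bound hH hH₀ hρ hρ1 he he2 hdz hm hF hτT hx w).1
        simpa [hL, hH.initial x hx] using this) hs' hx w
    rwa [hts, hexp] at this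
  · have := W.comparison (A := fun t => L * Real.exp (t / 2)) p2 p1 hρ hρ1 he he2 hdz hA hA0 hA'
      (fun t ht x hx v _ => hz t ht x hx v _ _)
      (fun t ht x hx w => hKK _ (hmem t ht).2 _ (hmem t ht).1 x hx w) (fun x hx w => by
        have := (flow_initial_bound hH hH₀ hρ hρ1 he he2 hdz hm hF hτT hx w).2
        simpa [hL, hH.initial x hx] using this) hs' hx w
    rwa [hts, hexp] at this

/-- Dividing the bound of `log (H_t / H_s)` by `t - s` bounds the velocity, that is the mean
curvature, of a solution. -/
theorem flow_meanCurvature_le (hH : IsFlow r W.h W.carrier H₀ T H)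
    (hH₀ : IsHermitianMetricOn r H₀ W.carrier)
    {ρ e : ℝ} (hρ : 0 < ρ) (hρ1 : ρ < 1) (he : 0 ≤ e) (he2 : e ≤ 1 / 2)
    (hdz : ∀ x ∉ W.D, W.radius x ≤ ρ →
      ∀ v : Fin 3 → ℂ, ‖W.dzAt x v / W.z x‖ ^ 2 ≤ 2 * (W.h x v v).re)
    {m : ℝ} (hm : 0 ≤ m) (hF : ∀ x ∉ W.D, ∀ v : Fin r → ℂ,
      |(star v ⬝ᵥ ((gramAt r H₀ x * ((-2 * Complex.I) • Fhat r W.h H₀ x)) *ᵥ v)).re| ≤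
        m * W.decay ρ e x * (star v ⬝ᵥ (gramAt r H₀ x *ᵥ v)).re)
    {t : ℝ} (ht : t ∈ Icc 0 T) (ht0 : 0 < t) {x : X} (hx : x ∉ W.D) (v : Fin r → ℂ) :
    |(star v ⬝ᵥ ((gramAt r (H t) x * ((-2 * Complex.I) • Fhat r W.h (H t) x)) *ᵥ v)).re| ≤
      m * Real.exp (t / 2) * W.decay ρ e x * (star v ⬝ᵥ (gramAt r (H t) x *ᵥ v)).re := by
  rcases eq_or_ne v 0 with rfl | hv
  · simp
  have hpos : ∀ s ∈ Icc 0 T, 0 < (star v ⬝ᵥ (gramAt r (H s) x *ᵥ v)).re := fun s hs =>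
    form_re_pos (posDef_gramAt (hH.metric s hs) hx) hv
  obtain ⟨k, hk⟩ : ∃ k, k = m * Real.exp (t / 2) * W.decay ρ e x := ⟨_, rfl⟩
  have hsub : Icc 0 t ⊆ Icc 0 T := Icc_subset_Icc le_rfl ht.2
  have hd := ((hasDerivWithinAt_form (hH.evolution t ht x hx) v).log (hpos t ht).ne').mono hsub
  have hlin : HasDerivWithinAt (fun s => k * s) k (Icc 0 t) t := by
    simpa using ((hasDerivAt_id t).const_mul k).hasDerivWithinAt (s := Icc 0 t)
  have hlog : ∀ s ∈ Icc 0 t,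
      Real.log (star v ⬝ᵥ (gramAt r (H t) x *ᵥ v)).re ≤
        k * (t - s) + Real.log (star v ⬝ᵥ (gramAt r (H s) x *ᵥ v)).re ∧
      Real.log (star v ⬝ᵥ (gramAt r (H s) x *ᵥ v)).re ≤
        k * (t - s) + Real.log (star v ⬝ᵥ (gramAt r (H t) x *ᵥ v)).re := by
    intro s hs
    obtain ⟨h1, h2⟩ := flow_shift_bound hH hH₀ hρ hρ1 he he2 hdz hm hF hs.1 hs.2 ht.2 hx
      (frameVec r x x v)
    rw [form_frameVec_self, form_frameVec_self, ← hk] at h1 h2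
    have p1 := hpos t ht
    have p2 := hpos s (hsub hs)
    have h3 := Real.log_le_log p1 h1
    have h4 := Real.log_le_log p2 h2
    rw [Real.log_mul (Real.exp_pos _).ne' p2.ne', Real.log_exp] at h3
    rw [Real.log_mul (Real.exp_pos _).ne' p1.ne', Real.log_exp] at h4
    exact ⟨h3, h4⟩
  have htt : t ∈ Icc 0 t := ⟨ht.1, le_rfl⟩
  -- `k s ∓ log (H_s(v,v))` is largest at `s = t`
  have n1 := deriv_nonneg_of_isMax htt ht0 (hlin.sub hd) (by
    intro s hs
    have := (hlog s hs).1
    simp only [Pi.sub_apply]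
    linarith)
  have n2 := deriv_nonneg_of_isMax htt ht0 (hlin.add hd) (by
    intro s hs
    have := (hlog s hs).2
    simp only [Pi.add_apply]
    linarith)
  rw [← hk, ← div_le_iff₀ (hpos t ht), ← abs_of_pos (hpos t ht), ← abs_div, abs_le]
  constructor <;> linarith

/-- The decay rate of the energy density is preserved by the evolution equation. The constant
`C = 1 + 4 r² / ρ` only depends on the rank and on the radius `ρ` from which on `log |z|` has gradient
of length at most `√2`. -/
theorem exists_energyDensity_flow_le (W : ACylKahler X) (r : ℕ) : ∃ C : ℝ, 1 ≤ C ∧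
    ∀ (E : X → Type*) [∀ x, AddCommGroup (E x)] [∀ x, Module ℂ (E x)]
      [∀ x, TopologicalSpace (E x)] [TopologicalSpace (Bundle.TotalSpace (Fin r → ℂ) E)]
      [FiberBundle (Fin r → ℂ) E] [VectorBundle ℂ (Fin r → ℂ) E]
      (H₀ : ∀ x, E x →ₗ⋆[ℂ] E x →ₗ[ℂ] ℂ), IsHermitianMetricOn r H₀ W.carrier →
      ∀ μ : ℝ, 0 < μ → μ ≤ 1 → ∀ B : ℝ,
        (∀ x ∈ W.carrier, energyDensity r W.h H₀ x ≤ B * W.ε x ^ μ) →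
        ∀ (T : ℝ) (H : ℝ → ∀ x, E x →ₗ⋆[ℂ] E x →ₗ[ℂ] ℂ), 0 < T →
          IsFlow r W.h W.carrier H₀ T H →
          ∀ t ∈ Icc 0 T, ∀ x ∈ W.carrier,
            energyDensity r W.h (H t) x ≤ C * B * Real.exp t * W.ε x ^ μ := by
  obtain ⟨ρ, hρ, hρ1, hdz⟩ := W.exists_norm_dz_div_z_sq_le
  have hC1 : (1 : ℝ) ≤ 1 + 4 * r ^ 2 / ρ := le_add_of_nonneg_right (by positivity)
  refine ⟨1 + 4 * r ^ 2 / ρ, hC1, ?_⟩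
  intro E _ _ _ _ _ _ H₀ hH₀ μ hμ hμ1 B hB T H hT hH t ht x hx
  have hεpos : ∀ {x : X}, x ∉ W.D → 0 < W.ε x ^ μ := fun hx => by
    rw [W.ε_eq_radius hx]; exact Real.rpow_pos_of_pos (W.radius_pos hx) _
  have hB0 : 0 ≤ B := by
    have h1 := (matEnergy_nonneg (posDef_gramAt hH₀ hx) (Fhat r W.h H₀ x)).trans (hB x hx)
    exact nonneg_of_mul_nonneg_left h1 (hεpos hx)
  have hBC : B ≤ (1 + 4 * r ^ 2 / ρ) * B := le_mul_of_one_le_left hB0 hC1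
  have hexp : 1 ≤ Real.exp t := Real.one_le_exp ht.1
  have hCB : 0 ≤ (1 + 4 * r ^ 2 / ρ) * B := hB0.trans hBC
  -- at time `0` there are no left differences, but `H 0 = H₀`
  rcases ht.1.eq_or_lt with rfl | ht0
  · rw [energyDensity_congr W.isOpen_carrier hH.initial hx]
    refine (hB x hx).trans (mul_le_mul_of_nonneg_right ?_ (hεpos hx).le)
    exact hBC.trans (le_mul_of_one_le_right hCB hexp)
  -- the hypothesis in terms of the barrier, with `m = 2 √B` and exponent `μ / 2`
  have hF : ∀ x ∉ W.D, ∀ v : Fin r → ℂ,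
      |(star v ⬝ᵥ ((gramAt r H₀ x * ((-2 * Complex.I) • Fhat r W.h H₀ x)) *ᵥ v)).re| ≤
        2 * √B * W.decay ρ (μ / 2) x * (star v ⬝ᵥ (gramAt r H₀ x *ᵥ v)).re := by
    intro x hx v
    have hG := posDef_gramAt hH₀ hx
    have hr := W.radius_pos hx
    have h1 : √(matEnergy (Fhat r W.h H₀ x) (gramAt r H₀ x)) ≤ √B * W.radius x ^ (μ / 2) := by
      refine (Real.sqrt_le_sqrt (hB x hx)).trans_eq ?_
      rw [Real.sqrt_mul hB0, W.ε_eq_radius hx, Real.sqrt_eq_rpow (W.radius x ^ μ),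
        ← Real.rpow_mul hr.le]
      congr 2
      ring
    have h2 : W.radius x ^ (μ / 2) ≤ W.decay ρ (μ / 2) x := by
      refine le_min (Real.rpow_le_one hr.le (W.radius_le_one x) (by positivity))
        (Real.rpow_le_rpow hr.le ?_ (by positivity))
      exact le_div_self hr.le hρ hρ1.le
    have h3 := norm_form_le_sqrt_matEnergy hG (Fhat r W.h H₀ x) v
    calc _ ≤ ‖star v ⬝ᵥ ((gramAt r H₀ x * ((-2 * Complex.I) • Fhat r W.h H₀ x)) *ᵥ v)‖ :=
          Complex.abs_re_le_norm _
      _ = 2 * ‖star v ⬝ᵥ ((gramAt r H₀ x * Fhat r W.h H₀ x) *ᵥ v)‖ := by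
          rw [Matrix.mul_smul, Matrix.smul_mulVec, dotProduct_smul, norm_smul]
          simp
      _ ≤ 2 * (√B * W.decay ρ (μ / 2) x * (star v ⬝ᵥ (gramAt r H₀ x *ᵥ v)).re) := by
          refine mul_le_mul_of_nonneg_left (h3.trans ?_) zero_le_two
          exact mul_le_mul_of_nonneg_right
            (h1.trans (mul_le_mul_of_nonneg_left h2 (Real.sqrt_nonneg B))) (form_re_nonneg hG v)
      _ = _ := by ring
  have h1 := matEnergy_le_of_form_le (posDef_gramAt (hH.metric t ht) hx)
    (hH.isHermitian_velocity hT ht hx) (fun v => flow_meanCurvature_le hH hH₀ hρ hρ1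
      (e := μ / 2) (by positivity) (by linarith) hdz (by positivity) hF ht ht0 hx v)
  have hr := W.radius_pos hx
  -- `Ψ² ≤ (ε / ρ) ^ μ ≤ ε ^ μ / ρ`, with a constant independent of `μ ≤ 1`
  have h2 : W.decay ρ (μ / 2) x ^ 2 ≤ W.ε x ^ μ / ρ := by
    calc W.decay ρ (μ / 2) x ^ 2 ≤ ((W.radius x / ρ) ^ (μ / 2)) ^ 2 :=
          pow_le_pow_left₀ (W.decay_nonneg hρ _ x) (min_le_right _ _) 2
      _ = W.ε x ^ μ / ρ ^ μ := by
          rw [← Real.rpow_natCast, ← Real.rpow_mul (by positivity), Real.div_rpow hr.le hρ.le,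
            W.ε_eq_radius hx]
          norm_num
      _ ≤ W.ε x ^ μ / ρ := by
          refine div_le_div_of_nonneg_left (hεpos hx).le hρ ?_
          simpa using Real.rpow_le_rpow_of_exponent_ge hρ hρ1.le hμ1
  have h3 : (2 * √B * Real.exp (t / 2) * W.decay ρ (μ / 2) x) ^ 2 =
      4 * B * Real.exp t * W.decay ρ (μ / 2) x ^ 2 := by
    rw [mul_pow, mul_pow, mul_pow, Real.sq_sqrt hB0, ← Real.exp_nat_mul]
    norm_num
    left; left
    ring
  rw [h3] at h1
  calc energyDensity r W.h (H t) x ≤ r ^ 2 * (4 * B * Real.exp t * W.decay ρ (μ / 2) x ^ 2) := h1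
    _ ≤ r ^ 2 * (4 * B * Real.exp t * (W.ε x ^ μ / ρ)) := by gcongr
    _ = 4 * r ^ 2 / ρ * (B * Real.exp t * W.ε x ^ μ) := by ring
    _ ≤ (1 + 4 * r ^ 2 / ρ) * (B * Real.exp t * W.ε x ^ μ) := by
        refine mul_le_mul_of_nonneg_right (by linarith) ?_
        have := (hεpos hx).le
        positivity
    _ = _ := by ring

end ACylKahler

end

theorem mainTheorem7 {X : Type*} [TopologicalSpace X] [T2Space X] [CompactSpace X]
    [ChartedSpace (Fin 3 → ℂ) X] [IsManifold 𝓘(ℂ, Fin 3 → ℂ) ω X]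
    (W : ACylKahler X) (r : ℕ) :
    ∃ C : ℝ, 1 ≤ C ∧
      ∀ (E : X → Type*) [∀ x, AddCommGroup (E x)] [∀ x, Module ℂ (E x)]
        [∀ x, TopologicalSpace (E x)] [TopologicalSpace (Bundle.TotalSpace (Fin r → ℂ) E)]
        [FiberBundle (Fin r → ℂ) E] [VectorBundle ℂ (Fin r → ℂ) E]
        [ContMDiffVectorBundle ω (Fin r → ℂ) E 𝓘(ℂ, Fin 3 → ℂ)]
        (H₀ : ∀ x, E x →ₗ⋆[ℂ] E x →ₗ[ℂ] ℂ), W.IsReferenceMetric r H₀ →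
        (∃ B : ℝ, ∀ x ∈ W.carrier,
          energyDensity r W.h H₀ x ≤ B * W.ε x ^ min 1 (2 * W.rate)) ∧
        (∀ μ : ℝ, 0 < μ → μ ≤ 1 → ∀ B : ℝ,
          (∀ x ∈ W.carrier, energyDensity r W.h H₀ x ≤ B * W.ε x ^ μ) →
          ∀ (T : ℝ) (H : ℝ → ∀ x, E x →ₗ⋆[ℂ] E x →ₗ[ℂ] ℂ), 0 < T →
            IsFlow r W.h W.carrier H₀ T H →
            ∀ t ∈ Icc 0 T, ∀ x ∈ W.carrier,
              energyDensity r W.h (H t) x ≤ C * B * Real.exp t * W.ε x ^ μ) ∧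
        (∃ B : ℝ, ∀ (T : ℝ) (H : ℝ → ∀ x, E x →ₗ⋆[ℂ] E x →ₗ[ℂ] ℂ), 0 < T →
            IsFlow r W.h W.carrier H₀ T H →
            ∀ t ∈ Icc 0 T, ∀ x ∈ W.carrier ∩ W.U,
              √(energyDensity r W.h (H t) x) ≤
                B * Real.exp (t / 2) * Real.exp (-(min 1 (2 * W.rate) / 2) * W.s x)) := by
  obtain ⟨C, hC, hflow⟩ := ACylKahler.exists_energyDensity_flow_le W r
  refine ⟨C, hC, fun E _ _ _ _ _ _ _ H₀ hH => ?_⟩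
  have hH₀ : IsHermitianMetricOn r H₀ W.carrier := hH.metric.mono (subset_univ _)
  have h1 := W.exists_energyDensity_le hH
  refine ⟨h1, fun μ hμ hμ1 B hB => hflow E H₀ hH₀ μ hμ hμ1 B hB, ?_⟩
  obtain ⟨B, hB⟩ := h1
  have hμ : 0 < min 1 (2 * W.rate) := lt_min one_pos (mul_pos two_pos W.rate_pos)
  refine ⟨√(C * B), fun T H hT hHt t ht x hx => ?_⟩
  have h2 := hflow E H₀ hH₀ _ hμ (min_le_left _ _) B hB T H hT hHt t ht x hx.1
  have h3 : W.ε x = Real.exp (-W.s x) := if_pos hx.2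
  rw [h3, ← Real.exp_mul, mul_assoc, ← Real.exp_add] at h2
  refine (Real.sqrt_le_sqrt h2).trans_eq ?_
  rw [Real.sqrt_mul' _ (Real.exp_pos _).le, mul_assoc, ← Real.exp_add, Real.sqrt_eq_rpow (Real.exp _),
    ← Real.exp_mul]
  congr 2
  ring
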